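/- **Setting.** A locally convex super-vector space is a Hausdorff locally convex complex vector space $V$ with a topological direct sum decomposition $V=V_{\bar 0}\oplus V_{\bar 1}$. A *cs* supergroup pair $(\mathfrak g,G_0)$ consists of a finite-dimensional complex Lie superalgebra $\mathfrak g$ and a real Lie group $G_0$ whose Lie algebra $\mathfrak g_{\bar 0,\mathbb R}$ is a real form of $\mathfrak g_{\bar 0}$, together with a smooth action $\mathrm{Ad}$ of $G_0$ on $\mathfrak g$ by even automorphisms, which extends the adjoint action and whose differential is the bracket. A smooth representation $(\pi_0,\pi_{\mathfrak g})$ of $(\mathfrak g,G_0)$ on $V$ consists of a group homomorphism $\pi_0$ from $G_0$ to the even linear automorphisms of $V$ and a Lie superalgebra morphism $\pi_{\mathfrak g}:\mathfrak g\to\mathfrak{gl}(V)$, such that both actions $G_0\times V\to V$ and $\mathfrak g\times V\to V$ are continuous, all maps $g\mapsto\pi_0(g)v$ are smooth, $\partial_t|_0\,\pi_0(e^{tx})v=\pi_{\mathfrak g}(x)v$ for $x\in\mathfrak g_{\bar 0,\mathbb R}$, and $\pi_{\mathfrak g}(\mathrm{Ad}(g)x)=\pi_0(g)\pi_{\mathfrak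 g}(x)\pi_0(g)^{-1}$. **Induced representations.** Let $(\mathfrak h,H_0)$ be a subpair of $(\mathfrak g,G_0)$ and $W$ a smooth $(\mathfrak h,H_0)$-representation. Then $\mathrm{Ind}_{\mathfrak h,H_0}^{\mathfrak g,G_0}(W)$ is the space of all linear maps $f:\mathfrak U(\mathfrak g)\to C^\infty(G_0,W)$ such that $$f(yu)(p)=\partial_t|_0 f(u)(pe^{ty}),\qquad f(u)(p)=\pi_0(h)\bigl(f(\mathrm{Ad}(h^{-1})u)(ph)\bigr),\qquad f(uz)(p)=-(-1)^{|z|(|u|+|f|)}\pi_{\mathfrak h}(z)\bigl(f(u)(p)\bigr)$$ for $u\in\mathfrak U(\mathfrak g)$, $p\in G_0$, $y\in\mathfrak g_{\bar 0,\mathbb R}$, $h\in H_0$, $z\in\mathfrak h$ (with signs extended linearly from homogeneous elements), with the topology of uniform convergence of $f(u)$ on compact subsets of $G_0$ for every $u$, and with the action $(\rho_0(g)f)(u)(p)=f(u)(g^{-1}p)$, $(\rho_{\mathfrak g}(x)f)(u)(p)=-(-1)^{|f||x|}f(\mathrm{Ad}(p^{-1})(x)u)(p)$. **Data.** Let $(\mathfrak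 g,\theta)$ be a reductive symmetric superpair: $\theta$ is an involutive automorphism of $\mathfrak g$; $\mathfrak g$ is a semi-simple $\mathfrak g_{\bar 0}$-module; $\mathfrak z(\mathfrak g)\subseteq\mathfrak g_{\bar 0}$; and there is a $\mathfrak g$- and $\theta$-invariant, non-degenerate, even, supersymmetric bilinear form on $\mathfrak g$. Put $\mathfrak k=\ker(\theta-1)$, $\mathfrak p=\ker(\theta+1)$. Let $(\mathfrak g,G_0,\theta)$ be a non-compact global *cs* form: $(\mathfrak g,G_0)$ is a *cs* supergroup pair; $\mathfrak g_{\bar 0,\mathbb R}$ is $\theta$-invariant and $b$-non-degenerate for some form $b$ as above; $\theta$ is also an involutive automorphism of $G_0$ with differential $\theta|_{\mathfrak g_{\bar 0,\mathbb R}}$ and $\mathrm{Ad}(\theta(g))=\theta\,\mathrm{Ad}(g)\,\theta$; with $\mathfrak k_{\bar 0,\mathbb R}=\mathfrak k\cap\mathfrak g_{\bar 0,\mathbb R}$ and $\mathfrak p_{\bar 0,\mathbb R}=\mathfrak p\cap\mathfrak g_{\bar 0,\mathbb R}$, the space $\mathfrak k_{\bar 0,\mathbb R}\oplus i\mathfrak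 p_{\bar 0,\mathbb R}$ is a real form of $\mathfrak g_{\bar 0}$ whose image under $\mathrm{ad}_{\mathfrak g}$ generates a compact analytic subgroup of $\mathrm{GL}(\mathfrak g)$; and $\mathrm{Ad}_{\mathfrak g}(K_0)$ is compact, $K_0$ being the analytic subgroup of $G_0$ with Lie algebra $\mathfrak k_{\bar 0,\mathbb R}$. Let $\mathfrak a_{\mathbb R}\subseteq\mathfrak p_{\bar 0,\mathbb R}$ be a real subspace whose complexification $\mathfrak a$ is an even Cartan subspace, i.e. $\mathfrak a\subseteq\mathfrak p_{\bar 0}$ is Abelian, consists of semi-simple elements of $\mathfrak g_{\bar 0}$, and $\mathfrak p=\mathfrak a+[\mathfrak k,\mathfrak a]$. For $\lambda\in\mathfrak a^*$ let $\mathfrak g^\lambda=\{x\in\mathfrak g:[h,x]=\lambda(h)x\ \forall h\in\mathfrak a\}$, let $\Sigma=\{\lambda\neq0:\mathfrak g^\lambda\neq0\}$, and let $\Sigma^+$ be a positive system: $\Sigma=\Sigma^+\,\dot\cup\,(-\Sigma^+)$ and $\Sigma\cap(\Sigma^++\Sigma^+)\subseteq\Sigma^+$. Put $\mathfrak n=\bigoplus_{\lambda\in\Sigma^+}\mathfrak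 g^\lambda$, and let $A$, $N_0$ be the analytic subgroups of $G_0$ with Lie algebras $\mathfrak a_{\mathbb R}$, $\mathfrak n\cap\mathfrak g_{\bar 0,\mathbb R}$. Assume the global Iwasawa decomposition: multiplication $K_0\times A\times N_0\to G_0$ is a diffeomorphism. Finally let $\mathfrak m=\mathfrak z_{\mathfrak k}(\mathfrak a)$, $M_0=Z_{K_0}(\mathfrak a)$, and let $(\mathfrak q,Q_0)$, $\mathfrak q=\mathfrak m\oplus\mathfrak a\oplus\mathfrak n$, $Q_0=M_0AN_0$, be the minimal parabolic subpair. **Proposition.** Let $V$ be a locally convex super-vector space with a smooth representation of $(\mathfrak g,G_0)$. Then $\mathrm{Ind}^{\mathfrak g,G_0}_{\mathfrak q,Q_0}(V)$, restricted to $(\mathfrak k,K_0)$, and $\mathrm{Ind}^{\mathfrak k,K_0}_{\mathfrak m,M_0}(V)$ are smooth $(\mathfrak k,K_0)$-representations on locally convex super-vector spaces, and the restriction of $f$ to $\mathfrak U(\mathfrak k)\to\mathfrak U(\mathfrak g)$ and $K_0\subseteq G_0$ defines an isomorphism of smooth $(\mathfrak k,K_0)$-representations (an even, equivariant, linear homeomorphism)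 $$\mathrm{Ind}^{\mathfrak g,G_0}_{\mathfrak q,Q_0}(V)\;\cong\;\mathrm{Ind}^{\mathfrak k,K_0}_{\mathfrak m,M_0}(V).$$ -/

import Mathlib

open scoped Manifold ContDiff Topology

namespace CsSuper

noncomputable section

set_option linter.unusedSectionVars false

/-! ### Super-vector spaces -/

/-- The sign `(-1)^{ij}` for parities `i, j`. -/
def koszulSign (i j : ZMod 2) : ℂ := if i = 1 ∧ j = 1 then -1 else 1

/-- A complex super-vector space `V = V₀ ⊕ V₁`. The grading is encoded by its parity involution
`γ`, which is `1` on `V₀` and `-1` on `V₁`. -/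
class SuperModule (V : Type*) [AddCommGroup V] [Module ℂ V] where
  parity : V →ₗ[ℂ] V
  parity_parity : ∀ v, parity (parity v) = v

namespace SuperModule

variable {V : Type*} [AddCommGroup V] [Module ℂ V] [SuperModule V]

/-- The homogeneous part `V_i`, i.e. the `(-1)^i`-eigenspace of the parity involution. -/
def part (V : Type*) [AddCommGroup V] [Module ℂ V] [SuperModule V] (i : ZMod 2) :
    Submodule ℂ V where
  carrier := {v | parity v = koszulSign i 1 • v}
  zero_mem' := by simp
  add_mem' := by
    intro a b ha hb
    simp only [Set.mem_ofPred_eq] at *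
    rw [map_add, ha, hb, smul_add]
  smul_mem' := by
    intro c a ha
    simp only [Set.mem_ofPred_eq] at *
    rw [map_smul, ha, smul_comm]

theorem mem_part {i : ZMod 2} {v : V} : v ∈ part V i ↔ parity v = koszulSign i 1 • v := Iff.rfl

theorem parity_mem_part {i : ZMod 2} {v : V} (h : v ∈ part V i) : parity v ∈ part V i := by
  rw [mem_part] at h
  rw [h]
  exact Submodule.smul_mem _ _ h

/-- The linear map `v ↦ (-1)^{i|v|} v` (for homogeneous `v`, extended linearly). -/
def twist (i : ZMod 2) : V →ₗ[ℂ] V := if i = 0 then LinearMap.id else parity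

theorem parity_twist (i : ZMod 2) (v : V) : parity (twist i v) = twist i (parity v) := by
  unfold twist
  split_ifs <;> simp

end SuperModule

open SuperModule

/-! ### Lie superalgebras -/

/-- A complex Lie superalgebra: an even bilinear bracket that is super-skew-symmetric and satisfies
the super Jacobi identity. -/
class LieSuperalgebra (𝔤 : Type*) [AddCommGroup 𝔤] [Module ℂ 𝔤] extends SuperModule 𝔤 where
  br : 𝔤 →ₗ[ℂ] 𝔤 →ₗ[ℂ] 𝔤
  parity_br : ∀ x y, parity (br x y) = br (parity x) (parity y)
  br_skew : ∀ i j, ∀ x ∈ part 𝔤 i, ∀ y ∈ part 𝔤 j, br x y = -(koszulSign i j • br y x)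
  jacobi : ∀ i j, ∀ x ∈ part 𝔤 i, ∀ y ∈ part 𝔤 j, ∀ z,
    br x (br y z) = br (br x y) z + koszulSign i j • br y (br x z)

open LieSuperalgebra (br)

section

variable {𝔤 : Type*} [AddCommGroup 𝔤] [Module ℂ 𝔤] [LieSuperalgebra 𝔤]

/-- The derivation property of the adjoint action of an even element. -/
theorem br_even_derivation {h : 𝔤} (hh : h ∈ part 𝔤 0) (z y : 𝔤) :
    br h (br z y) = br (br h z) y + br z (br h y) := by
  have key : ∀ (i : ZMod 2) (x' : 𝔤), x' ∈ part 𝔤 i →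
      br h (br x' y) = br (br h x') y + br x' (br h y) := by
    intro i x' hx'
    have := LieSuperalgebra.jacobi 0 i h hh x' hx' y
    simpa [koszulSign] using this
  have e0 : z + parity z ∈ part 𝔤 0 := by
    simp [mem_part, koszulSign, parity_parity, add_comm]
  have e1 : z - parity z ∈ part 𝔤 1 := by
    simp [mem_part, koszulSign, parity_parity]
  have hz : z = (2⁻¹ : ℂ) • (z + parity z) + (2⁻¹ : ℂ) • (z - parity z) := by
    module
  have k0 := key 0 _ e0
  have k1 := key 1 _ e1
  rw [hz]
  simp only [map_add, map_smul, map_sub, LinearMap.add_apply, LinearMap.sub_apply,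
    LinearMap.smul_apply] at k0 k1 ⊢
  rw [k0, k1]
  module

/-- The bracket is skew-symmetric if one argument is even. -/
theorem br_even_skew {h : 𝔤} (hh : h ∈ part 𝔤 0) (z : 𝔤) : br z h = -br h z := by
  have key : ∀ (i : ZMod 2) (x' : 𝔤), x' ∈ part 𝔤 i → br x' h = -br h x' := by
    intro i x' hx'
    have := LieSuperalgebra.br_skew i 0 x' hx' h hh
    simpa [koszulSign] using this
  have e0 : z + parity z ∈ part 𝔤 0 := by
    simp [mem_part, koszulSign, parity_parity, add_comm]
  have e1 : z - parity z ∈ part 𝔤 1 := by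
    simp [mem_part, koszulSign, parity_parity]
  have hz : z = (2⁻¹ : ℂ) • (z + parity z) + (2⁻¹ : ℂ) • (z - parity z) := by
    module
  have k0 := key 0 _ e0
  have k1 := key 1 _ e1
  rw [hz]
  simp only [map_add, map_smul, map_sub, LinearMap.add_apply, LinearMap.sub_apply,
    LinearMap.smul_apply] at k0 k1 ⊢
  rw [k0, k1]
  module

end

/-- A morphism of Lie superalgebras: an even linear map preserving brackets. -/
structure LieSuperHom (𝔤 𝔥 : Type*) [AddCommGroup 𝔤] [Module ℂ 𝔤] [LieSuperalgebra 𝔤]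
    [AddCommGroup 𝔥] [Module ℂ 𝔥] [LieSuperalgebra 𝔥] where
  toLin : 𝔤 →ₗ[ℂ] 𝔥
  map_parity : ∀ x, toLin (parity x) = parity (toLin x)
  map_br : ∀ x y, toLin (br x y) = br (toLin x) (toLin y)

namespace LieSuperHom

variable {𝔤 𝔥 𝔩 : Type*} [AddCommGroup 𝔤] [Module ℂ 𝔤] [LieSuperalgebra 𝔤]
  [AddCommGroup 𝔥] [Module ℂ 𝔥] [LieSuperalgebra 𝔥]
  [AddCommGroup 𝔩] [Module ℂ 𝔩] [LieSuperalgebra 𝔩]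

instance : CoeFun (LieSuperHom 𝔤 𝔥) (fun _ => 𝔤 → 𝔥) := ⟨fun φ => φ.toLin⟩

theorem map_part (φ : LieSuperHom 𝔤 𝔥) {i : ZMod 2} {x : 𝔤} (hx : x ∈ part 𝔤 i) :
    φ x ∈ part 𝔥 i := by
  rw [mem_part] at hx ⊢
  rw [← φ.map_parity, hx, map_smul]

/-- Composition of morphisms. -/
def comp (ψ : LieSuperHom 𝔥 𝔩) (φ : LieSuperHom 𝔤 𝔥) : LieSuperHom 𝔤 𝔩 where
  toLin := ψ.toLin.comp φ.toLin
  map_parity x := by simp [φ.map_parity, ψ.map_parity]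
  map_br x y := by simp [φ.map_br, ψ.map_br]

end LieSuperHom

/-- A Lie subsuperalgebra: a graded subspace closed under the bracket. -/
structure LieSubsuperalgebra (𝔤 : Type*) [AddCommGroup 𝔤] [Module ℂ 𝔤] [LieSuperalgebra 𝔤]
    extends Submodule ℂ 𝔤 where
  parity_mem : ∀ x ∈ toSubmodule, parity x ∈ toSubmodule
  br_mem : ∀ x ∈ toSubmodule, ∀ y ∈ toSubmodule, br x y ∈ toSubmodule

namespace LieSubsuperalgebra

variable {𝔤 : Type*} [AddCommGroup 𝔤] [Module ℂ 𝔤] [LieSuperalgebra 𝔤]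

/-- A Lie subsuperalgebra, regarded as a type. -/
abbrev Carrier (𝔥 : LieSubsuperalgebra 𝔤) : Type _ := ↥𝔥.toSubmodule

instance (𝔥 : LieSubsuperalgebra 𝔤) : SuperModule 𝔥.Carrier where
  parity := (parity : 𝔤 →ₗ[ℂ] 𝔤).restrict 𝔥.parity_mem
  parity_parity v := Subtype.ext (parity_parity (v : 𝔤))

theorem coe_parity (𝔥 : LieSubsuperalgebra 𝔤) (x : 𝔥.Carrier) :
    ((parity x : 𝔥.Carrier) : 𝔤) = parity (x : 𝔤) := rfl

theorem coe_mem_part (𝔥 : LieSubsuperalgebra 𝔤) {i : ZMod 2} {x : 𝔥.Carrier}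
    (hx : x ∈ part 𝔥.Carrier i) : (x : 𝔤) ∈ part 𝔤 i := by
  rw [mem_part] at hx ⊢
  rw [← coe_parity, hx]
  rfl

instance (𝔥 : LieSubsuperalgebra 𝔤) : LieSuperalgebra 𝔥.Carrier where
  br := LinearMap.mk₂ ℂ (fun x y => ⟨br (x : 𝔤) (y : 𝔤), 𝔥.br_mem _ x.2 _ y.2⟩)
    (fun x y z => Subtype.ext (by simp)) (fun c x y => Subtype.ext (by simp))
    (fun x y z => Subtype.ext (by simp)) (fun c x y => Subtype.ext (by simp))
  parity_br x y := Subtype.ext (LieSuperalgebra.parity_br (x : 𝔤) y)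
  br_skew i j x hx y hy := Subtype.ext
    (LieSuperalgebra.br_skew i j _ (𝔥.coe_mem_part hx) _ (𝔥.coe_mem_part hy))
  jacobi i j x hx y hy z := Subtype.ext
    (LieSuperalgebra.jacobi i j _ (𝔥.coe_mem_part hx) _ (𝔥.coe_mem_part hy) (z : 𝔤))

/-- The inclusion of a Lie subsuperalgebra. -/
def incl (𝔥 : LieSubsuperalgebra 𝔤) : LieSuperHom 𝔥.Carrier 𝔤 where
  toLin := 𝔥.toSubmodule.subtype
  map_parity _ := rfl
  map_br _ _ := rfl

/-- The preimage of a Lie subsuperalgebra under a morphism. -/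
def comap {𝔥 : Type*} [AddCommGroup 𝔥] [Module ℂ 𝔥] [LieSuperalgebra 𝔥]
    (φ : LieSuperHom 𝔥 𝔤) (𝔩 : LieSubsuperalgebra 𝔤) : LieSubsuperalgebra 𝔥 where
  toSubmodule := 𝔩.toSubmodule.comap φ.toLin
  parity_mem x hx := by
    rw [Submodule.mem_comap] at hx ⊢
    rw [φ.map_parity]
    exact 𝔩.parity_mem _ hx
  br_mem x hx y hy := by
    rw [Submodule.mem_comap] at hx hy ⊢
    rw [φ.map_br]
    exact 𝔩.br_mem _ hx _ hy

/-- The fixed subalgebra `𝔨 = ker (θ - 1)`. -/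
def fixed (θ : LieSuperHom 𝔤 𝔤) : LieSubsuperalgebra 𝔤 where
  toSubmodule := LinearMap.eqLocus θ.toLin LinearMap.id
  parity_mem x hx := by
    simp only [LinearMap.mem_eqLocus, LinearMap.id_coe, id_eq] at hx ⊢
    rw [θ.map_parity, hx]
  br_mem x hx y hy := by
    simp only [LinearMap.mem_eqLocus, LinearMap.id_coe, id_eq] at hx hy ⊢
    rw [θ.map_br, hx, hy]

/-- The centraliser of a subspace of the even part. -/
def centralizer (𝔞 : Submodule ℂ 𝔤) (h𝔞 : 𝔞 ≤ part 𝔤 0) : LieSubsuperalgebra 𝔤 where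
  carrier := {x | ∀ h ∈ 𝔞, br h x = 0}
  zero_mem' := by simp
  add_mem' := by
    intro x y hx hy h hh
    rw [map_add, hx h hh, hy h hh, add_zero]
  smul_mem' := by
    intro c x hx h hh
    rw [map_smul, hx h hh, smul_zero]
  parity_mem x hx h hh := by
    have h1 : parity h = h := by simpa [mem_part, koszulSign] using h𝔞 hh
    have h2 := LieSuperalgebra.parity_br h x
    rw [hx h hh, h1, map_zero] at h2
    exact h2.symm
  br_mem x hx y hy h hh := by
    rw [br_even_derivation (h𝔞 hh), hx h hh, hy h hh]
    simp

end LieSubsuperalgebra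

/-! ### The universal enveloping algebra -/

/-- The defining relations `x y = [x, y] + (-1)^{|x||y|} y x` of the universal enveloping algebra
(for homogeneous `x`, `y`). -/
inductive SuperEnv.Rel (𝔤 : Type*) [AddCommGroup 𝔤] [Module ℂ 𝔤] [LieSuperalgebra 𝔤] :
    TensorAlgebra ℂ 𝔤 → TensorAlgebra ℂ 𝔤 → Prop
  | mk (i j : ZMod 2) (x y : 𝔤) (hx : x ∈ part 𝔤 i) (hy : y ∈ part 𝔤 j) :
    SuperEnv.Rel 𝔤 (TensorAlgebra.ι ℂ x * TensorAlgebra.ι ℂ y)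
      (TensorAlgebra.ι ℂ (br x y) + koszulSign i j • (TensorAlgebra.ι ℂ y * TensorAlgebra.ι ℂ x))

/-- The universal enveloping algebra `𝔘(𝔤)` of a Lie superalgebra. -/
abbrev SuperEnv (𝔤 : Type*) [AddCommGroup 𝔤] [Module ℂ 𝔤] [LieSuperalgebra 𝔤] : Type _ :=
  RingQuot (SuperEnv.Rel 𝔤)

namespace SuperEnv

variable {𝔤 𝔥 : Type*} [AddCommGroup 𝔤] [Module ℂ 𝔤] [LieSuperalgebra 𝔤]
  [AddCommGroup 𝔥] [Module ℂ 𝔥] [LieSuperalgebra 𝔥]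

/-- The canonical map `𝔤 → 𝔘(𝔤)`. -/
def ι : 𝔤 →ₗ[ℂ] SuperEnv 𝔤 :=
  (RingQuot.mkAlgHom ℂ (SuperEnv.Rel 𝔤)).toLinearMap.comp (TensorAlgebra.ι ℂ)

theorem ι_mul_ι {i j : ZMod 2} {x y : 𝔤} (hx : x ∈ part 𝔤 i) (hy : y ∈ part 𝔤 j) :
    ι x * ι y = ι (br x y) + koszulSign i j • (ι y * ι x) := by
  have := RingQuot.mkAlgHom_rel ℂ (Rel.mk i j x y hx hy)
  simpa [ι] using this

/-- The universal property, for linear maps compatible with the defining relations. -/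
def lift {A : Type*} [Ring A] [Algebra ℂ A] (f : 𝔤 →ₗ[ℂ] A)
    (hf : ∀ i j, ∀ x ∈ part 𝔤 i, ∀ y ∈ part 𝔤 j,
      f x * f y = f (br x y) + koszulSign i j • (f y * f x)) : SuperEnv 𝔤 →ₐ[ℂ] A :=
  RingQuot.liftAlgHom ℂ ⟨TensorAlgebra.lift ℂ f, by
    rintro _ _ ⟨i, j, x, y, hx, hy⟩
    simpa using hf i j x hx y hy⟩

@[simp]
theorem lift_ι {A : Type*} [Ring A] [Algebra ℂ A] (f : 𝔤 →ₗ[ℂ] A)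
    (hf : ∀ i j, ∀ x ∈ part 𝔤 i, ∀ y ∈ part 𝔤 j,
      f x * f y = f (br x y) + koszulSign i j • (f y * f x)) (x : 𝔤) :
    lift f hf (ι x) = f x := by
  simp [lift, ι]

theorem algHom_ext {A : Type*} [Ring A] [Algebra ℂ A] {f g : SuperEnv 𝔤 →ₐ[ℂ] A}
    (h : ∀ x : 𝔤, f (ι x) = g (ι x)) : f = g := by
  apply RingQuot.ringQuot_ext'
  apply TensorAlgebra.hom_ext
  ext x
  exact h x

/-- The algebra morphism `𝔘(𝔤) → 𝔘(𝔥)` induced by a morphism `𝔤 → 𝔥`. -/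
def map (φ : LieSuperHom 𝔤 𝔥) : SuperEnv 𝔤 →ₐ[ℂ] SuperEnv 𝔥 :=
  lift (ι.comp φ.toLin) (by
    intro i j x hx y hy
    simp only [LinearMap.comp_apply]
    rw [φ.map_br]
    exact ι_mul_ι (φ.map_part hx) (φ.map_part hy))

@[simp]
theorem map_ι (φ : LieSuperHom 𝔤 𝔥) (x : 𝔤) : map φ (ι x) = ι (φ x) := by
  simp [map]

/-- The parity automorphism of `𝔘(𝔤)`. -/
def parityHom : SuperEnv 𝔤 →ₐ[ℂ] SuperEnv 𝔤 :=
  lift (ι.comp parity) (by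
    intro i j x hx y hy
    simp only [LinearMap.comp_apply]
    rw [LieSuperalgebra.parity_br]
    exact ι_mul_ι (parity_mem_part hx) (parity_mem_part hy))

@[simp]
theorem parityHom_ι (x : 𝔤) : parityHom (ι x) = ι (parity x) := by
  simp [parityHom]

/-- The grading of `𝔘(𝔤)` induced by that of `𝔤`. -/
instance : SuperModule (SuperEnv 𝔤) where
  parity := parityHom.toLinearMap
  parity_parity v := by
    have : (parityHom.comp parityHom : SuperEnv 𝔤 →ₐ[ℂ] SuperEnv 𝔤) = AlgHom.id ℂ _ :=
      algHom_ext (fun x => by simp [parity_parity])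
    exact DFunLike.congr_fun this v

theorem parity_eq (u : SuperEnv 𝔤) : parity u = parityHom u := rfl

theorem parity_map (φ : LieSuperHom 𝔤 𝔥) (u : SuperEnv 𝔤) :
    parity (map φ u) = map φ (parity u) := by
  have : (parityHom.comp (map φ) : SuperEnv 𝔤 →ₐ[ℂ] SuperEnv 𝔥) = (map φ).comp parityHom :=
    algHom_ext (fun x => by simp [φ.map_parity])
  exact DFunLike.congr_fun this u

end SuperEnv

/-! ### Smooth maps with values in locally convex spaces -/

/-- A (Hausdorff) locally convex super-vector space: the grading is a topological direct sum
decomposition, i.e. the parity involution is continuous. -/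
class LCSuperSpace (V : Type*) [AddCommGroup V] [Module ℂ V] [SuperModule V] [UniformSpace V] :
    Prop extends IsUniformAddGroup V, ContinuousSMul ℂ V, T2Space V, LocallyConvexSpace ℝ V where
  continuous_parity : Continuous (parity : V → V)

section Smooth

variable {V : Type*} [AddCommGroup V] [Module ℂ V] [TopologicalSpace V]

/-- `∂_t|₀ c(t) = v`. -/
def HasVelocity (c : ℝ → V) (v : V) : Prop :=
  Filter.Tendsto (fun t : ℝ => t⁻¹ • (c t - c 0)) (𝓝[≠] 0) (𝓝 v)

/-- Smoothness of a map `f` on an open subset `U` of a finite-dimensional space `E`, with values in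
a locally convex space: all iterated directional derivatives
`d^k f (x; v₁, …, v_k) = ∂_{v_k} ⋯ ∂_{v_1} f (x)` exist, and they are continuous on `U × E^k`. -/
def LCSmoothOn {E : Type*} [NormedAddCommGroup E] [NormedSpace ℝ E] (f : E → V) (U : Set E) :
    Prop :=
  ∃ D : (k : ℕ) → E → (Fin k → E) → V,
    (∀ x ∈ U, ∀ v, D 0 x v = f x) ∧
    (∀ k, ContinuousOn (fun p : E × (Fin k → E) => D k p.1 p.2) (U ×ˢ Set.univ)) ∧
    (∀ k, ∀ x ∈ U, ∀ (v : Fin k → E) (w : E),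
      HasVelocity (fun t : ℝ => D k (x + t • w) v) (D (k + 1) x (Fin.snoc v w)))

/-- Smoothness of a map on a manifold modelled on `E`: smoothness in the local charts. -/
def LCSmooth (E : Type*) [NormedAddCommGroup E] [NormedSpace ℝ E] {G : Type*} [TopologicalSpace G]
    [ChartedSpace E G] (f : G → V) : Prop :=
  ∀ e ∈ atlas E G, LCSmoothOn (f ∘ e.symm) e.target

theorem HasVelocity.add [IsTopologicalAddGroup V] {c d : ℝ → V} {v w : V} (hc : HasVelocity c v)
    (hd : HasVelocity d w) : HasVelocity (fun t => c t + d t) (v + w) := by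
  refine (Filter.Tendsto.add hc hd).congr (fun t => ?_)
  rw [← smul_add, add_sub_add_comm]

theorem HasVelocity.map {W : Type*} [AddCommGroup W] [Module ℂ W] [TopologicalSpace W]
    {c : ℝ → V} {v : V} (hc : HasVelocity c v) (T : V →ₗ[ℂ] W) (hT : Continuous T) :
    HasVelocity (fun t => T (c t)) (T v) := by
  refine ((hT.tendsto v).comp hc).congr (fun t => ?_)
  have h : ∀ (r : ℝ) (z : V), T (r • z) = r • T z := by
    intro r z
    rw [← Complex.coe_smul, map_smul, Complex.coe_smul]
  simp [h]

theorem HasVelocity.zero : HasVelocity (fun _ : ℝ => (0 : V)) 0 := by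
  simpa [HasVelocity] using tendsto_const_nhds

variable {E : Type*} [NormedAddCommGroup E] [NormedSpace ℝ E] {U : Set E}

theorem LCSmoothOn.add [IsTopologicalAddGroup V] {f g : E → V} (hf : LCSmoothOn f U)
    (hg : LCSmoothOn g U) : LCSmoothOn (fun x => f x + g x) U := by
  obtain ⟨D, h0, hc, hd⟩ := hf
  obtain ⟨D', h0', hc', hd'⟩ := hg
  refine ⟨fun k x v => D k x v + D' k x v, ?_, ?_, ?_⟩
  · intro x hx v
    simp [h0 x hx, h0' x hx]
  · intro k
    exact (hc k).add (hc' k)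
  · intro k x hx v w
    exact (hd k x hx v w).add (hd' k x hx v w)

theorem LCSmoothOn.map {W : Type*} [AddCommGroup W] [Module ℂ W] [TopologicalSpace W]
    {f : E → V} (hf : LCSmoothOn f U) (T : V →ₗ[ℂ] W) (hT : Continuous T) :
    LCSmoothOn (fun x => T (f x)) U := by
  obtain ⟨D, h0, hc, hd⟩ := hf
  refine ⟨fun k x v => T (D k x v), ?_, ?_, ?_⟩
  · intro x hx v
    simp [h0 x hx]
  · intro k
    exact hT.comp_continuousOn (hc k)
  · intro k x hx v w
    exact (hd k x hx v w).map T hT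

theorem LCSmoothOn.zero : LCSmoothOn (fun _ : E => (0 : V)) U := by
  refine ⟨fun _ _ _ => 0, ?_, ?_, ?_⟩
  · simp
  · intro k
    exact continuousOn_const
  · intro k x hx v w
    exact HasVelocity.zero

end Smooth

/-! ### Supergroup pairs -/

/-- `γ` is the one-parameter subgroup `t ↦ exp (t x)` of the Lie group `G`. -/
structure IsOneParam {E : Type*} [NormedAddCommGroup E] [NormedSpace ℝ E] {G : Type*} [Group G]
    [TopologicalSpace G] [ChartedSpace E G] (γ : ℝ → G) (x : GroupLieAlgebra 𝓘(ℝ, E) G) :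
    Prop where
  map_add : ∀ s t, γ (s + t) = γ s * γ t
  smooth : ContMDiff 𝓘(ℝ, ℝ) 𝓘(ℝ, E) ∞ γ
  velocity : (mfderiv 𝓘(ℝ, ℝ) 𝓘(ℝ, E) γ 0 (1 : ℝ) : E) = x

/-- `L` is a real form of the complex subspace `S`, that is, `S = L ⊕ iL`. -/
structure IsRealForm {V : Type*} [AddCommGroup V] [Module ℂ V] (L : Submodule ℝ V)
    (S : Submodule ℂ V) : Prop where
  le : ∀ x ∈ L, x ∈ S
  exists_add : ∀ z ∈ S, ∃ x ∈ L, ∃ y ∈ L, z = x + Complex.I • y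
  indep : ∀ x ∈ L, ∀ y ∈ L, x + Complex.I • y = 0 → x = 0 ∧ y = 0

/-- A *cs* supergroup pair `(𝔤, G₀)`: a finite-dimensional complex Lie superalgebra `𝔤` and a real
Lie group `G₀`, together with an identification `emb` of the Lie algebra of `G₀` with a real form
of `𝔤₀` and a smooth action `Ad` of `G₀` by automorphisms of `𝔤`, which extends the adjoint action
and whose differential is the bracket. (The norm on `𝔤` serves only to fix the canonical
topology.) -/
structure CsSupergroupPair (𝔤 : Type*) [NormedAddCommGroup 𝔤] [NormedSpace ℂ 𝔤]
    [FiniteDimensional ℂ 𝔤] [LieSuperalgebra 𝔤]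
    (E : Type*) [NormedAddCommGroup E] [NormedSpace ℝ E] [FiniteDimensional ℝ E]
    (G : Type*) [Group G] [TopologicalSpace G] [ChartedSpace E G] [LieGroup 𝓘(ℝ, E) ∞ G] where
  emb : GroupLieAlgebra 𝓘(ℝ, E) G →ₗ[ℝ] 𝔤
  emb_injective : Function.Injective emb
  emb_bracket : ∀ x y : GroupLieAlgebra 𝓘(ℝ, E) G, emb ⁅x, y⁆ = br (emb x) (emb y)
  isRealForm : IsRealForm (LinearMap.range emb) (part 𝔤 0)
  Ad : G → LieSuperHom 𝔤 𝔤
  Ad_one : ∀ x, Ad 1 x = x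
  Ad_mul : ∀ g h x, Ad (g * h) x = Ad g (Ad h x)
  Ad_smooth : ContMDiff (𝓘(ℝ, E).prod 𝓘(ℝ, 𝔤)) 𝓘(ℝ, 𝔤) ∞ (fun p : G × 𝔤 => Ad p.1 p.2)
  Ad_emb : ∀ (g : G) (x : GroupLieAlgebra 𝓘(ℝ, E) G),
    Ad g (emb x) = emb (mfderiv 𝓘(ℝ, E) 𝓘(ℝ, E) (fun h : G => g * h * g⁻¹) 1 x : E)
  deriv_Ad : ∀ (x : GroupLieAlgebra 𝓘(ℝ, E) G) (y : 𝔤),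
    (mfderiv 𝓘(ℝ, E) 𝓘(ℝ, 𝔤) (fun g : G => Ad g y) 1 x : 𝔤) = br (emb x) y

/-! ### Representations -/

/-- The algebraic data of a representation of a pair `(𝔤, G₀)` on a super-vector space `V`: a
group homomorphism `G₀ → GL(V)₀` and a morphism of Lie superalgebras `𝔤 → 𝔤𝔩(V)`. -/
structure SuperRep (𝔤 : Type*) [AddCommGroup 𝔤] [Module ℂ 𝔤] [LieSuperalgebra 𝔤]
    (G : Type*) [Group G] (V : Type*) [AddCommGroup V] [Module ℂ V] [SuperModule V] where
  grp : G →* (V →ₗ[ℂ] V)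
  alg : 𝔤 →ₗ[ℂ] V →ₗ[ℂ] V
  parity_grp : ∀ g v, parity (grp g v) = grp g (parity v)
  parity_alg : ∀ x v, parity (alg x v) = alg (parity x) (parity v)
  alg_br : ∀ i j, ∀ x ∈ part 𝔤 i, ∀ y ∈ part 𝔤 j, ∀ v,
    alg (br x y) v = alg x (alg y v) - koszulSign i j • alg y (alg x v)

namespace SuperRep

variable {𝔤 𝔥 : Type*} [AddCommGroup 𝔤] [Module ℂ 𝔤] [LieSuperalgebra 𝔤]
  [AddCommGroup 𝔥] [Module ℂ 𝔥] [LieSuperalgebra 𝔥] {G H : Type*} [Group G] [Group H]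
  {V W : Type*} [AddCommGroup V] [Module ℂ V] [SuperModule V]
  [AddCommGroup W] [Module ℂ W] [SuperModule W]

/-- The restriction of a representation along morphisms `𝔥 → 𝔤` and `H₀ → G₀`. -/
def restrict (ρ : SuperRep 𝔤 G V) (dφ : LieSuperHom 𝔥 𝔤) (φ : H →* G) : SuperRep 𝔥 H V where
  grp := ρ.grp.comp φ
  alg := ρ.alg.comp dφ.toLin
  parity_grp g v := ρ.parity_grp (φ g) v
  parity_alg x v := by
    simp only [LinearMap.comp_apply]
    rw [ρ.parity_alg, dφ.map_parity]
  alg_br i j x hx y hy v := by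
    simp only [LinearMap.comp_apply]
    rw [dφ.map_br]
    exact ρ.alg_br i j _ (dφ.map_part hx) _ (dφ.map_part hy) v

/-- `T` is an even linear map that commutes with the actions of `𝔤` and `G₀`. -/
structure IsIntertwining (ρ : SuperRep 𝔤 G V) (σ : SuperRep 𝔤 G W) (T : V → W) : Prop where
  parity : ∀ v, T (parity v) = SuperModule.parity (T v)
  grp : ∀ g v, T (ρ.grp g v) = σ.grp g (T v)
  alg : ∀ x v, T (ρ.alg x v) = σ.alg x (T v)

end SuperRep

section Pair

variable {𝔤 : Type*} [NormedAddCommGroup 𝔤] [NormedSpace ℂ 𝔤] [FiniteDimensional ℂ 𝔤]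
  [LieSuperalgebra 𝔤]
  {E : Type*} [NormedAddCommGroup E] [NormedSpace ℝ E] [FiniteDimensional ℝ E]
  {G : Type*} [Group G] [TopologicalSpace G] [ChartedSpace E G] [LieGroup 𝓘(ℝ, E) ∞ G]

/-- The representation `ρ` of the *cs* supergroup pair `P = (𝔤, G₀)` on the topological
super-vector space `V` is smooth. -/
structure CsSupergroupPair.IsSmoothRep (P : CsSupergroupPair 𝔤 E G) {V : Type*} [AddCommGroup V]
    [Module ℂ V] [SuperModule V] [UniformSpace V] (ρ : SuperRep 𝔤 G V) : Prop where
  continuous_grp : Continuous (fun p : G × V => ρ.grp p.1 p.2)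
  smooth_grp : ∀ v, LCSmooth E (fun g => ρ.grp g v)
  continuous_alg : Continuous (fun p : 𝔤 × V => ρ.alg p.1 p.2)
  velocity : ∀ (x : GroupLieAlgebra 𝓘(ℝ, E) G) (γ : ℝ → G), IsOneParam γ x →
    ∀ v, HasVelocity (fun t => ρ.grp (γ t) v) (ρ.alg (P.emb x) v)
  equivariant : ∀ g x v, ρ.alg (P.Ad g x) v = ρ.grp g (ρ.alg x (ρ.grp g⁻¹ v))

/-! ### Induced representations -/

/-- The topology on `W`-valued superfunctions: uniform convergence of `f(u)` on compact subsets
of `G₀`, for each `u ∈ 𝔘(𝔤)`. It is generated by the seminorms `sup_{p ∈ K} ‖f(u)(p)‖_j` with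
`u ∈ 𝔘(𝔤)`, `K ⊆ G₀` compact, and `‖·‖_j` a continuous seminorm on `W`. -/
instance superfunctionUniformSpace {𝔤 : Type*} [AddCommGroup 𝔤] [Module ℂ 𝔤] [LieSuperalgebra 𝔤]
    {G : Type*} [TopologicalSpace G] {W : Type*} [AddCommGroup W] [Module ℂ W] [UniformSpace W] :
    UniformSpace (SuperEnv 𝔤 →ₗ[ℂ] (G → W)) :=
  UniformSpace.comap
    (fun f (u : SuperEnv 𝔤) => UniformOnFun.ofFun {K : Set G | IsCompact K} (f u)) inferInstance

variable {W : Type*} [AddCommGroup W] [Module ℂ W] [SuperModule W] [UniformSpace W]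
  [LCSuperSpace W]

/-- The space `C^∞(𝔤, G₀, W)` of `W`-valued superfunctions: linear maps `f` from `𝔘(𝔤)` to smooth
maps `G₀ → W`, such that `f(yu)(p) = ∂_t|₀ f(u)(p e^{ty})` for `y` in the real form of `𝔤₀` (and
hence, by linearity, `f(yu) = 𝓛_y f(u)` for all `y ∈ 𝔤₀`). -/
def superfunctions (P : CsSupergroupPair 𝔤 E G) (W : Type*) [AddCommGroup W] [Module ℂ W]
    [SuperModule W] [UniformSpace W] [LCSuperSpace W] : Submodule ℂ (SuperEnv 𝔤 →ₗ[ℂ] (G → W)) where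
  carrier := {f | (∀ u, LCSmooth E (f u)) ∧
    ∀ (y : GroupLieAlgebra 𝓘(ℝ, E) G) (γ : ℝ → G), IsOneParam γ y → ∀ u p,
      HasVelocity (fun t => f u (p * γ t)) (f (SuperEnv.ι (P.emb y) * u) p)}
  zero_mem' := ⟨fun _ _ _ => LCSmoothOn.zero, fun _ _ _ _ _ => HasVelocity.zero⟩
  add_mem' := by
    rintro f g ⟨hf, hf'⟩ ⟨hg, hg'⟩
    exact ⟨fun u e he => (hf u e he).add (hg u e he),
      fun y γ hγ u p => (hf' y γ hγ u p).add (hg' y γ hγ u p)⟩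
  smul_mem' := by
    rintro c f ⟨hf, hf'⟩
    have hc : Continuous (c • (LinearMap.id : W →ₗ[ℂ] W)) := continuous_const_smul c
    exact ⟨fun u e he => (hf u e he).map (c • LinearMap.id) hc,
      fun y γ hγ u p => (hf' y γ hγ u p).map (c • LinearMap.id) hc⟩

/-- The induced representation space `Ind_{𝔥,H₀}^{𝔤,G₀}(W)`: all `f ∈ C^∞(𝔤, G₀, W)` with
`f(u)(p) = π₀(h) f(Ad(h⁻¹)u)(ph)` for `h ∈ H₀` and
`f(uy)(p) = (-1)^{|y|(|u|+|f|)} π_𝔥(S(y)) f(u)(p)` for `y ∈ 𝔥`, where `S(y) = -y`. Here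
`|u| + |f|` is the parity of the vector `f(u)(p)` of `W`, so the sign is `twist |y|`. -/
def ind (P : CsSupergroupPair 𝔤 E G) (𝔥 : LieSubsuperalgebra 𝔤) (H : Subgroup G)
    (π : SuperRep 𝔥.Carrier H W) : Submodule ℂ (SuperEnv 𝔤 →ₗ[ℂ] (G → W)) where
  carrier := {f | f ∈ superfunctions P W ∧
    (∀ (h : H) u p, f u p = π.grp h (f (SuperEnv.map (P.Ad (h : G)⁻¹) u) (p * h))) ∧
    (∀ (i : ZMod 2), ∀ y ∈ part 𝔥.Carrier i, ∀ u p,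
      f (u * SuperEnv.ι (y : 𝔤)) p = -(π.alg y (twist i (f u p))))}
  zero_mem' := ⟨Submodule.zero_mem _, by simp, by simp⟩
  add_mem' := by
    rintro f g ⟨hf, hf1, hf2⟩ ⟨hg, hg1, hg2⟩
    refine ⟨Submodule.add_mem _ hf hg, fun h u p => ?_, fun i y hy u p => ?_⟩
    · simp only [LinearMap.add_apply, Pi.add_apply, map_add]
      rw [← hf1, ← hg1]
    · simp only [LinearMap.add_apply, Pi.add_apply, map_add]
      rw [hf2 i y hy, hg2 i y hy]
      abel
  smul_mem' := by
    rintro c f ⟨hf, hf1, hf2⟩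
    refine ⟨Submodule.smul_mem _ c hf, fun h u p => ?_, fun i y hy u p => ?_⟩
    · simp only [LinearMap.smul_apply, Pi.smul_apply, map_smul]
      rw [← hf1]
    · simp only [LinearMap.smul_apply, Pi.smul_apply, map_smul]
      rw [hf2 i y hy, smul_neg]

/-- The parity involution `f ↦ γ_W ∘ f ∘ γ_𝔘` of linear maps: `f` is homogeneous of parity `i` iff
`f(u)(p) ∈ W_{i+j}` for all `u ∈ 𝔘(𝔤)_j`. -/
def superfunctionParity :
    (SuperEnv 𝔤 →ₗ[ℂ] (G → W)) →ₗ[ℂ] (SuperEnv 𝔤 →ₗ[ℂ] (G → W)) where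
  toFun f := (LinearMap.compLeft (parity : W →ₗ[ℂ] W) G).comp (f.comp parity)
  map_add' f g := by
    ext u p
    simp
  map_smul' c f := by
    ext u p
    simp

theorem superfunctionParity_apply (f : SuperEnv 𝔤 →ₗ[ℂ] (G → W)) (u : SuperEnv 𝔤) (p : G) :
    superfunctionParity f u p = parity (f (parity u) p) := rfl

theorem superfunctionParity_mem (P : CsSupergroupPair 𝔤 E G) (𝔥 : LieSubsuperalgebra 𝔤)
    (H : Subgroup G) (π : SuperRep 𝔥.Carrier H W) (f : SuperEnv 𝔤 →ₗ[ℂ] (G → W))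
    (hf : f ∈ ind P 𝔥 H π) : superfunctionParity f ∈ ind P 𝔥 H π := by
  obtain ⟨⟨hf, hf'⟩, hf1, hf2⟩ := hf
  have hγ : Continuous (parity : W →ₗ[ℂ] W) := LCSuperSpace.continuous_parity
  refine ⟨⟨fun u e he => (hf (parity u) e he).map parity hγ, fun y γ h u p => ?_⟩,
    fun h u p => ?_, fun i y hy u p => ?_⟩
  · have hy : parity (P.emb y) = P.emb y := by
      have := P.isRealForm.le _ (LinearMap.mem_range_self P.emb y)
      simpa [mem_part, koszulSign] using this
    have h1 := (hf' y γ h (parity u) p).map parity hγ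
    rw [superfunctionParity_apply, SuperEnv.parity_eq, map_mul, SuperEnv.parityHom_ι, hy]
    exact h1
  · rw [superfunctionParity_apply, superfunctionParity_apply, hf1 h, π.parity_grp,
      SuperEnv.parity_map]
  · have h1 := hf2 i (parity y) (parity_mem_part hy) (parity u) p
    rw [superfunctionParity_apply, superfunctionParity_apply, SuperEnv.parity_eq, map_mul,
      SuperEnv.parityHom_ι, ← 𝔥.coe_parity, ← SuperEnv.parity_eq, h1, map_neg, π.parity_alg,
      parity_parity, parity_twist]

instance (P : CsSupergroupPair 𝔤 E G) (𝔥 : LieSubsuperalgebra 𝔤) (H : Subgroup G)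
    (π : SuperRep 𝔥.Carrier H W) : SuperModule (ind P 𝔥 H π) where
  parity := superfunctionParity.restrict (superfunctionParity_mem P 𝔥 H π)
  parity_parity f := by
    ext u p
    change parity (parity ((f : SuperEnv 𝔤 →ₗ[ℂ] (G → W)) (parity (parity u)) p)) = _
    rw [parity_parity, parity_parity]

/-- `ρ` is the canonical action of `(𝔤, G₀)` on the induced representation, that is,
`(ρ₀(g)f)(u)(p) = f(u)(g⁻¹p)` and
`(ρ_𝔤(x)f)(u)(p) = -(-1)^{|f||x|} f(Ad(p⁻¹)(x)u)(p)` for homogeneous `x ∈ 𝔤`. -/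
structure IsInducedAction (P : CsSupergroupPair 𝔤 E G) (𝔥 : LieSubsuperalgebra 𝔤) (H : Subgroup G)
    (π : SuperRep 𝔥.Carrier H W) (ρ : SuperRep 𝔤 G (ind P 𝔥 H π)) : Prop where
  grp : ∀ g f u p, (ρ.grp g f).1 u p = f.1 u (g⁻¹ * p)
  alg : ∀ i, ∀ x ∈ part 𝔤 i, ∀ f u p,
    (ρ.alg x f).1 u p = -((twist i f).1 (SuperEnv.ι (P.Ad p⁻¹ x) * u) p)

/-! ### Symmetric superpairs -/

/-- An even, supersymmetric, non-degenerate, `𝔤`- and `θ`-invariant bilinear form on `𝔤`. -/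
structure IsInvariantForm (θ : LieSuperHom 𝔤 𝔤) (b : 𝔤 →ₗ[ℂ] 𝔤 →ₗ[ℂ] ℂ) : Prop where
  even : ∀ x y, b (parity x) (parity y) = b x y
  symm : ∀ i j, ∀ x ∈ part 𝔤 i, ∀ y ∈ part 𝔤 j, b x y = koszulSign i j * b y x
  invariant : ∀ x y z, b (br x y) z = b x (br y z)
  theta : ∀ x y, b (θ x) (θ y) = b x y
  nondegenerate : ∀ x, (∀ y, b x y = 0) → x = 0

/-- `(𝔤, θ)` is a reductive symmetric superpair. -/
structure IsReductiveSymmetricSuperpair (θ : LieSuperHom 𝔤 𝔤) : Prop where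
  involutive : ∀ x, θ (θ x) = x
  semisimple : ∀ N : Submodule ℂ 𝔤, (∀ x ∈ part 𝔤 0, ∀ y ∈ N, br x y ∈ N) →
    ∃ N' : Submodule ℂ 𝔤, (∀ x ∈ part 𝔤 0, ∀ y ∈ N', br x y ∈ N') ∧ IsCompl N N'
  center_even : ∀ x : 𝔤, (∀ y, br x y = 0) → x ∈ part 𝔤 0
  exists_form : ∃ b, IsInvariantForm θ b

/-- The `-1`-eigenspace `𝔭 = ker (θ + 1)`. -/
def antifixed (θ : LieSuperHom 𝔤 𝔤) : Submodule ℂ 𝔤 := LinearMap.ker (θ.toLin + LinearMap.id)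

/-- `𝔞` is an even Cartan subspace of `(𝔤, θ)`: an Abelian subalgebra contained in `𝔭₀`,
consisting of semi-simple elements of `𝔤₀` (those whose adjoint action on `𝔤₀` is
diagonalisable), such that `𝔭 = 𝔞 + [𝔨, 𝔞]`. -/
structure IsEvenCartan (θ : LieSuperHom 𝔤 𝔤) (𝔞 : Submodule ℂ 𝔤) : Prop where
  le_even : 𝔞 ≤ part 𝔤 0
  le_antifixed : 𝔞 ≤ antifixed θ
  abelian : ∀ x ∈ 𝔞, ∀ y ∈ 𝔞, br x y = 0
  semisimple : ∀ h ∈ 𝔞, part 𝔤 0 ≤ ⨆ c : ℂ, Module.End.eigenspace (br h) c ⊓ part 𝔤 0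
  antifixed_eq : antifixed θ = 𝔞 ⊔ Submodule.map₂ br (LieSubsuperalgebra.fixed θ).toSubmodule 𝔞

/-- The restricted root space `𝔤^λ`, for `λ ∈ 𝔞*`. -/
def rootSpace (𝔞 : Submodule ℂ 𝔤) (l : Module.Dual ℂ 𝔞) : Submodule ℂ 𝔤 where
  carrier := {x | ∀ h : 𝔞, br (h : 𝔤) x = l h • x}
  zero_mem' := by simp
  add_mem' := by
    intro x y hx hy h
    rw [map_add, hx, hy, smul_add]
  smul_mem' := by
    intro c x hx h
    rw [map_smul, hx, smul_comm]

/-- The set `Σ` of restricted roots. -/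
def restrictedRoots (𝔞 : Submodule ℂ 𝔤) : Set (Module.Dual ℂ 𝔞) :=
  {l | l ≠ 0 ∧ rootSpace 𝔞 l ≠ ⊥}

/-- `Σ⁺` is a positive system of restricted roots: `Σ` is the disjoint union of `Σ⁺` and `-Σ⁺`,
and `Σ ∩ (Σ⁺ + Σ⁺) ⊆ Σ⁺`. -/
structure IsPositiveSystem (𝔞 : Submodule ℂ 𝔤) (S : Set (Module.Dual ℂ 𝔞)) : Prop where
  union : restrictedRoots 𝔞 = S ∪ {l | -l ∈ S}
  disjoint : ∀ l ∈ S, -l ∉ S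
  add_mem : ∀ l ∈ S, ∀ l' ∈ S, l + l' ∈ restrictedRoots 𝔞 → l + l' ∈ S

/-- `𝔫 = ⨁_{λ ∈ Σ⁺} 𝔤^λ`. -/
def positivePart (𝔞 : Submodule ℂ 𝔤) (S : Set (Module.Dual ℂ 𝔞)) : Submodule ℂ 𝔤 :=
  ⨆ l ∈ S, rootSpace 𝔞 l

/-! ### Forms and the Iwasawa decomposition -/

/-- `φ : H → G` exhibits the connected Lie group `H` as the analytic subgroup of `G` with Lie
algebra `𝔩`. -/
structure IsAnalyticSubgroup (F : Type*) [NormedAddCommGroup F] [NormedSpace ℝ F] {H : Type*}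
    [Group H] [TopologicalSpace H] [ChartedSpace F H] (φ : H →* G)
    (𝔩 : Submodule ℝ (GroupLieAlgebra 𝓘(ℝ, E) G)) : Prop where
  connected : ConnectedSpace H
  injective : Function.Injective φ
  smooth : ContMDiff 𝓘(ℝ, F) 𝓘(ℝ, E) ∞ φ
  deriv_injective : Function.Injective (mfderiv 𝓘(ℝ, F) 𝓘(ℝ, E) φ 1)
  range_deriv : ∀ x : GroupLieAlgebra 𝓘(ℝ, E) G,
    x ∈ 𝔩 ↔ ∃ y : GroupLieAlgebra 𝓘(ℝ, F) H, (mfderiv 𝓘(ℝ, F) 𝓘(ℝ, E) φ 1 y : E) = x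

namespace CsSupergroupPair

variable (P : CsSupergroupPair 𝔤 E G) (θ : LieSuperHom 𝔤 𝔤)

/-- The real Lie subalgebra `𝔩 ∩ 𝔤_{0,ℝ}` of the Lie algebra of `G₀`, for a subspace `𝔩 ⊆ 𝔤`. -/
def realPart (𝔩 : Submodule ℂ 𝔤) : Submodule ℝ (GroupLieAlgebra 𝓘(ℝ, E) G) :=
  (𝔩.restrictScalars ℝ).comap P.emb

/-- The real Lie algebra of `G₀` is a *cs* form of `(𝔤, θ)`: it is `θ`-invariant and
`b`-non-degenerate for some `b`. -/
structure IsCsForm : Prop where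
  theta : ∀ x, ∃ y, θ (P.emb x) = P.emb y
  nondegenerate : ∃ b, IsInvariantForm θ b ∧ ∀ x, (∀ y, b (P.emb x) (P.emb y) = 0) → x = 0

/-- `𝔲₀ = 𝔨_{0,ℝ} ⊕ i𝔭_{0,ℝ}`. -/
def compactDual : Submodule ℝ 𝔤 :=
  ((P.realPart (LieSubsuperalgebra.fixed θ).toSubmodule).map P.emb) ⊔
    ((P.realPart (antifixed θ)).map P.emb).map
      ((Complex.I • (LinearMap.id : 𝔤 →ₗ[ℂ] 𝔤)).restrictScalars ℝ)

/-- The *cs* form is non-compact: `𝔲₀` is a real form of `𝔤₀`, and the analytic subgroup of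
`GL(𝔤)` generated by `ad_𝔤(𝔲₀)` is compact. -/
structure IsNoncompactForm : Prop extends P.IsCsForm θ where
  isRealForm : IsRealForm (P.compactDual θ) (part 𝔤 0)
  compact : IsCompact ((Submonoid.closure
    {T : 𝔤 →L[ℂ] 𝔤 | ∃ x ∈ P.compactDual θ,
      T = NormedSpace.exp (LinearMap.toContinuousLinearMap (br x))} :
    Submonoid (𝔤 →L[ℂ] 𝔤)) : Set (𝔤 →L[ℂ] 𝔤))

/-- `(𝔤, G₀, θ)` is a non-compact global *cs* form of `(𝔤, θ)`, where `θ₀` is the involution of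
`G₀`, and `φK : K₀ → G₀` is the analytic subgroup generated by `𝔨_{0,ℝ}`. -/
structure IsNoncompactGlobalForm (θ₀ : G →* G) (F : Type*) [NormedAddCommGroup F]
    [NormedSpace ℝ F] {K : Type*} [Group K] [TopologicalSpace K] [ChartedSpace F K]
    (φK : K →* G) : Prop extends P.IsNoncompactForm θ where
  involutive : ∀ g, θ₀ (θ₀ g) = g
  smooth : ContMDiff 𝓘(ℝ, E) 𝓘(ℝ, E) ∞ θ₀
  deriv : ∀ x : GroupLieAlgebra 𝓘(ℝ, E) G,
    P.emb (mfderiv 𝓘(ℝ, E) 𝓘(ℝ, E) θ₀ 1 x : E) = θ (P.emb x)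
  Ad_theta : ∀ g x, P.Ad (θ₀ g) x = θ (P.Ad g (θ x))
  analytic : IsAnalyticSubgroup F φK (P.realPart (LieSubsuperalgebra.fixed θ).toSubmodule)
  compact_Ad : IsCompact
    (Set.range fun k : K => LinearMap.toContinuousLinearMap (P.Ad (φK k)).toLin)

end CsSupergroupPair

namespace CsSupergroupPair

variable (P : CsSupergroupPair 𝔤 E G)

/-- The complexification `𝔞` of a real subspace `𝔞_ℝ` of the Lie algebra of `G₀`. -/
def complexify (aR : Submodule ℝ (GroupLieAlgebra 𝓘(ℝ, E) G)) : Submodule ℂ 𝔤 :=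
  Submodule.span ℂ (P.emb '' aR)

end CsSupergroupPair

/-- `(𝔥, H₀) → (𝔤, G₀)`, given by `dφ` and `φ`, is a morphism of *cs* supergroup pairs. -/
structure CsSupergroupPair.IsMorphism {𝔥 : Type*} [NormedAddCommGroup 𝔥] [NormedSpace ℂ 𝔥]
    [FiniteDimensional ℂ 𝔥] [LieSuperalgebra 𝔥]
    {F : Type*} [NormedAddCommGroup F] [NormedSpace ℝ F] [FiniteDimensional ℝ F]
    {H : Type*} [Group H] [TopologicalSpace H] [ChartedSpace F H] [LieGroup 𝓘(ℝ, F) ∞ H]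
    (P' : CsSupergroupPair 𝔥 F H) (P : CsSupergroupPair 𝔤 E G) (dφ : LieSuperHom 𝔥 𝔤)
    (φ : H →* G) : Prop where
  smooth : ContMDiff 𝓘(ℝ, F) 𝓘(ℝ, E) ∞ φ
  emb : ∀ x : GroupLieAlgebra 𝓘(ℝ, F) H,
    dφ (P'.emb x) = P.emb (mfderiv 𝓘(ℝ, F) 𝓘(ℝ, E) φ 1 x : E)
  Ad : ∀ h x, dφ (P'.Ad h x) = P.Ad (φ h) (dφ x)

/-- The global Iwasawa decomposition: multiplication `K₀ × A × N₀ → G₀` is a diffeomorphism. -/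
def HasGlobalIwasawa
    (EK : Type*) [NormedAddCommGroup EK] [NormedSpace ℝ EK] {K : Type*} [Group K]
    [TopologicalSpace K] [ChartedSpace EK K]
    (EA : Type*) [NormedAddCommGroup EA] [NormedSpace ℝ EA] {A : Type*} [Group A]
    [TopologicalSpace A] [ChartedSpace EA A]
    (EN : Type*) [NormedAddCommGroup EN] [NormedSpace ℝ EN] {N : Type*} [Group N]
    [TopologicalSpace N] [ChartedSpace EN N]
    (E : Type*) [NormedAddCommGroup E] [NormedSpace ℝ E] {G : Type*} [Group G]
    [TopologicalSpace G] [ChartedSpace E G]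
    (φK : K →* G) (φA : A →* G) (φN : N →* G) : Prop :=
  ∃ Φ : Diffeomorph (𝓘(ℝ, EK).prod (𝓘(ℝ, EA).prod 𝓘(ℝ, EN))) 𝓘(ℝ, E) (K × A × N) G ∞,
    ∀ k a n, Φ (k, a, n) = φK k * φA a * φN n

/-! ### The minimal parabolic subpair -/

section Parabolic

variable {θ : LieSuperHom 𝔤 𝔤} {𝔞 : Submodule ℂ 𝔤} {S : Set (Module.Dual ℂ 𝔞)}

/-- The subalgebra `𝔪 = 𝔷_𝔨(𝔞)`, as a subsuperalgebra of `𝔨`. -/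
def centralizerInK (h𝔞 : IsEvenCartan θ 𝔞) :
    LieSubsuperalgebra (LieSubsuperalgebra.fixed θ).Carrier :=
  (LieSubsuperalgebra.centralizer 𝔞 h𝔞.le_even).comap (LieSubsuperalgebra.fixed θ).incl

theorem br_mem_rootSpace (h𝔞 : IsEvenCartan θ 𝔞) {l l' : Module.Dual ℂ 𝔞} {x y : 𝔤}
    (hx : x ∈ rootSpace 𝔞 l) (hy : y ∈ rootSpace 𝔞 l') : br x y ∈ rootSpace 𝔞 (l + l') := by
  intro h
  rw [br_even_derivation (h𝔞.le_even h.2), hx h, hy h]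
  simp only [map_smul, LinearMap.smul_apply, LinearMap.add_apply]
  module

theorem parity_mem_rootSpace (h𝔞 : IsEvenCartan θ 𝔞) {l : Module.Dual ℂ 𝔞} {x : 𝔤}
    (hx : x ∈ rootSpace 𝔞 l) : parity x ∈ rootSpace 𝔞 l := by
  intro h
  have h1 : parity (h : 𝔤) = h := by simpa [mem_part, koszulSign] using h𝔞.le_even h.2
  have h2 := LieSuperalgebra.parity_br (h : 𝔤) x
  rw [hx h, h1, map_smul] at h2
  exact h2.symm

theorem parity_mem_positivePart (h𝔞 : IsEvenCartan θ 𝔞) {x : 𝔤} (hx : x ∈ positivePart 𝔞 S) :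
    parity x ∈ positivePart 𝔞 S := by
  have : positivePart 𝔞 S ≤ (positivePart 𝔞 S).comap parity := by
    refine iSup₂_le fun l hl x hx => ?_
    exact Submodule.mem_iSup_of_mem l
      (Submodule.mem_iSup_of_mem hl (parity_mem_rootSpace h𝔞 hx))
  exact this hx

theorem br_mem_positivePart_left (h𝔞 : IsEvenCartan θ 𝔞) {x y : 𝔤}
    (hx : x ∈ rootSpace 𝔞 0) (hy : y ∈ positivePart 𝔞 S) : br x y ∈ positivePart 𝔞 S := by
  have : positivePart 𝔞 S ≤ (positivePart 𝔞 S).comap (br x) := by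
    refine iSup₂_le fun l hl z hz => ?_
    have h1 := br_mem_rootSpace h𝔞 hx hz
    rw [zero_add] at h1
    exact Submodule.mem_iSup_of_mem l (Submodule.mem_iSup_of_mem hl h1)
  exact this hy

theorem br_mem_positivePart_right (h𝔞 : IsEvenCartan θ 𝔞) {x y : 𝔤}
    (hx : x ∈ positivePart 𝔞 S) (hy : y ∈ rootSpace 𝔞 0) : br x y ∈ positivePart 𝔞 S := by
  have : positivePart 𝔞 S ≤ (positivePart 𝔞 S).comap ((br : 𝔤 →ₗ[ℂ] 𝔤 →ₗ[ℂ] 𝔤).flip y) := by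
    refine iSup₂_le fun l hl z hz => ?_
    have h1 := br_mem_rootSpace h𝔞 hz hy
    rw [add_zero] at h1
    exact Submodule.mem_iSup_of_mem l (Submodule.mem_iSup_of_mem hl h1)
  exact this hx

theorem br_mem_positivePart (h𝔞 : IsEvenCartan θ 𝔞) (hS : IsPositiveSystem 𝔞 S) {x y : 𝔤}
    (hx : x ∈ positivePart 𝔞 S) (hy : y ∈ positivePart 𝔞 S) : br x y ∈ positivePart 𝔞 S := by
  have step : ∀ l ∈ S, ∀ z ∈ rootSpace 𝔞 l,
      positivePart 𝔞 S ≤ (positivePart 𝔞 S).comap (br z) := by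
    intro l hl z hz
    refine iSup₂_le fun l' hl' w hw => ?_
    have h1 := br_mem_rootSpace h𝔞 hz hw
    rw [Submodule.mem_comap]
    by_cases h0 : br z w = 0
    · rw [h0]
      exact Submodule.zero_mem _
    · have hne : l + l' ≠ 0 := by
        intro h
        exact hS.disjoint l hl (by rwa [neg_eq_of_add_eq_zero_right h])
      have hr : l + l' ∈ restrictedRoots 𝔞 := by
        refine ⟨hne, fun hb => h0 ?_⟩
        rw [hb] at h1
        exact (Submodule.mem_bot ℂ).1 h1
      exact Submodule.mem_iSup_of_mem _
        (Submodule.mem_iSup_of_mem (hS.add_mem l hl l' hl' hr) h1)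
  have : positivePart 𝔞 S ≤ (positivePart 𝔞 S).comap ((br : 𝔤 →ₗ[ℂ] 𝔤 →ₗ[ℂ] 𝔤).flip y) :=
    iSup₂_le fun l hl z hz => step l hl z hz hy
  exact this hx

/-- The minimal parabolic subalgebra `𝔮 = 𝔪 ⊕ 𝔞 ⊕ 𝔫`, where `𝔪 = 𝔷_𝔨(𝔞)`. -/
def minimalParabolic (h𝔞 : IsEvenCartan θ 𝔞) (hS : IsPositiveSystem 𝔞 S) :
    LieSubsuperalgebra 𝔤 where
  toSubmodule := ((LieSubsuperalgebra.fixed θ).toSubmodule ⊓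
    (LieSubsuperalgebra.centralizer 𝔞 h𝔞.le_even).toSubmodule) ⊔ 𝔞 ⊔ positivePart 𝔞 S
  parity_mem x hx := by
    obtain ⟨z, hz, n, hn, rfl⟩ := Submodule.mem_sup.1 hx
    obtain ⟨m, hm, a, ha, rfl⟩ := Submodule.mem_sup.1 hz
    have h1 : parity a = a := by simpa [mem_part, koszulSign] using h𝔞.le_even ha
    rw [map_add, map_add, h1]
    exact Submodule.add_mem_sup (Submodule.add_mem_sup
      ⟨LieSubsuperalgebra.parity_mem _ _ hm.1, LieSubsuperalgebra.parity_mem _ _ hm.2⟩ ha)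
      (parity_mem_positivePart h𝔞 hn)
  br_mem x hx y hy := by
    obtain ⟨z, hz, n, hn, rfl⟩ := Submodule.mem_sup.1 hx
    obtain ⟨m, hm, a, ha, rfl⟩ := Submodule.mem_sup.1 hz
    obtain ⟨z', hz', n', hn', rfl⟩ := Submodule.mem_sup.1 hy
    obtain ⟨m', hm', a', ha', rfl⟩ := Submodule.mem_sup.1 hz'
    have r0 : ∀ {m a : 𝔤}, m ∈ (LieSubsuperalgebra.centralizer 𝔞 h𝔞.le_even).toSubmodule →
        a ∈ 𝔞 → m + a ∈ rootSpace 𝔞 0 := by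
      intro m a hm ha h
      have h1 : br (h : 𝔤) m = 0 := hm h h.2
      have h2 : br (h : 𝔤) a = 0 := h𝔞.abelian h h.2 a ha
      rw [map_add, h1, h2]
      simp
    have e : br (m + a) (m' + a') = br m m' := by
      have h1 : br a m' = 0 := hm'.2 a ha
      have h2 : br m a' = 0 := by
        rw [br_even_skew (h𝔞.le_even ha'), show br a' m = 0 from hm.2 a' ha', neg_zero]
      have h3 : br a a' = 0 := h𝔞.abelian a ha a' ha'
      simp only [map_add, LinearMap.add_apply, h1, h2, h3, add_zero]
    have e' : br (m + a + n) (m' + a' + n') =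
        br m m' + (br n (m' + a') + (br (m + a) n' + br n n')) := by
      rw [map_add (br (m + a + n)) (m' + a') n', map_add br (m + a) n]
      simp only [LinearMap.add_apply]
      rw [e]
      abel
    rw [e']
    refine Submodule.add_mem_sup (Submodule.mem_sup_left ⟨LieSubsuperalgebra.br_mem _ _ hm.1 _ hm'.1,
      LieSubsuperalgebra.br_mem _ _ hm.2 _ hm'.2⟩) ?_
    exact Submodule.add_mem _ (br_mem_positivePart_right h𝔞 hn (r0 hm'.2 ha'))
      (Submodule.add_mem _ (br_mem_positivePart_left h𝔞 (r0 hm.2 ha) hn')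
        (br_mem_positivePart h𝔞 hS hn hn'))

/-- The group `M₀ = Z_{K₀}(𝔞)`, as a subgroup of `K₀`. -/
def centralizerGroup {K : Type*} [Group K] (P : CsSupergroupPair 𝔤 E G) (𝔞 : Submodule ℂ 𝔤)
    (φK : K →* G) : Subgroup K where
  carrier := {k | ∀ h ∈ 𝔞, P.Ad (φK k) h = h}
  one_mem' h _ := by rw [map_one, P.Ad_one]
  mul_mem' {k l} hk hl h hh := by rw [map_mul, P.Ad_mul, hl h hh, hk h hh]
  inv_mem' {k} hk h hh := by
    have h1 := P.Ad_mul (φK k⁻¹) (φK k) h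
    rw [← map_mul, inv_mul_cancel, map_one, P.Ad_one, hk h hh] at h1
    exact h1.symm

/-- The group `Q₀ = M₀ A N₀`: the subgroup generated by `M₀`, `A` and `N₀`. (It equals the set of
all products, as `M₀` and `A` commute and `M₀ A` normalises `N₀`.) -/
def minimalParabolicGroup {K A N : Type*} [Group K] [Group A] [Group N]
    (P : CsSupergroupPair 𝔤 E G) (𝔞 : Submodule ℂ 𝔤) (φK : K →* G) (φA : A →* G) (φN : N →* G) :
    Subgroup G :=
  (centralizerGroup P 𝔞 φK).map φK ⊔ φA.range ⊔ φN.range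

end Parabolic

end Pair

end

end CsSuper

open CsSuper

namespace CsSuper

noncomputable section

set_option linter.unusedSectionVars false

open SuperModule
open CsSuper.LieSuperalgebra (br)
open Filter

/-! ### Signs and homogeneous components -/

/-! Restriction is inverted explicitly. Put 𝔟 = 𝔞 ⊕ 𝔫, so that 𝔤 = 𝔨 ⊕ 𝔟, and write g = κ(g)η(g)
with κ(g) ∈ K₀ and η(g) ∈ A N₀. Covariance under right multiplication by 𝔟 recovers f(u)(k), u ∈
𝔘(𝔤), from the values on 𝔘(𝔨). Equivariance under η(g) then forces f(u)(g) = π(η(g))⁻¹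
f(Ad(η(g))u)(κ(g)). This gives injectivity. For surjectivity one takes these two rules as
definitions and checks that the result lies in the induced space.

Algebra. Uniqueness is 𝔘(𝔤) = 𝔘(𝔨)𝔘(𝔟) (`SuperEnv.mem_of_map_of_right`). Existence of a 𝔟-covariant
extension φ̃ of a linear map φ on 𝔘(𝔨) is a statement of Poincaré–Birkhoff–Witt type. No basis is
used: the maps u ↦ φ̃(gu) are built by recursion on u ∈ 𝔘(𝔨), and `SuperEnv.ExtSetup.R_anti` shows
that the resulting operators satisfy the relations of the opposite of 𝔘(𝔤). The decomposition 𝔤 = 𝔨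
⊕ 𝔟 (`isCompl_fixed_cartanPositive`) needs 𝔞 to act diagonalisably on all of 𝔤, the odd part
included. This holds because exp(it ad h) stays in the compact group generated by ad(𝔲₀), which
excludes Jordan blocks (`eq_smul_of_bounded`).

Group. The formula above satisfies f(yu) = 𝓛_y f(u) (`isCovariant_extendGroup`): the A N₀-component
of the velocity lies in 𝔮, and the terms produced by differentiating π and Ad are balanced by right
covariance. Equivariance under A and N₀ is right covariance integrated over a connected group
(`IsCovariant.equivariant`). For m ∈ M₀, the function and its m-translate are both covariant and
agree on 𝔘(𝔨) × K₀, so they coincide by uniqueness.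

Analysis. A class of continuous functions stable under differentiation along curves consists of
smooth functions (`lcSmooth_of_velocity`), so only continuity and first derivatives are ever
checked, both for superfunctions and for orbit maps. As G₀ is locally compact, continuity into an
induced space is joint continuity of evaluation (`continuous_ind_iff`). In this form the inverse of
restriction is seen to be continuous from its formula. -/

theorem parity_cases (i : ZMod 2) : i = 0 ∨ i = 1 := by
  revert i
  decide

theorem one_add_one_parity : (1 + 1 : ZMod 2) = 0 := rfl

theorem koszulSign_comm (i j : ZMod 2) : koszulSign i j = koszulSign j i := by
  unfold koszulSign
  simp only [and_comm]

theorem koszulSign_mul_self (i j : ZMod 2) : koszulSign i j * koszulSign i j = 1 := by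
  unfold koszulSign
  split_ifs <;> norm_num

theorem koszulSign_eq (i j : ZMod 2) : koszulSign i j = 1 ∨ koszulSign i j = -1 := by
  unfold koszulSign
  split_ifs <;> simp

theorem koszulSign_zero_left (j : ZMod 2) : koszulSign 0 j = 1 := by
  simp [koszulSign]

theorem koszulSign_add_left (i j k : ZMod 2) :
    koszulSign (i + j) k = koszulSign i k * koszulSign j k := by
  rcases parity_cases i with rfl | rfl <;> rcases parity_cases j with rfl | rfl <;>
    rcases parity_cases k with rfl | rfl <;> simp [koszulSign, one_add_one_parity]

theorem koszulSign_add_right (i j k : ZMod 2) :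
    koszulSign i (j + k) = koszulSign i j * koszulSign i k := by
  rw [koszulSign_comm, koszulSign_add_left, koszulSign_comm j, koszulSign_comm k]

namespace SuperModule

variable {V : Type*} [AddCommGroup V] [Module ℂ V] [SuperModule V]

/-- The projection onto the homogeneous part of parity `i`. -/
def proj (i : ZMod 2) : V →ₗ[ℂ] V := (2⁻¹ : ℂ) • (LinearMap.id + koszulSign i 1 • parity)

theorem proj_apply (i : ZMod 2) (v : V) :
    proj i v = (2⁻¹ : ℂ) • (v + koszulSign i 1 • parity v) := rfl

theorem proj_mem (i : ZMod 2) (v : V) : proj i v ∈ part V i := by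
  rw [mem_part, proj_apply, map_smul, map_add, map_smul, parity_parity,
    smul_comm (koszulSign i 1) (2⁻¹ : ℂ), smul_add (koszulSign i 1), smul_smul (koszulSign i 1),
    koszulSign_mul_self, one_smul, add_comm]

theorem proj_add_proj (v : V) : proj 0 v + proj 1 v = v := by
  simp only [proj_apply, koszulSign]
  simp
  module

theorem proj_of_mem {i : ZMod 2} {v : V} (h : v ∈ part V i) (j : ZMod 2) :
    proj j v = if j = i then v else 0 := by
  rw [mem_part] at h
  rw [proj_apply, h]
  rcases parity_cases i with rfl | rfl <;> rcases parity_cases j with rfl | rfl <;>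
    simp [koszulSign] <;> module

theorem proj_parity (i : ZMod 2) (v : V) : proj i (parity v) = parity (proj i v) := by
  simp [proj_apply, smul_add]

/-- Two linear maps agree if they agree on homogeneous vectors. -/
theorem linearMap_ext_part {W : Type*} [AddCommGroup W] [Module ℂ W] {f g : V →ₗ[ℂ] W}
    (h : ∀ i, ∀ v ∈ part V i, f v = g v) : f = g := by
  ext v
  rw [← proj_add_proj v, map_add, map_add, h 0 _ (proj_mem 0 v), h 1 _ (proj_mem 1 v)]

theorem twist_of_mem (i : ZMod 2) {j : ZMod 2} {v : V} (h : v ∈ part V j) :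
    twist i v = koszulSign i j • v := by
  rw [mem_part] at h
  rcases parity_cases i with rfl | rfl
  · simp [twist, koszulSign]
  · simpa [twist, koszulSign] using h

theorem twist_twist (i j : ZMod 2) (v : V) : twist i (twist j v) = twist (i + j) v := by
  rcases parity_cases i with rfl | rfl <;> rcases parity_cases j with rfl | rfl <;>
    simp [twist, parity_parity, one_add_one_parity]

theorem twist_zero (v : V) : twist 0 v = v := by simp [twist]

theorem twist_one (v : V) : twist 1 v = parity v := by simp [twist]

end SuperModule

/-! ### Brackets -/

section Bracket

variable {𝔤 : Type*} [AddCommGroup 𝔤] [Module ℂ 𝔤] [LieSuperalgebra 𝔤]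

theorem br_mem_part {i j : ZMod 2} {x y : 𝔤} (hx : x ∈ part 𝔤 i) (hy : y ∈ part 𝔤 j) :
    br x y ∈ part 𝔤 (i + j) := by
  rw [mem_part] at *
  rw [LieSuperalgebra.parity_br, hx, hy, koszulSign_add_left]
  simp [smul_smul, mul_comm]

/-- The Jacobi identity rearranged by skew-symmetry so that z is bracketed from the right, which is
how elements of 𝔨 are moved past elements of 𝔤 in `extAct_rel` and `R_anti`. -/
theorem jacobi_right {i j k : ZMod 2} {x y z : 𝔤} (hx : x ∈ part 𝔤 i) (hy : y ∈ part 𝔤 j)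
    (hz : z ∈ part 𝔤 k) :
    br (br x y) z = br x (br y z) + koszulSign k j • br (br x z) y := by
  rw [LieSuperalgebra.jacobi i j x hx y hy z,
    LieSuperalgebra.br_skew j (i + k) y hy (br x z) (br_mem_part hx hz), koszulSign_add_right,
    koszulSign_comm k j, koszulSign_comm j i, smul_neg, smul_smul, ← mul_assoc,
    koszulSign_mul_self, one_mul]
  abel

namespace LieSubsuperalgebra

theorem proj_mem (𝔥 : LieSubsuperalgebra 𝔤) {x : 𝔤} (hx : x ∈ 𝔥.toSubmodule) (i : ZMod 2) :
    proj i x ∈ 𝔥.toSubmodule := by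
  rw [proj_apply]
  exact Submodule.smul_mem _ _ (Submodule.add_mem _ hx (Submodule.smul_mem _ _ (𝔥.parity_mem _ hx)))

theorem mem_part_carrier (𝔥 : LieSubsuperalgebra 𝔤) {i : ZMod 2} {x : 𝔥.Carrier}
    (hx : (x : 𝔤) ∈ part 𝔤 i) : x ∈ part 𝔥.Carrier i := by
  rw [mem_part] at hx ⊢
  exact Subtype.ext hx

end LieSubsuperalgebra

theorem LieSuperHom.map_proj {𝔥 : Type*} [AddCommGroup 𝔥] [Module ℂ 𝔥] [LieSuperalgebra 𝔥]
    (φ : LieSuperHom 𝔤 𝔥) (i : ZMod 2) (x : 𝔤) : φ (proj i x) = proj i (φ x) := by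
  rw [proj_apply, proj_apply, map_smul, map_add, map_smul, φ.map_parity]

end Bracket

/-! ### Induction in the enveloping algebra -/

namespace SuperEnv

variable {𝔤 : Type*} [AddCommGroup 𝔤] [Module ℂ 𝔤] [LieSuperalgebra 𝔤]

/-- The universal property yields a map into the generated subalgebra. Followed by the inclusion it
fixes the generators, so it is the identity. -/
theorem adjoin_range_ι : Algebra.adjoin ℂ (Set.range (ι : 𝔤 →ₗ[ℂ] SuperEnv 𝔤)) = ⊤ := by
  set B := Algebra.adjoin ℂ (Set.range (ι : 𝔤 →ₗ[ℂ] SuperEnv 𝔤)) with hB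
  let j : 𝔤 →ₗ[ℂ] B := LinearMap.codRestrict (Subalgebra.toSubmodule B) ι
    (fun x => Algebra.subset_adjoin ⟨x, rfl⟩)
  have hj : ∀ i k, ∀ x ∈ part 𝔤 i, ∀ y ∈ part 𝔤 k,
      j x * j y = j (br x y) + koszulSign i k • (j y * j x) :=
    fun i k x hx y hy => Subtype.ext (ι_mul_ι hx hy)
  let l := lift (A := B) j hj
  have h : B.val.comp l = AlgHom.id ℂ _ := algHom_ext (fun x => by
    simp only [AlgHom.comp_apply, l, lift_ι]
    rfl)
  rw [eq_top_iff]
  intro u _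
  have := DFunLike.congr_fun h u
  rw [AlgHom.id_apply] at this
  rw [← this]
  exact (l u).2

/-- A subspace of the enveloping algebra that contains `1` and is stable under left multiplication
by homogeneous elements of the Lie superalgebra is everything. -/
theorem mem_of_left (p : Submodule ℂ (SuperEnv 𝔤)) (h1 : 1 ∈ p)
    (hmul : ∀ i, ∀ x ∈ part 𝔤 i, ∀ u ∈ p, ι x * u ∈ p) (u : SuperEnv 𝔤) : u ∈ p := by
  have hmul' : ∀ x : 𝔤, ∀ u ∈ p, ι x * u ∈ p := by
    intro x u hu
    rw [← proj_add_proj x, map_add, add_mul]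
    exact p.add_mem (hmul 0 _ (proj_mem 0 x) u hu) (hmul 1 _ (proj_mem 1 x) u hu)
  have key : ∀ v ∈ Algebra.adjoin ℂ (Set.range (ι : 𝔤 →ₗ[ℂ] SuperEnv 𝔤)), ∀ u ∈ p, v * u ∈ p := by
    intro v hv
    induction hv using Algebra.adjoin_induction with
    | mem x hx =>
      obtain ⟨x, rfl⟩ := hx
      exact hmul' x
    | algebraMap r =>
      intro u hu
      rw [← Algebra.smul_def]
      exact p.smul_mem _ hu
    | add x y _ _ hx hy =>
      intro u hu
      rw [add_mul]
      exact p.add_mem (hx u hu) (hy u hu)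
    | mul x y _ _ hx hy =>
      intro u hu
      rw [mul_assoc]
      exact hx _ (hy u hu)
  have := key u (by rw [adjoin_range_ι]; trivial) 1 h1
  rwa [mul_one] at this

/-- If `𝔤 = 𝔨 + 𝔟`, then a subspace of `𝔘(𝔤)` which contains the image of `𝔘(𝔨)` and is stable under
right multiplication by homogeneous elements of `𝔟` is everything. -/
theorem mem_of_map_of_right {𝔨 𝔟 : LieSubsuperalgebra 𝔤}
    (hsup : 𝔨.toSubmodule ⊔ 𝔟.toSubmodule = ⊤)
    (p : Submodule ℂ (SuperEnv 𝔤)) (hK : ∀ u, map 𝔨.incl u ∈ p)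
    (hB : ∀ i, ∀ z ∈ 𝔟.toSubmodule, z ∈ part 𝔤 i → ∀ u ∈ p, u * ι z ∈ p) (u : SuperEnv 𝔤) :
    u ∈ p := by
  -- The least subspace with the two properties of p. Stability under left multiplication fails for
  -- a general p, but for q it follows from minimality.
  let q : Submodule ℂ (SuperEnv 𝔤) := sInf {q | (∀ u, map 𝔨.incl u ∈ q) ∧
    ∀ i, ∀ z ∈ 𝔟.toSubmodule, z ∈ part 𝔤 i → ∀ u ∈ q, u * ι z ∈ q}
  have qp : q ≤ p := sInf_le ⟨hK, hB⟩
  have qK : ∀ u, map 𝔨.incl u ∈ q := fun u => by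
    simp only [q, Submodule.mem_sInf]
    exact fun r hr => hr.1 u
  have qB : ∀ i, ∀ z ∈ 𝔟.toSubmodule, z ∈ part 𝔤 i → ∀ u ∈ q, u * ι z ∈ q := by
    intro i z hz hi u hu
    simp only [q, Submodule.mem_sInf] at hu ⊢
    exact fun r hr => hr.2 i z hz hi u (hu r hr)
  have qmin : ∀ r : Submodule ℂ (SuperEnv 𝔤), (∀ u, map 𝔨.incl u ∈ r) →
      (∀ i, ∀ z ∈ 𝔟.toSubmodule, z ∈ part 𝔤 i → ∀ u ∈ r, u * ι z ∈ r) → q ≤ r :=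
    fun r h1 h2 => sInf_le ⟨h1, h2⟩
  have qBall : ∀ z ∈ 𝔟.toSubmodule, ∀ u ∈ q, u * ι z ∈ q := by
    intro z hz u hu
    rw [← proj_add_proj z, map_add, mul_add]
    exact q.add_mem (qB 0 _ (𝔟.proj_mem hz 0) (proj_mem 0 z) u hu)
      (qB 1 _ (𝔟.proj_mem hz 1) (proj_mem 1 z) u hu)
  -- Induction on v with g arbitrary, since moving g past a factor x ∈ 𝔨 replaces it by [g, x].
  have left_map : ∀ (v : SuperEnv 𝔨.Carrier) (g : 𝔤), ι g * map 𝔨.incl v ∈ q := by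
    let r : Submodule ℂ (SuperEnv 𝔨.Carrier) :=
      { carrier := {v | ∀ g : 𝔤, ι g * map 𝔨.incl v ∈ q}
        zero_mem' := fun g => by simp
        add_mem' := fun {a b} ha hb g => by
          rw [map_add, mul_add]
          exact q.add_mem (ha g) (hb g)
        smul_mem' := fun c a ha g => by
          rw [map_smul, mul_smul_comm]
          exact q.smul_mem _ (ha g) }
    have kB : ∀ g : 𝔤, ∃ x : 𝔨.Carrier, ∃ z ∈ 𝔟.toSubmodule, g = x + z := by
      intro g
      have : g ∈ 𝔨.toSubmodule ⊔ 𝔟.toSubmodule := by rw [hsup]; trivial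
      obtain ⟨x, hx, z, hz, h⟩ := Submodule.mem_sup.1 this
      exact ⟨⟨x, hx⟩, z, hz, h.symm⟩
    refine fun v => mem_of_left r ?_ ?_ v
    · intro g
      obtain ⟨x, z, hz, rfl⟩ := kB g
      rw [map_one, mul_one, map_add]
      refine q.add_mem ?_ ?_
      · have := qK (ι x)
        rwa [map_ι] at this
      · have := qBall z hz 1 (by simpa using qK 1)
        rwa [one_mul] at this
    · intro i x hx v hv g
      -- The preimage of q under left multiplication by x again has the two defining properties of
      -- q, so it contains q.
      have hq : ∀ w ∈ q, ι (x : 𝔤) * w ∈ q := by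
        let s : Submodule ℂ (SuperEnv 𝔤) :=
          q.comap (LinearMap.mulLeft ℂ (ι (x : 𝔤)))
        refine fun w hw => (qmin s ?_ ?_) hw
        · intro w
          have := qK (ι x * w)
          rwa [map_mul, map_ι] at this
        · intro j z hz hj w hw
          simp only [s, Submodule.mem_comap, LinearMap.mulLeft_apply] at hw ⊢
          rw [← mul_assoc]
          exact qB j z hz hj _ hw
      rw [map_mul, map_ι, ← mul_assoc]
      have hx' := 𝔨.coe_mem_part hx
      have hlin : ∀ g : 𝔤, ι g * ι (x : 𝔤) = ι (br g x) + ι (x : 𝔤) * ι (twist i g) := by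
        intro g
        have : (LinearMap.mulRight ℂ (ι (x : 𝔤))).comp ι =
            ι.comp ((br : 𝔤 →ₗ[ℂ] 𝔤 →ₗ[ℂ] 𝔤).flip (x : 𝔤)) +
              (LinearMap.mulLeft ℂ (ι (x : 𝔤))).comp (ι.comp (twist i)) := by
          refine linearMap_ext_part fun j y hy => ?_
          simp only [LinearMap.comp_apply, LinearMap.add_apply, LinearMap.mulRight_apply,
            LinearMap.mulLeft_apply, LinearMap.flip_apply]
          rw [twist_of_mem i hy, ι_mul_ι hy hx', map_smul, mul_smul_comm, koszulSign_comm]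
        exact DFunLike.congr_fun this g
      change ι g * ι (x : 𝔤) * _ ∈ q
      rw [hlin, add_mul, mul_assoc]
      exact q.add_mem (hv _) (hq _ (hv _))
  have left_q : ∀ (g : 𝔤), ∀ w ∈ q, ι g * w ∈ q := by
    intro g
    let s : Submodule ℂ (SuperEnv 𝔤) := q.comap (LinearMap.mulLeft ℂ (ι g))
    refine fun w hw => (qmin s ?_ ?_) hw
    · intro w
      exact left_map w g
    · intro j z hz hj w hw
      simp only [s, Submodule.mem_comap, LinearMap.mulLeft_apply] at hw ⊢
      rw [← mul_assoc]
      exact qB j z hz hj _ hw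
  exact qp (mem_of_left q (by simpa using qK 1) (fun i x _ u hu => left_q x u hu) u)

end SuperEnv

/-! ### Extending linear maps from `𝔘(𝔨)` to `𝔘(𝔤)` -/

namespace SuperEnv

section Extension

variable {𝔤 : Type*} [AddCommGroup 𝔤] [Module ℂ 𝔤] [LieSuperalgebra 𝔤]

/-- Bilinear maps which send a linear map `φ : 𝔘(𝔨) → V` and `g ∈ 𝔤` to a vector of `V`. They model
the assignments `(φ, g) ↦ φ̃(g u)`, where `φ̃` is an extension of `φ` to `𝔘(𝔤)`. -/
abbrev ExtData (𝔨 : LieSubsuperalgebra 𝔤) (V : Type*) [AddCommGroup V] [Module ℂ V] : Type _ :=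
  (SuperEnv 𝔨.Carrier →ₗ[ℂ] V) →ₗ[ℂ] 𝔤 →ₗ[ℂ] V

variable {𝔨 : LieSubsuperalgebra 𝔤} {V : Type*} [AddCommGroup V] [Module ℂ V]

/-- The effect of left multiplication by an element of `𝔨` of parity `i` on `ExtData`. -/
def extOp (i : ZMod 2) : 𝔨.Carrier →ₗ[ℂ] Module.End ℂ (ExtData 𝔨 V) :=
  LinearMap.mk₂ ℂ (fun x β => LinearMap.mk₂ ℂ
      (fun φ g => β φ (br g (x : 𝔤)) + β (φ.comp (LinearMap.mulLeft ℂ (ι x))) (twist i g))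
      (fun φ φ' g => by simp [LinearMap.add_comp]; abel)
      (fun c φ g => by simp [LinearMap.smul_comp])
      (fun φ g g' => by simp; abel)
      (fun c φ g => by simp))
    (fun x y β => by
      ext φ g
      have : LinearMap.mulLeft ℂ (ι x + ι y) =
          LinearMap.mulLeft ℂ (ι x) + LinearMap.mulLeft ℂ (ι y) := by
        ext u; simp [add_mul]
      simp only [LinearMap.mk₂_apply, map_add, this, LinearMap.comp_add, LinearMap.add_apply,
        Submodule.coe_add]
      abel)
    (fun c x β => by
      ext φ g
      have : LinearMap.mulLeft ℂ (c • ι x) = c • LinearMap.mulLeft ℂ (ι x) := by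
        ext u; simp
      simp only [LinearMap.mk₂_apply, map_smul, this, LinearMap.comp_smul, LinearMap.smul_apply,
        Submodule.coe_smul, smul_add])
    (fun x β β' => by
      ext φ g
      simp
      abel)
    (fun c x β => by
      ext φ g
      simp)

theorem extOp_apply (i : ZMod 2) (x : 𝔨.Carrier) (β : ExtData 𝔨 V)
    (φ : SuperEnv 𝔨.Carrier →ₗ[ℂ] V) (g : 𝔤) :
    extOp i x β φ g =
      β φ (br g (x : 𝔤)) + β (φ.comp (LinearMap.mulLeft ℂ (ι x))) (twist i g) := rfl

/-- The action of `𝔨` on `ExtData`. -/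
def extAct : 𝔨.Carrier →ₗ[ℂ] Module.End ℂ (ExtData 𝔨 V) :=
  (extOp 0).comp (proj 0) + (extOp 1).comp (proj 1)

theorem extAct_of_mem {i : ZMod 2} {x : 𝔨.Carrier} (hx : x ∈ part 𝔨.Carrier i) :
    (extAct x : Module.End ℂ (ExtData 𝔨 V)) = extOp i x := by
  simp only [extAct, LinearMap.add_apply, LinearMap.comp_apply, proj_of_mem hx]
  rcases parity_cases i with rfl | rfl <;> simp

/-- Consistency of the recursion: moving g past xy, past yx and past [x, y] gives compatible
results, by the Jacobi identity for the bracket terms and the relation of 𝔘(𝔨) for the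
multiplication terms. -/
theorem extAct_rel (i j : ZMod 2) (x : 𝔨.Carrier) (hx : x ∈ part 𝔨.Carrier i) (y : 𝔨.Carrier)
    (hy : y ∈ part 𝔨.Carrier j) :
    (extAct x * extAct y : Module.End ℂ (ExtData 𝔨 V)) =
      extAct (br x y) + koszulSign i j • (extAct y * extAct x) := by
  rw [extAct_of_mem hx, extAct_of_mem hy, extAct_of_mem (br_mem_part hx hy)]
  refine LinearMap.ext fun β => LinearMap.ext fun φ => linearMap_ext_part fun k g hg => ?_
  simp only [Module.End.mul_apply, LinearMap.add_apply, LinearMap.smul_apply, extOp_apply]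
  have hgx := br_mem_part hg (𝔨.coe_mem_part hx)
  have hgy := br_mem_part hg (𝔨.coe_mem_part hy)
  have hJ := LieSuperalgebra.jacobi k i g hg x (𝔨.coe_mem_part hx) (y : 𝔤)
  have hJ' := jacobi_right hg (𝔨.coe_mem_part hx) (𝔨.coe_mem_part hy)
  have hmul : φ.comp (LinearMap.mulLeft ℂ (ι (br x y))) =
      (φ.comp (LinearMap.mulLeft ℂ (ι x))).comp (LinearMap.mulLeft ℂ (ι y)) -
      koszulSign i j • (φ.comp (LinearMap.mulLeft ℂ (ι y))).comp (LinearMap.mulLeft ℂ (ι x)) := by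
    ext u
    have h := ι_mul_ι hx hy
    simp only [LinearMap.comp_apply, LinearMap.sub_apply, LinearMap.smul_apply,
      LinearMap.mulLeft_apply]
    rw [← mul_assoc, ← mul_assoc, h, add_mul, map_add, smul_mul_assoc, map_smul]
    abel
  have hbr : ((br x y : 𝔨.Carrier) : 𝔤) = br (x : 𝔤) (y : 𝔤) := rfl
  rw [hbr, hmul]
  rw [twist_of_mem j hgx, twist_of_mem i hg, twist_of_mem j hg, twist_of_mem i hgy,
    twist_of_mem (i + j) hg]
  simp only [map_smul, twist_of_mem i hg, twist_of_mem j hg, LinearMap.sub_apply, map_sub,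
    LinearMap.smul_apply, koszulSign_add_left, koszulSign_add_right, hJ', smul_add, smul_sub,
    map_add, smul_smul]
  rw [koszulSign_comm j i]
  simp only [koszulSign_comm i k, koszulSign_comm j k]
  -- Only the square of this sign has to simplify, so fixing its value leaves an identity linear in
  -- the vectors.
  rcases koszulSign_eq i j with h | h <;> rw [h] <;> module

/-- The action of `𝔘(𝔨)` on `ExtData`. -/
def extAlg : SuperEnv 𝔨.Carrier →ₐ[ℂ] Module.End ℂ (ExtData 𝔨 V) :=
  lift (A := Module.End ℂ (ExtData 𝔨 V)) extAct extAct_rel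

/-- The data describing a decomposition `𝔤 = 𝔨 ⊕ 𝔟` into graded subalgebras by its projections,
together with an anti-representation of `𝔟` on `V`. -/
structure ExtSetup (𝔨 𝔟 : LieSubsuperalgebra 𝔤) (σ : 𝔤 →ₗ[ℂ] Module.End ℂ V) where
  pK : 𝔤 →ₗ[ℂ] 𝔨.Carrier
  pB : 𝔤 →ₗ[ℂ] 𝔤
  pB_mem : ∀ g, pB g ∈ 𝔟.toSubmodule
  add_eq : ∀ g, (pK g : 𝔤) + pB g = g
  pK_coe : ∀ x : 𝔨.Carrier, pK x = x
  pK_of_mem : ∀ z ∈ 𝔟.toSubmodule, pK z = 0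
  pK_part : ∀ i, ∀ g ∈ part 𝔤 i, (pK g : 𝔤) ∈ part 𝔤 i
  anti : ∀ i j, ∀ z ∈ 𝔟.toSubmodule, z ∈ part 𝔤 i → ∀ z' ∈ 𝔟.toSubmodule, z' ∈ part 𝔤 j → ∀ v,
    σ z' (σ z v) = σ (br z z') v + koszulSign i j • σ z (σ z' v)

namespace ExtSetup

variable {𝔟 : LieSubsuperalgebra 𝔤} {σ : 𝔤 →ₗ[ℂ] Module.End ℂ V} (D : ExtSetup 𝔨 𝔟 σ)

theorem pB_eq (g : 𝔤) : D.pB g = g - D.pK g := by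
  rw [eq_sub_iff_add_eq, add_comm, D.add_eq]

theorem pB_coe (x : 𝔨.Carrier) : D.pB x = 0 := by rw [pB_eq, D.pK_coe, sub_self]

theorem pB_of_mem {z : 𝔤} (hz : z ∈ 𝔟.toSubmodule) : D.pB z = z := by
  rw [pB_eq, D.pK_of_mem z hz]
  simp

theorem pB_part {i : ZMod 2} {g : 𝔤} (hg : g ∈ part 𝔤 i) : D.pB g ∈ part 𝔤 i := by
  rw [pB_eq]
  exact Submodule.sub_mem _ hg (D.pK_part i g hg)

/-- The initial datum `(φ, g) ↦ φ̃(g)`. -/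
def base : ExtData 𝔨 V :=
  LinearMap.mk₂ ℂ (fun φ g => φ (ι (D.pK g)) + σ (D.pB g) (φ 1))
    (fun φ φ' g => by simp; abel) (fun c φ g => by simp)
    (fun φ g g' => by simp; abel) (fun c φ g => by simp)

theorem base_apply (φ : SuperEnv 𝔨.Carrier →ₗ[ℂ] V) (g : 𝔤) :
    D.base φ g = φ (ι (D.pK g)) + σ (D.pB g) (φ 1) := rfl

/-- The right action `(R_g φ)(u) = φ̃(g u)` of `𝔤` on linear maps `𝔘(𝔨) → V`. -/
def R : 𝔤 →ₗ[ℂ] Module.End ℂ (SuperEnv 𝔨.Carrier →ₗ[ℂ] V) :=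
  LinearMap.mk₂ ℂ (fun g φ =>
      { toFun := fun u => extAlg u D.base φ g
        map_add' := fun u v => by simp
        map_smul' := fun c u => by simp })
    (fun g g' φ => by ext u; simp) (fun c g φ => by ext u; simp)
    (fun g φ φ' => by ext u; simp) (fun c g φ => by ext u; simp)

theorem R_apply (g : 𝔤) (φ : SuperEnv 𝔨.Carrier →ₗ[ℂ] V) (u : SuperEnv 𝔨.Carrier) :
    D.R g φ u = extAlg u D.base φ g := rfl

theorem R_one (g : 𝔤) (φ : SuperEnv 𝔨.Carrier →ₗ[ℂ] V) :
    D.R g φ 1 = φ (ι (D.pK g)) + σ (D.pB g) (φ 1) := by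
  rw [R_apply, map_one]
  rfl

/-- The recursion behind `extOp`: gx = [g, x] ± xg gives φ̃(gxu) = φ̃([g, x]u) ± φ̃(xgu), and φ̃(x
·) is the extension of φ(x ·). -/
theorem R_ι_mul {i : ZMod 2} {x : 𝔨.Carrier} (hx : x ∈ part 𝔨.Carrier i) (g : 𝔤)
    (φ : SuperEnv 𝔨.Carrier →ₗ[ℂ] V) (u : SuperEnv 𝔨.Carrier) :
    D.R g φ (ι x * u) =
      D.R (br g (x : 𝔤)) φ u + D.R (twist i g) (φ.comp (LinearMap.mulLeft ℂ (ι x))) u := by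
  rw [R_apply, map_mul, Module.End.mul_apply]
  have : (extAlg (ι x) : Module.End ℂ (ExtData 𝔨 V)) = extOp i x := by
    rw [extAlg, lift_ι, extAct_of_mem hx]
  rw [this]
  rfl

/-- The recursion does not alter φ on 𝔘(𝔨): for u = yv its two terms recombine to φ(xyv) by the
defining relation. The induction leaves x and φ free because it uses [x, y] and φ(y ·). -/
theorem R_coe (x : 𝔨.Carrier) (φ : SuperEnv 𝔨.Carrier →ₗ[ℂ] V) :
    D.R x φ = φ.comp (LinearMap.mulLeft ℂ (ι x)) := by
  have key : ∀ u, ∀ i, ∀ x ∈ part 𝔨.Carrier i, ∀ φ : SuperEnv 𝔨.Carrier →ₗ[ℂ] V,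
      D.R x φ u = φ (ι x * u) := by
    let p : Submodule ℂ (SuperEnv 𝔨.Carrier) :=
      { carrier := {u | ∀ i, ∀ x ∈ part 𝔨.Carrier i, ∀ φ : SuperEnv 𝔨.Carrier →ₗ[ℂ] V,
          D.R x φ u = φ (ι x * u)}
        zero_mem' := fun i x _ φ => by simp
        add_mem' := fun {a b} ha hb i x hx φ => by
          rw [map_add, ha i x hx, hb i x hx, mul_add, map_add]
        smul_mem' := fun c a ha i x hx φ => by
          rw [map_smul, ha i x hx, mul_smul_comm, map_smul] }
    refine mem_of_left p ?_ ?_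
    · intro i x _ φ
      rw [R_one, D.pK_coe, D.pB_coe]
      simp
    · intro j y hy u hu i x hx φ
      have h1 := hu (i + j) (br x y) (br_mem_part hx hy) φ
      have hbr : ((br x y : 𝔨.Carrier) : 𝔤) = br (x : 𝔤) (y : 𝔤) := rfl
      rw [R_ι_mul D hy, ← hbr, h1, twist_of_mem j (𝔨.coe_mem_part hx), map_smul,
        LinearMap.smul_apply, LinearMap.smul_apply, hu i x hx, LinearMap.comp_apply,
        LinearMap.mulLeft_apply, ← mul_assoc, ← mul_assoc, ι_mul_ι hx hy, add_mul, map_add,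
        smul_mul_assoc, map_smul, koszulSign_comm]
  ext u
  rw [← proj_add_proj x]
  simp only [Submodule.coe_add, map_add, LinearMap.add_apply, LinearMap.comp_apply,
    LinearMap.mulLeft_apply, add_mul]
  rw [key u 0 _ (proj_mem 0 x), key u 1 _ (proj_mem 1 x)]

theorem R_anti_coe_right {i j : ZMod 2} {g : 𝔤} (hg : g ∈ part 𝔤 i) {x : 𝔨.Carrier}
    (hx : x ∈ part 𝔨.Carrier j) (φ : SuperEnv 𝔨.Carrier →ₗ[ℂ] V) :
    D.R x (D.R g φ) = D.R (br g (x : 𝔤)) φ + koszulSign i j • D.R g (D.R x φ) := by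
  ext u
  rw [R_coe, R_coe, LinearMap.comp_apply, LinearMap.mulLeft_apply, R_ι_mul D hx,
    twist_of_mem j hg, koszulSign_comm]
  simp

/-- The heart of the extension. Heuristically R_{g'} R_g φ is u ↦ φ̃(gg'u), so this is the relation
of the opposite of 𝔘(𝔤). It is proved by induction on u, for all g, g' and φ at once. -/
theorem R_anti {i j : ZMod 2} {g g' : 𝔤} (hg : g ∈ part 𝔤 i) (hg' : g' ∈ part 𝔤 j)
    (φ : SuperEnv 𝔨.Carrier →ₗ[ℂ] V) :
    D.R g' (D.R g φ) = D.R (br g g') φ + koszulSign i j • D.R g (D.R g' φ) := by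
  have key : ∀ u, ∀ i j, ∀ g ∈ part 𝔤 i, ∀ g' ∈ part 𝔤 j, ∀ φ : SuperEnv 𝔨.Carrier →ₗ[ℂ] V,
      D.R g' (D.R g φ) u = D.R (br g g') φ u + koszulSign i j • D.R g (D.R g' φ) u := by
    let p : Submodule ℂ (SuperEnv 𝔨.Carrier) :=
      { carrier := {u | ∀ i j, ∀ g ∈ part 𝔤 i, ∀ g' ∈ part 𝔤 j,
          ∀ φ : SuperEnv 𝔨.Carrier →ₗ[ℂ] V,
          D.R g' (D.R g φ) u = D.R (br g g') φ u + koszulSign i j • D.R g (D.R g' φ) u}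
        zero_mem' := fun i j g _ g' _ φ => by simp
        add_mem' := fun {a b} ha hb i j g hg g' hg' φ => by
          simp only [map_add]
          rw [ha i j g hg g' hg', hb i j g hg g' hg', smul_add]
          abel
        smul_mem' := fun c a ha i j g hg g' hg' φ => by
          simp only [map_smul]
          rw [ha i j g hg g' hg', smul_add, smul_comm] }
    refine mem_of_left p ?_ ?_
    · intro i j g hg g' hg' φ
      have hx := D.pK_part i g hg
      have hx' := D.pK_part j g' hg'
      have hz := D.pB_part hg
      have hz' := D.pB_part hg'
      -- At u = 1, split g and g' along 𝔨 ⊕ 𝔟. If g' ∈ 𝔨 this is `R_anti_coe_right`; if g' ∈ 𝔟 and g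
      -- ∈ 𝔨 it is the same with the roles exchanged (a2); if both lie in 𝔟 it is the
      -- anti-representation property of σ (a3).
      have a1 := DFunLike.congr_fun (D.R_anti_coe_right hg (𝔨.mem_part_carrier hx') φ) 1
      have a2 := DFunLike.congr_fun (D.R_anti_coe_right hz' (𝔨.mem_part_carrier hx) φ) 1
      have a3 : D.R (D.pB g') (D.R (D.pB g) φ) 1 = D.R (br (D.pB g) (D.pB g')) φ 1 +
          koszulSign i j • D.R (D.pB g) (D.R (D.pB g') φ) 1 := by
        have m := D.pB_mem g
        have m' := D.pB_mem g'
        have m'' := 𝔟.br_mem _ m _ m'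
        simp only [R_one, D.pK_of_mem _ m, D.pK_of_mem _ m', D.pK_of_mem _ m'', D.pB_of_mem m,
          D.pB_of_mem m', D.pB_of_mem m'', map_zero, zero_add]
        exact D.anti i j _ m hz _ m' hz' _
      have a4 : br (D.pB g') (D.pK g : 𝔤) = -(koszulSign i j • br (D.pK g : 𝔤) (D.pB g')) := by
        rw [LieSuperalgebra.br_skew j i _ hz' _ hx, koszulSign_comm]
      rw [a4] at a2
      have eg := D.add_eq g
      have eg' := D.add_eq g'
      generalize D.pK g = x at *
      generalize D.pK g' = x' at *
      generalize D.pB g = z at *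
      generalize D.pB g' = z' at *
      subst eg eg'
      rw [koszulSign_comm j i] at a2
      simp only [map_add, map_neg, map_smul, LinearMap.add_apply, LinearMap.neg_apply,
        LinearMap.smul_apply, smul_add] at a1 a2 a3 ⊢
      rcases koszulSign_eq i j with h | h <;> rw [h] at a1 a2 a3 ⊢
      · linear_combination (norm := module) a1 + a3 - a2
      · linear_combination (norm := module) a1 + a3 + a2
    -- Passing from u to xu uses the induction hypothesis for (g, [g', x]), for ([g, x], g'), and
    -- for (g, g') with φ(x ·), combined by the Jacobi identity.
    · intro k x hx u hu i j g hg g' hg' φ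
      have hxg := 𝔨.coe_mem_part hx
      have b1 := hu i (j + k) g hg _ (br_mem_part hg' hxg) φ
      have b2 := hu (i + k) j _ (br_mem_part hg hxg) g' hg' φ
      have b3 := hu i j g hg g' hg' (φ.comp (LinearMap.mulLeft ℂ (ι x)))
      have c1 := D.R_anti_coe_right hg hx φ
      have c2 := D.R_anti_coe_right hg' hx φ
      have hJ := jacobi_right hg hg' hxg
      rw [R_coe, R_coe] at c1 c2
      rw [R_ι_mul D hx, R_ι_mul D hx, R_ι_mul D hx, twist_of_mem k hg, twist_of_mem k hg',
        twist_of_mem k (br_mem_part hg hg'), hJ, c1, c2]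
      simp only [koszulSign_add_left, koszulSign_add_right] at b1 b2 b3 ⊢
      simp only [map_add, map_smul, LinearMap.add_apply, LinearMap.smul_apply, b1, b2, b3,
        smul_add, smul_smul, koszulSign_comm k]
      rcases koszulSign_eq i k with h | h <;> rcases koszulSign_eq j k with h' | h' <;>
        rw [h, h'] <;> module
  ext u
  exact key u i j g hg g' hg' φ

/-- The extension of the right action `R` to an action of the opposite of `𝔘(𝔤)`. -/
def RAlg : SuperEnv 𝔤 →ₐ[ℂ] (Module.End ℂ (SuperEnv 𝔨.Carrier →ₗ[ℂ] V))ᵐᵒᵖ :=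
  lift ((MulOpposite.opLinearEquiv ℂ).toLinearMap.comp D.R) (fun i j g hg g' hg' => by
    apply MulOpposite.unop_injective
    ext φ : 1
    exact D.R_anti hg hg' φ)

theorem RAlg_ι (g : 𝔤) : D.RAlg (ι g) = MulOpposite.op (D.R g) := by
  rw [RAlg, lift_ι]
  rfl

/-- The extension of a linear map `φ : 𝔘(𝔨) → V` to `𝔘(𝔤)`. -/
def extend (φ : SuperEnv 𝔨.Carrier →ₗ[ℂ] V) : SuperEnv 𝔤 →ₗ[ℂ] V where
  -- The operator attached to u sends φ to v ↦ φ̃(uv); evaluation at v = 1 leaves φ̃(u).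
  toFun u := (D.RAlg u).unop φ 1
  map_add' u v := by simp
  map_smul' c u := by simp

/-- In the opposite algebra the last factor z acts last, and R_z ψ(1) = σ(z)ψ(1) because the
𝔨-component of z vanishes. -/
theorem extend_mul (φ : SuperEnv 𝔨.Carrier →ₗ[ℂ] V) (u : SuperEnv 𝔤) {z : 𝔤}
    (hz : z ∈ 𝔟.toSubmodule) : D.extend φ (u * ι z) = σ z (D.extend φ u) := by
  change (D.RAlg (u * ι z)).unop φ 1 = σ z ((D.RAlg u).unop φ 1)
  rw [map_mul, RAlg_ι, MulOpposite.unop_mul, MulOpposite.unop_op, Module.End.mul_apply, R_one,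
    D.pK_of_mem z hz, D.pB_of_mem hz, map_zero, map_zero, zero_add]

theorem extend_map (φ : SuperEnv 𝔨.Carrier →ₗ[ℂ] V) (u : SuperEnv 𝔨.Carrier) :
    D.extend φ (map 𝔨.incl u) = φ u := by
  have key : ∀ u : SuperEnv 𝔨.Carrier, ∀ φ : SuperEnv 𝔨.Carrier →ₗ[ℂ] V,
      (D.RAlg (map 𝔨.incl u)).unop φ = φ.comp (LinearMap.mulLeft ℂ u) := by
    let p : Submodule ℂ (SuperEnv 𝔨.Carrier) :=
      { carrier := {u | ∀ φ : SuperEnv 𝔨.Carrier →ₗ[ℂ] V,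
          (D.RAlg (map 𝔨.incl u)).unop φ = φ.comp (LinearMap.mulLeft ℂ u)}
        zero_mem' := fun φ => by ext; simp
        add_mem' := fun {a b} ha hb φ => by
          ext v
          rw [map_add, map_add, MulOpposite.unop_add, LinearMap.add_apply, ha, hb]
          simp [add_mul]
        smul_mem' := fun c a ha φ => by
          ext v
          rw [map_smul, map_smul, MulOpposite.unop_smul, LinearMap.smul_apply, ha]
          simp }
    refine mem_of_left p ?_ ?_
    · intro φ
      ext v
      simp
    · intro i x _ u hu φ
      rw [map_mul, map_mul, map_ι, RAlg_ι, MulOpposite.unop_mul, Module.End.mul_apply,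
        MulOpposite.unop_op]
      change (D.RAlg (map 𝔨.incl u)).unop (D.R (x : 𝔤) φ) = _
      rw [hu, R_coe]
      ext v
      simp
  change (D.RAlg (map 𝔨.incl u)).unop φ 1 = φ u
  rw [key]
  simp

end ExtSetup

end Extension

end SuperEnv

/-! ### Calculus in locally convex spaces -/

section Calculus

variable {V : Type*} [AddCommGroup V] [Module ℂ V] [SuperModule V] [UniformSpace V]
  [LCSuperSpace V]
  {W : Type*} [AddCommGroup W] [Module ℂ W] [SuperModule W] [UniformSpace W] [LCSuperSpace W]

instance continuousSMul_real : ContinuousSMul ℝ V where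
  continuous_smul := by
    have : (fun p : ℝ × V => p.1 • p.2) = fun p : ℝ × V => (p.1 : ℂ) • p.2 := by
      ext p
      rw [Complex.coe_smul]
    rw [this]
    fun_prop

theorem HasVelocity.tendsto_nhdsNE {c : ℝ → V} {v : V} (h : HasVelocity c v) :
    Tendsto c (𝓝[≠] 0) (𝓝 (c 0)) := by
  have h1 : Tendsto (fun t : ℝ => t) (𝓝[≠] 0) (𝓝 0) := tendsto_id.mono_left nhdsWithin_le_nhds
  have h2 := (h1.smul h).add (tendsto_const_nhds (x := c 0))
  rw [zero_smul, zero_add] at h2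
  refine h2.congr' ?_
  filter_upwards [self_mem_nhdsWithin] with t ht
  rw [smul_inv_smul₀ ht, sub_add_cancel]

theorem HasVelocity.continuousAt {c : ℝ → V} {v : V} (h : HasVelocity c v) : ContinuousAt c 0 := by
  rw [ContinuousAt, ← nhdsNE_sup_pure]
  exact h.tendsto_nhdsNE.sup (tendsto_pure_nhds c 0)

theorem HasVelocity.unique {c : ℝ → V} {v w : V} (h : HasVelocity c v) (h' : HasVelocity c w) :
    v = w :=
  tendsto_nhds_unique h h'

theorem HasVelocity.sum {ι : Type*} (s : Finset ι) {c : ι → ℝ → V} {v : ι → V}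
    (h : ∀ i ∈ s, HasVelocity (c i) (v i)) :
    HasVelocity (fun t => ∑ i ∈ s, c i t) (∑ i ∈ s, v i) := by
  refine (tendsto_finsetSum s h).congr fun t => ?_
  rw [← Finset.smul_sum, Finset.sum_sub_distrib]

theorem HasVelocity.congr {c c' : ℝ → V} {v : V} (h : HasVelocity c v) (hc : c =ᶠ[𝓝 0] c') :
    HasVelocity c' v := by
  have h0 := hc.self_of_nhds
  refine Tendsto.congr' ?_ h
  filter_upwards [nhdsWithin_le_nhds hc] with t ht
  rw [ht, h0]

theorem HasVelocity.neg {c : ℝ → V} {v : V} (h : HasVelocity c v) :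
    HasVelocity (fun t => -c t) (-v) := by
  refine (Tendsto.neg h).congr fun t => ?_
  rw [← smul_neg, neg_sub_neg, neg_sub]

theorem HasVelocity.smul {a : ℝ → ℂ} {a' : ℂ} (ha : HasDerivAt a a' 0) {c : ℝ → V} {v : V}
    (hc : HasVelocity c v) : HasVelocity (fun t => a t • c t) (a' • c 0 + a 0 • v) := by
  have h1 := hasDerivAt_iff_tendsto_slope_zero.1 ha
  simp only [zero_add] at h1
  refine ((h1.smul hc.tendsto_nhdsNE).add (hc.const_smul (a 0))).congr fun t => ?_
  rw [smul_assoc, smul_comm (a 0) (t⁻¹), ← smul_add, sub_smul, smul_sub]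
  congr 1
  abel

/-- The product rule for a family of linear maps which acts jointly continuously. -/
theorem HasVelocity.apply {X : Type*} [TopologicalSpace X] {T : X → V →ₗ[ℂ] W}
    (hT : Continuous fun p : X × V => T p.1 p.2) {b : ℝ → X} (hb : ContinuousAt b 0) {c : ℝ → V}
    {v : V} {w : W} (hw : HasVelocity (fun t => T (b t) (c 0)) w) (hc : HasVelocity c v) :
    HasVelocity (fun t => T (b t) (c t)) (w + T (b 0) v) := by
  have h1 : Tendsto (fun t => T (b t) (t⁻¹ • (c t - c 0))) (𝓝[≠] 0) (𝓝 (T (b 0) v)) :=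
    (hT.tendsto (b 0, v)).comp ((hb.tendsto.mono_left nhdsWithin_le_nhds).prodMk_nhds hc)
  refine (Tendsto.add hw h1).congr fun t => ?_
  rw [← Complex.coe_smul, ← Complex.coe_smul, ← Complex.coe_smul, map_smul, map_sub, ← smul_add]
  congr 1
  abel

theorem HasVelocity.comp_mul {c : ℝ → V} {v : V} (h : HasVelocity c v) {a : ℝ} (ha : a ≠ 0) :
    HasVelocity (fun t => c (a * t)) (a • v) := by
  have h1 : Tendsto (fun t : ℝ => a * t) (𝓝[≠] 0) (𝓝[≠] 0) := by
    refine tendsto_nhdsWithin_of_tendsto_nhds_of_eventually_within _ ?_ ?_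
    · have : Tendsto (fun t : ℝ => a * t) (𝓝 0) (𝓝 (a * 0)) := (continuous_const_mul a).tendsto 0
      rw [mul_zero] at this
      exact this.mono_left nhdsWithin_le_nhds
    · filter_upwards [self_mem_nhdsWithin] with t ht
      exact mul_ne_zero ha ht
  refine ((h.comp h1).const_smul a).congr fun t => ?_
  simp only [Function.comp_apply, mul_zero, smul_smul]
  congr 1
  field_simp

theorem hasVelocity_real_iff {f : ℝ → ℝ} {x f' : ℝ} :
    Tendsto (fun t : ℝ => t⁻¹ • (f (x + t) - f (x + 0))) (𝓝[≠] 0) (𝓝 f') ↔ HasDerivAt f f' x := by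
  rw [hasDerivAt_iff_tendsto_slope_zero, add_zero]

/-- The mean value theorem. -/
theorem sub_mem_of_velocity_mem {c c' : ℝ → V}
    (hc : ∀ t ∈ Set.Icc (0 : ℝ) 1, HasVelocity (fun s => c (t + s)) (c' t)) {C : Set V}
    (hC : Convex ℝ C) (hC' : IsClosed C) (h : ∀ t ∈ Set.Icc (0 : ℝ) 1, c' t ∈ C) :
    c 1 - c 0 ∈ C := by
  by_contra hx
  -- A functional l separating the increment from C contradicts the scalar mean value theorem for l
  -- ∘ c.
  obtain ⟨l, u, hl, hu⟩ := geometric_hahn_banach_point_closed hC hC' hx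
  have hd : ∀ t ∈ Set.Icc (0 : ℝ) 1, HasDerivAt (fun s => l (c s)) (l (c' t)) t := by
    intro t ht
    rw [← hasVelocity_real_iff]
    refine ((l.continuous.tendsto _).comp (hc t ht)).congr fun s => ?_
    simp [map_smul, map_sub]
  obtain ⟨t, ht, hlt⟩ := exists_hasDerivAt_eq_slope (fun s => l (c s)) (fun s => l (c' s))
    (zero_lt_one' ℝ) (fun t ht => (hd t ht).continuousAt.continuousWithinAt)
    (fun t ht => hd t (Set.Ioo_subset_Icc_self ht))
  have h1 := hu _ (h t (Set.Ioo_subset_Icc_self ht))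
  rw [map_sub] at hl
  simp only [sub_zero, div_one] at hlt
  linarith

theorem eq_of_velocity_eq_zero {c : ℝ → V}
    (hc : ∀ t ∈ Set.Icc (0 : ℝ) 1, HasVelocity (fun s => c (t + s)) 0) : c 1 = c 0 := by
  have := sub_mem_of_velocity_mem hc (convex_singleton (0 : V)) isClosed_singleton
    (fun _ _ => rfl)
  exact sub_eq_zero.1 this

theorem exists_closed_convex_subset {v : V} {N : Set V} (hN : N ∈ 𝓝 v) :
    ∃ C ∈ 𝓝 v, Convex ℝ C ∧ IsClosed C ∧ C ⊆ N := by
  obtain ⟨N', hN', hcl, hsub⟩ := exists_mem_nhds_isClosed_subset hN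
  obtain ⟨C, ⟨hC, hconv⟩, hCN⟩ :=
    (LocallyConvexSpace.convex_basis (𝕜 := ℝ) v).mem_iff.1 hN'
  exact ⟨closure C, mem_of_superset hC subset_closure, hconv.closure, isClosed_closure,
    (closure_minimal hCN hcl).trans hsub⟩

variable {E : Type*} [NormedAddCommGroup E] [NormedSpace ℝ E]

/-- If the directional derivatives of `f` exist and are jointly continuous, then the difference
quotients converge jointly in the base point and the direction. -/
theorem tendsto_diffQuotient {f : E → V} {D : E → E → V} {U : Set E} (hU : IsOpen U)
    (hD : ContinuousOn (fun p : E × E => D p.1 p.2) (U ×ˢ Set.univ))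
    (hf : ∀ x ∈ U, ∀ w, HasVelocity (fun t : ℝ => f (x + t • w)) (D x w)) {x₀ : E} (hx₀ : x₀ ∈ U)
    (w₀ : E) :
    Tendsto (fun q : ℝ × E × E => q.1⁻¹ • (f (q.2.1 + q.1 • q.2.2) - f q.2.1))
      (𝓝[≠] 0 ×ˢ 𝓝 x₀ ×ˢ 𝓝 w₀) (𝓝 (D x₀ w₀)) := by
  intro N hN
  obtain ⟨C, hC, hconv, hcl, hCN⟩ := exists_closed_convex_subset hN
  refine mem_of_superset ?_ (Set.preimage_mono hCN)
  have hcont : ContinuousAt (fun p : E × E => D p.1 p.2) (x₀, w₀) :=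
    hD.continuousAt (prod_mem_nhds (hU.mem_nhds hx₀) univ_mem)
  have h1 : ∀ᶠ p : E × E in 𝓝 (x₀, w₀), p.1 ∈ U ∧ D p.1 p.2 ∈ C :=
    ((continuousAt_fst (X := E)).eventually (hU.mem_nhds hx₀)).and (hcont hC)
  obtain ⟨r, hr, hball⟩ := Metric.eventually_nhds_iff.1 h1
  have e1 : ∀ᶠ q : ℝ × E × E in 𝓝[≠] 0 ×ˢ 𝓝 x₀ ×ˢ 𝓝 w₀,
      ‖q.1 • q.2.2‖ < r / 2 := by
    have : Tendsto (fun q : ℝ × E × E => ‖q.1 • q.2.2‖) (𝓝 0 ×ˢ 𝓝 x₀ ×ˢ 𝓝 w₀)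
        (𝓝 ‖(0 : ℝ) • w₀‖) := by
      rw [← nhds_prod_eq, ← nhds_prod_eq]
      exact (continuous_fst.smul (continuous_snd.comp continuous_snd)).norm.tendsto
        ((0 : ℝ), x₀, w₀)
    rw [zero_smul, norm_zero] at this
    exact (this.mono_left (prod_mono nhdsWithin_le_nhds le_rfl)).eventually
      (gt_mem_nhds (by positivity))
  have e2 : ∀ᶠ q : ℝ × E × E in 𝓝[≠] 0 ×ˢ 𝓝 x₀ ×ˢ 𝓝 w₀, dist q.2.1 x₀ < r / 2 :=
    (tendsto_fst.comp tendsto_snd).eventually (Metric.ball_mem_nhds x₀ (by positivity))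
  have e3 : ∀ᶠ q : ℝ × E × E in 𝓝[≠] 0 ×ˢ 𝓝 x₀ ×ˢ 𝓝 w₀, dist q.2.2 w₀ < r :=
    (tendsto_snd.comp tendsto_snd).eventually (Metric.ball_mem_nhds w₀ hr)
  have e4 : ∀ᶠ q : ℝ × E × E in 𝓝[≠] 0 ×ˢ 𝓝 x₀ ×ˢ 𝓝 w₀, q.1 ≠ 0 :=
    tendsto_fst.eventually self_mem_nhdsWithin
  rw [mem_map]
  filter_upwards [e1, e2, e3, e4] with ⟨t, x, w⟩ h1 h2 h3 h4
  simp only at h1 h2 h3 h4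
  -- The whole segment from x to x + tw stays in the ball where D takes values in C, half of the
  -- radius being reserved for x and half for tw.
  have hmem : ∀ s ∈ Set.Icc (0 : ℝ) 1, x + (s * t) • w ∈ U ∧ D (x + (s * t) • w) w ∈ C := by
    intro s hs
    refine hball (y := (x + (s * t) • w, w)) ?_
    rw [Prod.dist_eq, max_lt_iff]
    refine ⟨?_, h3⟩
    have : ‖(s * t) • w‖ < r / 2 := by
      refine lt_of_le_of_lt ?_ h1
      rw [mul_smul, norm_smul s]
      refine mul_le_of_le_one_left (norm_nonneg _) ?_
      rw [Real.norm_eq_abs, abs_le]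
      exact ⟨by linarith [hs.1], hs.2⟩
    calc dist (x + (s * t) • w) x₀ ≤ dist (x + (s * t) • w) x + dist x x₀ := dist_triangle _ _ _
      _ < r / 2 + r / 2 := by
        refine add_lt_add ?_ h2
        rwa [dist_eq_norm, add_sub_cancel_left]
      _ = r := by ring
  -- The difference quotient is the increment over [0, 1] of s ↦ t⁻¹ f(x + stw), whose velocity is
  -- D(x + stw, w).
  have key := sub_mem_of_velocity_mem (c := fun s => t⁻¹ • f (x + (s * t) • w))
    (c' := fun s => D (x + (s * t) • w) w) ?_ hconv hcl (fun s hs => (hmem s hs).2)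
  · simpa [smul_sub] using key
  · intro s hs
    have h5 := (hf _ (hmem s hs).1 w).comp_mul h4
    have h6 := h5.const_smul t⁻¹
    rw [inv_smul_smul₀ h4] at h6
    refine h6.congr fun a => ?_
    rw [smul_comm, ← smul_sub]
    have e : x + (s * t) • w + (t * a) • w = x + ((s + a) * t) • w := by module
    simp only [e, mul_zero, zero_smul, add_zero]

end Calculus

/-! ### Curves in Lie groups -/

section Curves

variable {E : Type*} [NormedAddCommGroup E] [NormedSpace ℝ E]
  {G : Type*} [Group G] [TopologicalSpace G] [ChartedSpace E G]
  {E' : Type*} [NormedAddCommGroup E'] [NormedSpace ℝ E']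
  {G' : Type*} [Group G'] [TopologicalSpace G'] [ChartedSpace E' G']

/-- The curve `c` passes through `1` at time `0`, with velocity `y`. -/
structure IsCurve (c : ℝ → G) (y : E) : Prop where
  zero : c 0 = 1
  continuousAt : ContinuousAt c 0
  hasDerivAt : HasDerivAt (fun t => chartAt E (1 : G) (c t)) y 0

theorem IsCurve.tendsto {c : ℝ → G} {y : E} (hc : IsCurve c y) : Tendsto c (𝓝 0) (𝓝 1) := by
  have := hc.continuousAt.tendsto
  rwa [hc.zero] at this

theorem IsCurve.unique {c : ℝ → G} {y z : E} (hc : IsCurve c y) (hc' : IsCurve c z) : y = z :=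
  hc.hasDerivAt.unique hc'.hasDerivAt

theorem IsCurve.const : IsCurve (fun _ : ℝ => (1 : G)) (0 : E) :=
  ⟨rfl, continuousAt_const, hasDerivAt_const _ _⟩

theorem IsCurve.comp {c : ℝ → G} {y : E} (hc : IsCurve c y) {g : G → G'} (h1 : g 1 = 1)
    (hg : MDifferentiableAt 𝓘(ℝ, E) 𝓘(ℝ, E') g 1) :
    IsCurve (E := E') (fun t => g (c t)) (mfderiv 𝓘(ℝ, E) 𝓘(ℝ, E') g 1 y) := by
  have hd := hg.hasMFDerivAt
  have h2 : HasFDerivAt (fun x => chartAt E' (1 : G') (g ((chartAt E (1 : G)).symm x)))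
      (mfderiv 𝓘(ℝ, E) 𝓘(ℝ, E') g 1 : E →L[ℝ] E') (chartAt E (1 : G) 1) := by
    have := hd.2
    simp only [writtenInExtChartAt, h1, mfld_simps] at this
    exact (hasFDerivWithinAt_univ (𝕜 := ℝ)).1 this
  refine ⟨by simp [hc.zero, h1], ?_, ?_⟩
  · refine ContinuousAt.comp (g := g) ?_ hc.continuousAt
    rw [hc.zero]
    exact hg.continuousAt
  · have h3 := HasFDerivAt.comp_hasDerivAt_of_eq (0 : ℝ) h2 hc.hasDerivAt (by rw [hc.zero])
    refine h3.congr_of_eventuallyEq ?_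
    have : ∀ᶠ t in 𝓝 (0 : ℝ), c t ∈ (chartAt E (1 : G)).source :=
      hc.tendsto (chart_source_mem_nhds E 1)
    filter_upwards [this] with t ht
    simp only [Function.comp_apply, (chartAt E (1 : G)).left_inv ht]

theorem isCurve_iff_hasMFDerivAt {c : ℝ → G} {y : E} : IsCurve c y ↔
    c 0 = 1 ∧ MDifferentiableAt 𝓘(ℝ, ℝ) 𝓘(ℝ, E) c 0 ∧
      (mfderiv 𝓘(ℝ, ℝ) 𝓘(ℝ, E) c 0 (1 : ℝ) : E) = y := by
  have key : ∀ h : c 0 = 1, ∀ f : ℝ →L[ℝ] E, HasMFDerivAt 𝓘(ℝ, ℝ) 𝓘(ℝ, E) c 0 f ↔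
      ContinuousAt c 0 ∧ HasFDerivAt (fun t => chartAt E (1 : G) (c t)) f 0 := by
    intro h f
    simp only [HasMFDerivAt, writtenInExtChartAt, h, mfld_simps]
    exact and_congr Iff.rfl (hasFDerivWithinAt_univ (𝕜 := ℝ))
  constructor
  · intro hc
    have h := (key hc.zero _).2 ⟨hc.continuousAt, hc.hasDerivAt.hasFDerivAt⟩
    refine ⟨hc.zero, h.mdifferentiableAt, ?_⟩
    rw [h.mfderiv]
    exact one_smul ℝ y
  · rintro ⟨h0, hd, hy⟩
    have h := (key h0 _).1 hd.hasMFDerivAt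
    refine ⟨h0, h.1, ?_⟩
    have h2 := h.2.hasDerivAt
    rw [← hy]
    exact h2

theorem IsOneParam.isCurve {γ : ℝ → G} {y : GroupLieAlgebra 𝓘(ℝ, E) G} (hγ : IsOneParam γ y) :
    IsCurve (E := E) γ y := by
  refine isCurve_iff_hasMFDerivAt.2 ⟨?_, hγ.smooth.mdifferentiable (by simp) 0, hγ.velocity⟩
  have := hγ.map_add 0 0
  rw [add_zero] at this
  exact left_eq_mul.1 this

variable [LieGroup 𝓘(ℝ, E) ∞ G] [LieGroup 𝓘(ℝ, E') ∞ G']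

theorem contMDiffAt_chart_symm {e : OpenPartialHomeomorph G E} (he : e ∈ atlas E G) {x : E}
    (hx : x ∈ e.target) : ContMDiffAt 𝓘(ℝ, E) 𝓘(ℝ, E) ∞ e.symm x :=
  (contMDiffOn_symm_of_mem_maximalAtlas (IsManifold.subset_maximalAtlas he)).contMDiffAt
    (e.open_target.mem_nhds hx)

theorem contMDiffAt_chart {e : OpenPartialHomeomorph G E} (he : e ∈ atlas E G) {p : G}
    (hp : p ∈ e.source) : ContMDiffAt 𝓘(ℝ, E) 𝓘(ℝ, E) ∞ e p :=
  (contMDiffOn_of_mem_maximalAtlas (IsManifold.subset_maximalAtlas he)).contMDiffAt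
    (e.open_source.mem_nhds hp)

theorem contDiffAt_mul_chart {e₁ e₂ e₃ : OpenPartialHomeomorph G E} (h₁ : e₁ ∈ atlas E G)
    (h₂ : e₂ ∈ atlas E G) (h₃ : e₃ ∈ atlas E G) {x₁ x₂ : E} (hx₁ : x₁ ∈ e₁.target)
    (hx₂ : x₂ ∈ e₂.target) (hx₃ : e₁.symm x₁ * e₂.symm x₂ ∈ e₃.source) :
    ContDiffAt ℝ ∞ (fun q : E × E => e₃ (e₁.symm q.1 * e₂.symm q.2)) (x₁, x₂) := by
  rw [← contMDiffAt_iff_contDiffAt]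
  have a1 : ContMDiffAt 𝓘(ℝ, E × E) 𝓘(ℝ, E) ∞ (fun q : E × E => e₁.symm q.1) (x₁, x₂) :=
    ContMDiffAt.comp (x₁, x₂) (contMDiffAt_chart_symm h₁ hx₁) contDiffAt_fst.contMDiffAt
  have a2 : ContMDiffAt 𝓘(ℝ, E × E) 𝓘(ℝ, E) ∞ (fun q : E × E => e₂.symm q.2) (x₁, x₂) :=
    ContMDiffAt.comp (x₁, x₂) (contMDiffAt_chart_symm h₂ hx₂) contDiffAt_snd.contMDiffAt
  exact ContMDiffAt.comp (x₁, x₂) (contMDiffAt_chart h₃ hx₃) (a1.mul a2)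

theorem contDiffAt_inv_mul_chart {e₁ e₂ e₃ : OpenPartialHomeomorph G E} (h₁ : e₁ ∈ atlas E G)
    (h₂ : e₂ ∈ atlas E G) (h₃ : e₃ ∈ atlas E G) {x₁ x₂ : E} (hx₁ : x₁ ∈ e₁.target)
    (hx₂ : x₂ ∈ e₂.target) (hx₃ : (e₁.symm x₁)⁻¹ * e₂.symm x₂ ∈ e₃.source) :
    ContDiffAt ℝ ∞ (fun q : E × E => e₃ ((e₁.symm q.1)⁻¹ * e₂.symm q.2)) (x₁, x₂) := by
  rw [← contMDiffAt_iff_contDiffAt]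
  have a1 : ContMDiffAt 𝓘(ℝ, E × E) 𝓘(ℝ, E) ∞ (fun q : E × E => e₁.symm q.1) (x₁, x₂) :=
    ContMDiffAt.comp (x₁, x₂) (contMDiffAt_chart_symm h₁ hx₁) contDiffAt_fst.contMDiffAt
  have a2 : ContMDiffAt 𝓘(ℝ, E × E) 𝓘(ℝ, E) ∞ (fun q : E × E => e₂.symm q.2) (x₁, x₂) :=
    ContMDiffAt.comp (x₁, x₂) (contMDiffAt_chart_symm h₂ hx₂) contDiffAt_snd.contMDiffAt
  exact ContMDiffAt.comp (x₁, x₂) (contMDiffAt_chart h₃ hx₃) (a1.inv.mul a2)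

theorem mdifferentiableAt_mul_left (g p : G) :
    MDifferentiableAt 𝓘(ℝ, E) 𝓘(ℝ, E) (fun q : G => g * q) p :=
  (contMDiff_mul_left (I := 𝓘(ℝ, E)) (n := ∞)).mdifferentiable (by simp) p

theorem mdifferentiableAt_conj (g p : G) :
    MDifferentiableAt 𝓘(ℝ, E) 𝓘(ℝ, E) (fun q : G => g * q * g⁻¹) p :=
  ((contMDiff_mul_right (I := 𝓘(ℝ, E)) (n := ∞)).comp
    (contMDiff_mul_left (I := 𝓘(ℝ, E)) (n := ∞))).mdifferentiable (by simp) p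

theorem IsCurve.conj {c : ℝ → G} {y : E} (hc : IsCurve c y) (g : G) :
    IsCurve (E := E) (fun t => g * c t * g⁻¹)
      (mfderiv 𝓘(ℝ, E) 𝓘(ℝ, E) (fun h : G => g * h * g⁻¹) 1 y) :=
  hc.comp (g := fun q => g * q * g⁻¹) (by simp) (mdifferentiableAt_conj g 1)

/-- The differential of multiplication at (1, 1) is addition, since its restriction to either factor
is the identity. -/
theorem IsCurve.mul {c d : ℝ → G} {y z : E} (hc : IsCurve c y) (hd : IsCurve d z) :
    IsCurve (fun t => c t * d t) (y + z) := by
  have : IsTopologicalGroup G := topologicalGroup_of_lieGroup 𝓘(ℝ, E) ∞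
  set e := chartAt E (1 : G) with he
  have hs : (1 : G) ∈ e.source := mem_chart_source E 1
  have hsymm : e.symm (e 1) = 1 := e.left_inv hs
  have hat : e ∈ atlas E G := chart_mem_atlas E 1
  have hm := (contDiffAt_mul_chart hat hat hat (e.map_source hs) (e.map_source hs)
    (by rw [hsymm, mul_one]; exact hs)).differentiableAt (by simp)
  obtain ⟨M, hM⟩ := hm
  have hM1 : ∀ v, M (v, 0) = v := by
    have h1 : HasFDerivAt (fun x : E => e (e.symm x * e.symm (e 1)))
        (M.comp (ContinuousLinearMap.inl ℝ E E)) (e 1) :=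
      HasFDerivAt.comp (e 1) (g := fun q : E × E => e (e.symm q.1 * e.symm q.2)) (f := fun x : E => (x, e 1)) hM
        (hasFDerivAt_prodMk_left (e 1) (e 1))
    have h2 : HasFDerivAt (fun x : E => e (e.symm x * e.symm (e 1))) (ContinuousLinearMap.id ℝ E)
        (e 1) := by
      refine (hasFDerivAt_id (e 1)).congr_of_eventuallyEq ?_
      filter_upwards [e.open_target.mem_nhds (e.map_source hs)] with x hx
      rw [hsymm, mul_one, e.right_inv hx, id]
    intro v
    have := DFunLike.congr_fun (h1.unique h2) v
    simpa using this
  have hM2 : ∀ v, M (0, v) = v := by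
    have h1 : HasFDerivAt (fun x : E => e (e.symm (e 1) * e.symm x))
        (M.comp (ContinuousLinearMap.inr ℝ E E)) (e 1) :=
      HasFDerivAt.comp (e 1) (g := fun q : E × E => e (e.symm q.1 * e.symm q.2)) (f := fun x : E => (e 1, x)) hM
        (hasFDerivAt_prodMk_right (e 1) (e 1))
    have h2 : HasFDerivAt (fun x : E => e (e.symm (e 1) * e.symm x)) (ContinuousLinearMap.id ℝ E)
        (e 1) := by
      refine (hasFDerivAt_id (e 1)).congr_of_eventuallyEq ?_
      filter_upwards [e.open_target.mem_nhds (e.map_source hs)] with x hx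
      rw [hsymm, one_mul, e.right_inv hx, id]
    intro v
    have := DFunLike.congr_fun (h1.unique h2) v
    simpa using this
  refine ⟨by rw [hc.zero, hd.zero, mul_one], hc.continuousAt.mul hd.continuousAt, ?_⟩
  have h3 := HasFDerivAt.comp_hasDerivAt_of_eq (0 : ℝ) hM (hc.hasDerivAt.prodMk hd.hasDerivAt)
    (by rw [hc.zero, hd.zero])
  have h4 : M (y, z) = y + z := by
    rw [← hM1 y, ← hM2 z, ← map_add]
    simp [hM1, hM2]
  rw [h4] at h3
  refine h3.congr_of_eventuallyEq ?_
  filter_upwards [hc.tendsto (chart_source_mem_nhds E 1),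
    hd.tendsto (chart_source_mem_nhds E 1)] with t h5 h6
  simp only [Function.comp_apply]
  rw [← he, e.left_inv h5, e.left_inv h6]

/-- Some velocity exists as inversion is smooth; it must be -y because the product with c is
constant. -/
theorem IsCurve.inv {c : ℝ → G} {y : E} (hc : IsCurve c y) :
    IsCurve (fun t => (c t)⁻¹) (-y) := by
  have h1 := hc.comp (g := fun q => q⁻¹) inv_one
    ((contMDiff_inv 𝓘(ℝ, E) ∞).mdifferentiable (by simp) 1)
  have h2 := hc.mul h1
  simp only [mul_inv_cancel] at h2
  have h3 := h2.unique IsCurve.const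
  rwa [eq_neg_of_add_eq_zero_right h3] at h1

/-- The left logarithmic derivative in a chart. -/
def chartLog (e : OpenPartialHomeomorph G E) (x : E) : E →L[ℝ] E :=
  fderiv ℝ (fun x' => chartAt E (1 : G) ((e.symm x)⁻¹ * e.symm x')) x

theorem contDiffOn_chartLog {e : OpenPartialHomeomorph G E} (he : e ∈ atlas E G) :
    ContDiffOn ℝ ∞ (chartLog e) e.target := by
  intro x hx
  refine ContDiffAt.contDiffWithinAt ?_
  exact ContDiffAt.fderiv (n := ∞)
    (f := fun x x' => chartAt E (1 : G) ((e.symm x)⁻¹ * e.symm x')) (g := fun x => x)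
    (contDiffAt_inv_mul_chart he he (chart_mem_atlas E 1) hx hx (by simp)) contDiffAt_id (by simp)

/-- A straight line in a chart, translated back to 1. This converts directional derivatives in
charts into derivatives along curves p c(t). -/
theorem isCurve_chartLog {e : OpenPartialHomeomorph G E} (he : e ∈ atlas E G) {x : E}
    (hx : x ∈ e.target) (w : E) :
    IsCurve (fun t : ℝ => (e.symm x)⁻¹ * e.symm (x + t • w)) (chartLog e x w) := by
  have : IsTopologicalGroup G := topologicalGroup_of_lieGroup 𝓘(ℝ, E) ∞
  have hl : HasDerivAt (fun t : ℝ => x + t • w) w 0 := by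
    simpa using ((hasDerivAt_id (0 : ℝ)).smul_const w).const_add x
  refine ⟨by simp, ?_, ?_⟩
  · refine continuousAt_const.mul (ContinuousAt.comp (g := e.symm) ?_ hl.continuousAt)
    rw [zero_smul, add_zero]
    exact e.continuousAt_symm hx
  · have h1 := (contDiffAt_inv_mul_chart he he (chart_mem_atlas E 1) hx hx (by simp)).comp x
      (contDiffAt_const.prodMk contDiffAt_id : ContDiffAt ℝ ∞ (fun x' : E => (x, x')) x)
    have h2 : HasFDerivAt (fun x' => chartAt E (1 : G) ((e.symm x)⁻¹ * e.symm x')) (chartLog e x)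
        x := (h1.differentiableAt (by simp)).hasFDerivAt
    exact HasFDerivAt.comp_hasDerivAt_of_eq (0 : ℝ) h2 hl (by simp)

end Curves

/-! ### One-parameter subgroups -/

section OneParam

variable {E : Type*} [NormedAddCommGroup E] [NormedSpace ℝ E]
  {G : Type*} [Group G] [TopologicalSpace G] [ChartedSpace E G] [LieGroup 𝓘(ℝ, E) ∞ G]

/-- A homomorphism `ℝ → G` which is differentiable at `0` is smooth. -/
theorem isOneParam_of_isCurve {γ : ℝ → G} (hγ : ∀ s t, γ (s + t) = γ s * γ t) {y : E}
    (hy : IsCurve γ y) : IsOneParam γ (y : GroupLieAlgebra 𝓘(ℝ, E) G) := by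
  have : IsTopologicalGroup G := topologicalGroup_of_lieGroup 𝓘(ℝ, E) ∞
  have htr : ∀ s : ℝ, γ = fun t => γ s * γ (t - s) := by
    intro s
    ext t
    rw [← hγ, add_sub_cancel]
  have hcont : Continuous γ := by
    rw [continuous_iff_continuousAt]
    intro s
    rw [htr s]
    refine continuousAt_const.mul (ContinuousAt.comp (g := γ) ?_ (by fun_prop))
    rw [sub_self]
    exact hy.continuousAt
  set e := chartAt E (1 : G) with he
  have hat : e ∈ atlas E G := chart_mem_atlas E 1
  have hs : (1 : G) ∈ e.source := mem_chart_source E 1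
  have hsymm : e.symm (e 1) = 1 := e.left_inv hs
  -- The left-invariant vector field of y in the chart. The homomorphism property turns the
  -- derivative at 0 into the equation z' = X(z) wherever γ stays in the chart.
  set X : E → E := fun x => fderiv ℝ (fun x' => e (e.symm x * e.symm x')) (e 1) y with hX
  have hXs : ContDiffOn ℝ ∞ X e.target := by
    intro x hx
    refine ContDiffAt.contDiffWithinAt ?_
    have h1 := ContDiffAt.fderiv (n := ∞)
      (f := fun x x' => e (e.symm x * e.symm x')) (g := fun _ : E => e 1) (x₀ := x) (m := ∞)
      (contDiffAt_mul_chart hat hat hat hx (e.map_source hs) (by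
        rw [hsymm, mul_one]; exact e.map_target hx)) contDiffAt_const (by simp)
    exact h1.clm_apply contDiffAt_const
  set T : Set ℝ := γ ⁻¹' e.source with hT
  have hTo : IsOpen T := e.open_source.preimage hcont
  set z : ℝ → E := fun t => e (γ t) with hz
  have hd : ∀ t ∈ T, HasDerivAt z (X (z t)) t := by
    intro t ht
    have h1 := (contDiffAt_mul_chart hat hat hat (e.map_source ht) (e.map_source hs) (by
        rw [hsymm, mul_one, e.left_inv ht]; exact ht)).comp (e 1)
      (contDiffAt_const.prodMk contDiffAt_id : ContDiffAt ℝ ∞ (fun x' : E => (e (γ t), x')) (e 1))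
    have h2 : HasFDerivAt (fun x' => e (e.symm (z t) * e.symm x'))
        (fderiv ℝ (fun x' => e (e.symm (z t) * e.symm x')) (e 1)) (e 1) :=
      (h1.differentiableAt (by simp)).hasFDerivAt
    have h3 := HasFDerivAt.comp_hasDerivAt_of_eq (0 : ℝ) h2 hy.hasDerivAt (by rw [hy.zero])
    have h4 : HasDerivAt (fun s => z (t + s)) (X (z t)) 0 := by
      refine h3.congr_of_eventuallyEq ?_
      filter_upwards [hy.tendsto (chart_source_mem_nhds E 1)] with s hs'
      simp only [Function.comp_apply, hz]
      rw [e.left_inv ht, e.left_inv hs', hγ]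
    have h5 : HasDerivAt (fun s => z (t + s)) (X (z t)) (t - t) := by rwa [sub_self]
    have h6 := HasDerivAt.comp_sub_const t t h5
    simpa using h6
  -- Bootstrapping: if z is of class Cⁿ, then so is z' = X ∘ z.
  have hzs : ∀ n : ℕ, ContDiffOn ℝ n z T := by
    intro n
    induction n with
    | zero =>
      exact contDiffOn_zero.2 fun t ht => (hd t ht).continuousAt.continuousWithinAt
    | succ n ih =>
      rw [Nat.cast_add, Nat.cast_one]
      refine (contDiffOn_succ_iff_deriv_of_isOpen hTo).2
        ⟨fun t ht => (hd t ht).differentiableAt.differentiableWithinAt, by simp, ?_⟩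
      refine ContDiffOn.congr (f := X ∘ z) ?_ fun t ht => (hd t ht).deriv
      exact (hXs.of_le (by exact_mod_cast le_top)).comp ih fun t ht => e.map_source ht
  have h0T : (0 : ℝ) ∈ T := by
    rw [hT, Set.mem_preimage, hy.zero]
    exact hs
  have h0 : ContMDiffAt 𝓘(ℝ, ℝ) 𝓘(ℝ, E) ∞ γ 0 := by
    have h1 : ContDiffAt ℝ ∞ z 0 := ((contDiffOn_infty.2 hzs).contDiffAt (hTo.mem_nhds h0T))
    have h2 : ContMDiffAt 𝓘(ℝ, ℝ) 𝓘(ℝ, E) ∞ (fun t => e.symm (z t)) 0 :=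
      ContMDiffAt.comp (0 : ℝ) (contMDiffAt_chart_symm hat (e.map_source h0T)) h1.contMDiffAt
    refine h2.congr_of_eventuallyEq ?_
    filter_upwards [hTo.mem_nhds h0T] with t ht
    exact (e.left_inv ht).symm
  refine ⟨hγ, ?_, (isCurve_iff_hasMFDerivAt.1 hy).2.2⟩
  intro s
  rw [htr s]
  have h1 : ContMDiffAt 𝓘(ℝ, ℝ) 𝓘(ℝ, E) ∞ (fun t => γ (t - s)) s := by
    refine ContMDiffAt.comp_of_eq (f := fun t : ℝ => t - s) (y := (0 : ℝ)) h0 ?_ (sub_self s)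
    exact (contDiffAt_id.sub contDiffAt_const).contMDiffAt
  exact contMDiffAt_const.mul h1

theorem t2Space_of_lieGroup (E : Type*) [NormedAddCommGroup E] [NormedSpace ℝ E]
    (G : Type*) [Group G] [TopologicalSpace G] [ChartedSpace E G] [LieGroup 𝓘(ℝ, E) ∞ G] :
    T2Space G := by
  have : IsTopologicalGroup G := topologicalGroup_of_lieGroup 𝓘(ℝ, E) ∞
  have : T1Space G := ChartedSpace.t1Space E G
  infer_instance

theorem isMIntegralCurveOn_mul_left [LieGroup 𝓘(ℝ, E) (minSmoothness ℝ 3) G]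
    {v : GroupLieAlgebra 𝓘(ℝ, E) G} {γ : ℝ → G} {s : Set ℝ}
    (h : IsMIntegralCurveOn γ (mulInvariantVectorField v) s) (g : G) :
    IsMIntegralCurveOn (fun t => g * γ t) (mulInvariantVectorField v) s := by
  intro t ht
  have h1 := HasMFDerivAt.comp_hasMFDerivWithinAt (I' := 𝓘(ℝ, E)) t
    (mdifferentiableAt_mul_left g (γ t)).hasMFDerivAt (h t ht)
  have h2 : mulInvariantVectorField v (g * γ t) =
      mfderiv 𝓘(ℝ, E) 𝓘(ℝ, E) (fun q => g * q) (γ t) (mulInvariantVectorField v (γ t)) := by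
    have h3 := mfderiv_comp_apply (I' := 𝓘(ℝ, E)) (1 : G) (g := fun q => g * q)
      (f := fun q => γ t * q) (mdifferentiableAt_mul_left g _)
      (mdifferentiableAt_mul_left (γ t) 1) v
    have h4 : (fun q => g * q) ∘ (fun q => γ t * q) = fun q => g * γ t * q := by
      ext q
      simp [mul_assoc]
    rw [h4, mul_one] at h3
    exact h3
  have h5 : ∀ (L : E →L[ℝ] E) (x : E), L ∘L ((1 : ℝ →L[ℝ] ℝ).smulRight x) =
      (1 : ℝ →L[ℝ] ℝ).smulRight (L x) := by
    intro L x
    ext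
    simp
  rw [h2]
  refine HasMFDerivWithinAt.congr_mfderiv h1 ?_
  exact h5 _ _

variable [FiniteDimensional ℝ E]

variable (G) in
-- Left translation makes the existence time ε of integral curves of the left-invariant field
-- independent of the starting point, so the curve through 1 is complete. Uniqueness, applied to γ(s
-- + ·) and γ(s)γ(·), makes it a homomorphism.
theorem exists_isOneParam (y : GroupLieAlgebra 𝓘(ℝ, E) G) : ∃ γ : ℝ → G, IsOneParam γ y := by
  have : IsTopologicalGroup G := topologicalGroup_of_lieGroup 𝓘(ℝ, E) ∞
  have : T2Space G := t2Space_of_lieGroup E G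
  have : CompleteSpace E := FiniteDimensional.complete ℝ E
  have h3 : minSmoothness ℝ 3 = 3 := minSmoothness_of_isRCLikeNormedField
  have : LieGroup 𝓘(ℝ, E) (minSmoothness ℝ 3) G :=
    LieGroup.of_le (n := ∞) (by rw [h3]; exact ENat.LEInfty.out)
  have : LieGroup 𝓘(ℝ, E) 1 G := LieGroup.of_le (n := ∞) (by exact_mod_cast le_top)
  have hv : ContMDiff 𝓘(ℝ, E) 𝓘(ℝ, E).tangent 1
      (fun g : G => (⟨g, mulInvariantVectorField y g⟩ : TangentBundle 𝓘(ℝ, E) G)) :=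
    (contMDiff_mulInvariantVectorField y).of_le
      ((by norm_num : (1 : WithTop ℕ∞) ≤ 2).trans le_minSmoothness)
  obtain ⟨γ₁, h1, h2⟩ := exists_isMIntegralCurveAt_of_contMDiffAt_boundaryless (0 : ℝ)
    (hv.contMDiffAt (x := 1))
  obtain ⟨ε, hε, hγ₁⟩ := isMIntegralCurveAt_iff'.1 h2
  rw [Real.ball_eq_Ioo, zero_sub, zero_add] at hγ₁
  obtain ⟨γ, hγ0, hγ⟩ := exists_isMIntegralCurve_of_isMIntegralCurveOn hv hε
    (fun x => ⟨fun t => x * γ₁ t, by simp [h1], isMIntegralCurveOn_mul_left hγ₁ x⟩) 1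
  refine ⟨γ, isOneParam_of_isCurve (fun s t => ?_) ?_⟩
  · have e1 : IsMIntegralCurve (fun t => γ s * γ t) (mulInvariantVectorField y) :=
      isMIntegralCurve_iff_isMIntegralCurveOn.2
        (isMIntegralCurveOn_mul_left (isMIntegralCurve_iff_isMIntegralCurveOn.1 hγ) (γ s))
    have e2 := isMIntegralCurve_Ioo_eq_of_contMDiff_boundaryless (t₀ := 0) hv (hγ.comp_add s) e1
      (by simp [hγ0])
    have := congr_fun e2 t
    rwa [Function.comp_apply, add_comm] at this
  · refine isCurve_iff_hasMFDerivAt.2 ⟨hγ0, (hγ 0).mdifferentiableAt, ?_⟩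
    rw [(hγ 0).mfderiv]
    have e3 : mulInvariantVectorField y (γ 0) = y := by
      rw [hγ0, mulInvariantVectorField]
      have : (fun x : G => 1 * x) = id := by
        ext
        simp
      rw [this, mfderiv_id]
      rfl
    refine (one_smul ℝ _).trans ?_
    exact e3

end OneParam

/-! ### Derivatives along curves -/

section Velocity

variable {V : Type*} [AddCommGroup V] [Module ℂ V] [SuperModule V] [UniformSpace V]
  [LCSuperSpace V]
  {E : Type*} [NormedAddCommGroup E] [NormedSpace ℝ E]
  {G : Type*} [Group G] [TopologicalSpace G] [ChartedSpace E G] [LieGroup 𝓘(ℝ, E) ∞ G]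

/-- The difference quotients of a smooth function along a curve converge locally uniformly in the
base point, to a limit which depends only on the velocity of the curve. -/
theorem LCSmooth.exists_tendsto {f : G → V} (hf : LCSmooth E f) (p₀ : G) (y : E) :
    ∃ v : V, ∀ c : ℝ → G, IsCurve c y →
      Tendsto (fun q : ℝ × G => q.1⁻¹ • (f (c q.1 * q.2) - f q.2)) (𝓝[≠] 0 ×ˢ 𝓝 p₀) (𝓝 v) := by
  have : IsTopologicalGroup G := topologicalGroup_of_lieGroup 𝓘(ℝ, E) ∞
  set e := chartAt E p₀ with he
  have hat : e ∈ atlas E G := chart_mem_atlas E p₀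
  have hp : p₀ ∈ e.source := mem_chart_source E p₀
  set e₁ := chartAt E (1 : G) with he₁
  have hat₁ : e₁ ∈ atlas E G := chart_mem_atlas E 1
  have h1 : (1 : G) ∈ e₁.source := mem_chart_source E 1
  obtain ⟨D, h0, hc, hd⟩ := hf e hat
  -- Strict differentiability is what makes the estimates below uniform in the base point near p₀.
  obtain ⟨M, hM⟩ : ∃ M, HasStrictFDerivAt (fun q : E × E => e (e₁.symm q.1 * e.symm q.2)) M
      (e₁ 1, e p₀) :=
    ⟨_, (contDiffAt_mul_chart hat₁ hat hat (e₁.map_source h1) (e.map_source hp) (by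
      rw [e₁.left_inv h1, e.left_inv hp, one_mul]; exact hp)).hasStrictFDerivAt (by simp)⟩
  have hsn : Continuous fun p : E × E => (p.1, (Fin.snoc Fin.elim0 p.2 : Fin 1 → E)) := by
    refine continuous_fst.prodMk (continuous_pi fun i => ?_)
    have : i = Fin.last 0 := by omega
    subst this
    simp only [Fin.snoc_last]
    exact continuous_snd
  have hT := tendsto_diffQuotient (f := f ∘ e.symm) (D := fun x w => D 1 x (Fin.snoc Fin.elim0 w))
    e.open_target ((hc 1).comp hsn.continuousOn fun p hp => ⟨hp.1, trivial⟩)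
    (fun x hx w => by
      refine (hd 0 x hx Fin.elim0 w).congr ?_
      have hl : Tendsto (fun t : ℝ => x + t • w) (𝓝 0) (𝓝 x) := by
        have : Continuous fun t : ℝ => x + t • w := by fun_prop
        simpa using this.tendsto 0
      filter_upwards [hl (e.open_target.mem_nhds hx)] with t ht
      exact h0 _ ht _) (e.map_source hp) (M (y, 0))
  refine ⟨D 1 (e p₀) (Fin.snoc Fin.elim0 (M (y, 0))), fun c hcy => ?_⟩
  set l := 𝓝[≠] (0 : ℝ) ×ˢ 𝓝 p₀ with hl
  have t1 : Tendsto (fun q : ℝ × G => e₁ (c q.1)) l (𝓝 (e₁ 1)) := by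
    have := (e₁.continuousAt h1).tendsto.comp hcy.tendsto
    exact this.comp (tendsto_fst.mono_right nhdsWithin_le_nhds)
  have t2 : Tendsto (fun q : ℝ × G => e q.2) l (𝓝 (e p₀)) :=
    (e.continuousAt hp).tendsto.comp tendsto_snd
  have t3 : Tendsto (fun q : ℝ × G => q.1⁻¹ • (e₁ (c q.1) - e₁ 1)) l (𝓝 y) := by
    have h := hasDerivAt_iff_tendsto_slope_zero.1 hcy.hasDerivAt
    simp only [zero_add, hcy.zero] at h
    exact h.comp tendsto_fst
  have tc : Tendsto (fun q : ℝ × G => c q.1 * q.2) l (𝓝 p₀) := by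
    have := (hcy.tendsto.comp ((tendsto_fst (f := 𝓝[≠] (0 : ℝ)) (g := 𝓝 p₀)).mono_right
      nhdsWithin_le_nhds)).mul tendsto_snd
    rwa [one_mul] at this
  have ev1 : ∀ᶠ q : ℝ × G in l, q.1 ≠ 0 := tendsto_fst.eventually self_mem_nhdsWithin
  have ev2 : ∀ᶠ q : ℝ × G in l, q.2 ∈ e.source :=
    tendsto_snd.eventually (e.open_source.mem_nhds hp)
  have ev3 : ∀ᶠ q : ℝ × G in l, c q.1 * q.2 ∈ e.source := tc (e.open_source.mem_nhds hp)
  have ev4 : ∀ᶠ q : ℝ × G in l, c q.1 ∈ e₁.source :=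
    (tendsto_fst.mono_right nhdsWithin_le_nhds).eventually
      (hcy.tendsto (e₁.open_source.mem_nhds h1))
  -- The displacement of q under c(t), rescaled in the chart, converges. It serves as the varying
  -- direction in `tendsto_diffQuotient`.
  have t4 : Tendsto (fun q : ℝ × G => q.1⁻¹ • (e (c q.1 * q.2) - e q.2)) l (𝓝 (M (y, 0))) := by
    have a1 := (hasStrictFDerivAt_iff_isLittleO.1 hM).comp_tendsto
      ((t1.prodMk_nhds t2).prodMk_nhds ((tendsto_const_nhds (x := e₁ 1)).prodMk_nhds t2))
    have a2 : (fun q : ℝ × G => q.1⁻¹ • (e (c q.1 * q.2) - e q.2 - M (e₁ (c q.1) - e₁ 1, 0)))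
        =o[l] fun q => q.1⁻¹ • (e₁ (c q.1) - e₁ 1) := by
      have := (Asymptotics.isBigO_refl (fun q : ℝ × G => q.1⁻¹) l).smul_isLittleO a1
      refine (this.congr' (g₂ := fun q => q.1⁻¹ • ((e₁ (c q.1) - e₁ 1, 0) : E × E)) ?_ ?_).trans_isBigO
        (Asymptotics.isBigO_of_le _ fun q => by
          simp only [norm_smul, Prod.norm_def, norm_zero, sup_of_le_left (norm_nonneg _)]
          exact le_rfl)
      · filter_upwards [ev2, ev4] with q h2 h4
        simp only [Function.comp_apply]
        rw [e₁.left_inv h4, e.left_inv h2, e₁.left_inv h1, one_mul]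
        simp
      · refine Eventually.of_forall fun q => ?_
        simp
    have a3 := (a2.trans_isBigO (t3.isBigO_one ℝ)).tendsto_zero_of_tendsto tendsto_const_nhds
    have a4 : Tendsto (fun q : ℝ × G => M (q.1⁻¹ • (e₁ (c q.1) - e₁ 1), 0)) l (𝓝 (M (y, 0))) :=
      (M.continuous.tendsto (y, 0)).comp (t3.prodMk_nhds tendsto_const_nhds)
    have a5 := a3.add a4
    rw [zero_add] at a5
    refine a5.congr fun q => ?_
    have : ((q.1⁻¹ • (e₁ (c q.1) - e₁ 1), 0) : E × E) = q.1⁻¹ • (e₁ (c q.1) - e₁ 1, 0) := by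
      simp
    rw [this, map_smul, ← smul_add, sub_add_cancel]
  refine (hT.comp ((tendsto_fst (f := 𝓝[≠] (0 : ℝ)) (g := 𝓝 p₀)).prodMk
    (t2.prodMk t4))).congr' ?_
  filter_upwards [ev1, ev2, ev3] with q hq1 hq2 hq3
  simp only [Function.comp_apply]
  rw [smul_inv_smul₀ hq1, add_sub_cancel, e.left_inv hq3, e.left_inv hq2]

/-- Writing p c(t) = (p c(t) p⁻¹) p, the derivative depends only on the velocity of the conjugated
curve. Hence conditions stated for one-parameter subgroups hold along all curves, a class stable
under products and smooth homomorphisms. -/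
theorem LCSmooth.hasVelocity_of_isOneParam {f : G → V} (hf : LCSmooth E f) {p : G}
    {γ : ℝ → G} {y : GroupLieAlgebra 𝓘(ℝ, E) G} (hγ : IsOneParam γ y) {v : V}
    (hv : HasVelocity (fun t => f (p * γ t)) v) {c : ℝ → G} (hc : IsCurve (E := E) c y) :
    HasVelocity (fun t => f (p * c t)) v := by
  obtain ⟨w, hw⟩ := hf.exists_tendsto p
    (mfderiv 𝓘(ℝ, E) 𝓘(ℝ, E) (fun h : G => p * h * p⁻¹) 1 y)
  have key : ∀ c : ℝ → G, IsCurve (E := E) c y → HasVelocity (fun t => f (p * c t)) w := by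
    intro c hc
    have h1 := (hw _ (hc.conj p)).comp (tendsto_id.prodMk (tendsto_const_nhds (x := p)))
    refine h1.congr fun t => ?_
    simp [hc.zero]
  rw [hv.unique (key γ hγ.isCurve)]
  exact key c hc

theorem LCSmooth.continuous {f : G → V} (hf : LCSmooth E f) : Continuous f := by
  rw [continuous_iff_continuousAt]
  intro p
  obtain ⟨D, h0, hc, -⟩ := hf _ (chart_mem_atlas E p)
  set e := chartAt E p with he
  have hp : p ∈ e.source := mem_chart_source E p
  have h1 : ContinuousAt (fun x => D 0 x Fin.elim0) (e p) :=
    ((hc 0).comp (f := fun x : E => (x, Fin.elim0)) (s := e.target) (by fun_prop)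
      fun x hx => ⟨hx, trivial⟩).continuousAt
      (e.open_target.mem_nhds (e.map_source hp))
  have h2 := ContinuousAt.comp (g := fun x => D 0 x Fin.elim0) h1 (e.continuousAt hp)
  refine h2.congr ?_
  filter_upwards [e.open_source.mem_nhds hp] with q hq
  simp only [Function.comp_apply]
  rw [h0 _ (e.map_source hq), Function.comp_apply, e.left_inv hq]

/-! ### A criterion for smoothness -/

/-- As partial derivatives stay in S, they can be chosen again and again. The iterated directional
derivatives are their multilinear expansions in coordinates, which are continuous since all members
of S are. -/
theorem lcSmoothOn_of_partials {J : Type*} [Fintype J] (b : Module.Basis J ℝ E) {U : Set E}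
    (S : Set (E → V))
    (hS : ∀ F ∈ S, ContinuousOn F U ∧ ∃ F' : J → E → V, (∀ j, F' j ∈ S) ∧ ∀ x ∈ U, ∀ w,
      HasVelocity (fun t : ℝ => F (x + t • w)) (∑ j, b.repr w j • F' j x))
    (hb : ∀ j, Continuous fun w => b.repr w j) {F : E → V} (hF : F ∈ S) : LCSmoothOn F U := by
  choose hcont d hdS hd using hS
  -- The iterated partial derivative with multi-index m; the last entry is the last derivative
  -- taken, in accordance with `Fin.snoc`.
  let H : (k : ℕ) → (Fin k → J) → S := fun k => Nat.rec (fun _ => ⟨F, hF⟩)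
    (fun k Hk m => ⟨d (Hk (Fin.init m)).1 (Hk (Fin.init m)).2 (m (Fin.last k)), hdS _ _ _⟩) k
  have H0 : ∀ m, (H 0 m).1 = F := fun _ => rfl
  have Hs : ∀ k (m : Fin k → J) (j : J), (H (k + 1) (Fin.snoc m j)).1 =
      d (H k m).1 (H k m).2 j := by
    intro k m j
    have e1 : (H (k + 1) (Fin.snoc m j)).1 = d (H k (Fin.init (Fin.snoc m j : Fin (k + 1) → J))).1
      (H k (Fin.init (Fin.snoc m j : Fin (k + 1) → J))).2
      ((Fin.snoc m j : Fin (k + 1) → J) (Fin.last k)) := rfl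
    rw [e1]
    have hi : Fin.init (Fin.snoc m j : Fin (k + 1) → J) = m := Fin.init_snoc ..
    rw [hi, Fin.snoc_last]
  refine ⟨fun k x v => ∑ m : Fin k → J, (∏ i, b.repr (v i) (m i)) • (H k m).1 x, ?_, ?_, ?_⟩
  · intro x _ v
    simp [H0]
  · intro k
    refine continuousOn_finsetSum _ fun m _ => ?_
    have h1 : Continuous fun p : E × (Fin k → E) => ∏ i, b.repr (p.2 i) (m i) :=
      continuous_finsetProd _ fun i _ => (hb (m i)).comp ((continuous_apply i).comp continuous_snd)
    refine ContinuousOn.smul (M := ℝ) h1.continuousOn ?_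
    exact (hcont _ (H k m).2).comp continuousOn_fst fun p hp => hp.1
  · intro k x hx v w
    have e : ∑ m : Fin (k + 1) → J, (∏ i, b.repr ((Fin.snoc v w : Fin (k + 1) → E) i) (m i)) •
        (H (k + 1) m).1 x = ∑ m : Fin k → J, (∏ i, b.repr (v i) (m i)) •
          ∑ j, b.repr w j • d (H k m).1 (H k m).2 j x := by
      rw [← (Fin.snocEquiv (fun _ : Fin (k + 1) => J)).sum_comp, Fintype.sum_prod_type_right]
      refine Finset.sum_congr rfl fun m _ => ?_
      rw [Finset.smul_sum]
      refine Finset.sum_congr rfl fun j _ => ?_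
      have : (Fin.snocEquiv (fun _ : Fin (k + 1) => J)) (j, m) = (Fin.snoc m j : Fin (k + 1) → J) :=
        rfl
      rw [this, Hs, Fin.prod_univ_castSucc, smul_smul]
      simp only [Fin.snoc_castSucc, Fin.snoc_last]
    refine Eq.subst (motive := HasVelocity _) e.symm ?_
    refine HasVelocity.sum _ fun m _ => ?_
    refine ((hd _ (H k m).2 x hx w).const_smul (∏ i, b.repr (v i) (m i))).congr fun t => ?_
    rw [smul_comm, smul_sub]

/-- A class of continuous functions which is closed under differentiation along curves consists
of smooth functions. -/
theorem lcSmooth_of_velocity [FiniteDimensional ℝ E] {J : Type*} [Fintype J]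
    (b : Module.Basis J ℝ E) (S : Set (G → V))
    (hS : ∀ g ∈ S, Continuous g ∧ ∃ g' : J → G → V, (∀ j, g' j ∈ S) ∧ ∀ p c (y : E), IsCurve c y →
      HasVelocity (fun t : ℝ => g (p * c t)) (∑ j, b.repr y j • g' j p))
    {g : G → V} (hg : g ∈ S) : LCSmooth E g := by
  intro e he
  have hb : ∀ j, Continuous fun w => b.repr w j := fun j =>
    (b.coord j).continuous_of_finiteDimensional
  have hbs : ∀ j, ContDiff ℝ ∞ fun w => b.repr w j := fun j =>
    (LinearMap.toContinuousLinearMap (b.coord j)).contDiff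
  -- In a chart the directions become variable, so smooth scalar coefficients are needed. By the
  -- product rule, and the expansion of `chartLog` in the basis, the span of these products is
  -- closed under partial derivatives.
  let R : Set (E → V) :=
    {F | ∃ a : E → ℝ, ContDiffOn ℝ ∞ a e.target ∧ ∃ g ∈ S, F = fun x => a x • g (e.symm x)}
  have hR : ∀ a : E → ℝ, ContDiffOn ℝ ∞ a e.target → ∀ g ∈ S,
      (fun x => a x • g (e.symm x)) ∈ Submodule.span ℝ R := fun a ha g hg =>
    Submodule.subset_span ⟨a, ha, g, hg, rfl⟩
  refine lcSmoothOn_of_partials b (Submodule.span ℝ R : Set (E → V)) ?_ hb ?_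
  · intro F hF
    induction hF using Submodule.span_induction with
    | zero =>
      refine ⟨continuousOn_const, fun _ => 0, fun _ => Submodule.zero_mem _, fun x _ w => ?_⟩
      simpa using HasVelocity.zero
    | add F₁ F₂ _ _ h₁ h₂ =>
      obtain ⟨c₁, F₁', m₁, v₁⟩ := h₁
      obtain ⟨c₂, F₂', m₂, v₂⟩ := h₂
      refine ⟨c₁.add c₂, fun j => F₁' j + F₂' j, fun j => Submodule.add_mem _ (m₁ j) (m₂ j),
        fun x hx w => ?_⟩
      simp only [Pi.add_apply, smul_add, Finset.sum_add_distrib]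
      exact (v₁ x hx w).add (v₂ x hx w)
    | smul r F _ h =>
      obtain ⟨c, F', m, v⟩ := h
      refine ⟨ContinuousOn.const_smul (M := ℝ) c r, fun j => r • F' j,
        fun j => Submodule.smul_mem _ r (m j), fun x hx w => ?_⟩
      simp only [Pi.smul_apply]
      refine (((v x hx w).const_smul r).congr fun t => ?_).trans_eq ?_
      · rw [smul_comm, smul_sub]
      · rw [Finset.smul_sum]
        simp only [smul_comm r]
    | mem F h =>
      obtain ⟨a, ha, g, hg, rfl⟩ := h
      obtain ⟨hc, g', hg', hv⟩ := hS g hg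
      refine ⟨?_, fun j => (fun x => fderiv ℝ a x (b j) • g (e.symm x)) +
        ∑ l, fun x => (a x * b.repr (chartLog e x (b j)) l) • g' l (e.symm x), fun j => ?_,
        fun x hx w => ?_⟩
      · exact ContinuousOn.smul (M := ℝ) ha.continuousOn
          (hc.comp_continuousOn e.continuousOn_symm)
      · refine Submodule.add_mem _ (hR _ ?_ g hg) (Submodule.sum_mem _ fun l _ =>
          hR _ ?_ _ (hg' l))
        · exact (ha.fderiv_of_isOpen e.open_target (by simp)).clm_apply contDiffOn_const
        · exact ha.mul ((hbs l).comp_contDiffOn ((contDiffOn_chartLog he).clm_apply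
            contDiffOn_const))
      · have hl : HasDerivAt (fun t : ℝ => x + t • w) w 0 := by
          simpa using ((hasDerivAt_id (0 : ℝ)).smul_const w).const_add x
        have h1 : HasDerivAt (fun t : ℝ => a (x + t • w)) (fderiv ℝ a x w) 0 :=
          HasFDerivAt.comp_hasDerivAt_of_eq (0 : ℝ)
            ((ha.contDiffAt (e.open_target.mem_nhds hx)).differentiableAt (by simp)).hasFDerivAt
            hl (by simp)
        have h2 := hv (e.symm x) _ _ (isCurve_chartLog he hx w)
        simp only [mul_inv_cancel_left] at h2
        have h3 := HasVelocity.smul h1.ofReal_comp h2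
        simp only [Complex.coe_smul, zero_smul, add_zero] at h3
        have e1 : ∀ L : E →L[ℝ] ℝ, L w = ∑ j, b.repr w j * L (b j) := by
          intro L
          conv_lhs => rw [← b.sum_repr w]
          simp only [map_sum, map_smul, smul_eq_mul]
        refine (h3 : Tendsto _ _ _).trans_eq ?_
        congr 1
        have e2 := e1 (fderiv ℝ a x)
        have e3 : ∀ l, b.repr (chartLog e x w) l =
            ∑ j, b.repr w j * b.repr (chartLog e x (b j)) l := fun l =>
          e1 ((LinearMap.toContinuousLinearMap (b.coord l)).comp (chartLog e x))
        simp only [Pi.add_apply, Finset.sum_apply, smul_add, Finset.sum_add_distrib, smul_smul,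
          Finset.smul_sum]
        rw [e2, Finset.sum_smul]
        congr 1
        rw [Finset.sum_comm]
        refine Finset.sum_congr rfl fun l _ => ?_
        rw [e3, ← Finset.sum_smul, Finset.mul_sum]
        congr 1
        refine Finset.sum_congr rfl fun j _ => ?_
        ring
  · have := hR (fun _ => 1) contDiffOn_const g hg
    simp only [one_smul] at this
    exact this

/-! ### Connected Lie groups -/

/-- Along straight segments in a chart the velocity vanishes by left translation, so f is locally
constant. -/
theorem eq_of_velocity_zero [ConnectedSpace G] {f : G → V}
    (hf : ∀ p c (y : E), IsCurve c y → HasVelocity (fun t : ℝ => f (p * c t)) 0) (p q : G) :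
    f p = f q := by
  refine IsLocallyConstant.apply_eq_of_preconnectedSpace ?_ p q
  rw [IsLocallyConstant.iff_eventually_eq]
  intro p
  set e := chartAt E p with he
  have hat : e ∈ atlas E G := chart_mem_atlas E p
  have hp : p ∈ e.source := mem_chart_source E p
  obtain ⟨r, hr, hball⟩ := Metric.isOpen_iff.1 e.open_target (e p) (e.map_source hp)
  filter_upwards [e.open_source.mem_nhds hp,
    e.continuousAt hp (Metric.ball_mem_nhds _ hr)] with q hq hq'
  have hmem : ∀ t ∈ Set.Icc (0 : ℝ) 1, e p + t • (e q - e p) ∈ e.target := fun t ht =>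
    hball ((convex_ball (e p) r).add_smul_sub_mem (Metric.mem_ball_self hr) hq' ht)
  have key := eq_of_velocity_eq_zero (c := fun t : ℝ => f (e.symm (e p + t • (e q - e p)))) ?_
  · simpa [e.left_inv hp, e.left_inv hq] using key
  · intro t ht
    have h2 := hf (e.symm (e p + t • (e q - e p))) _ _ (isCurve_chartLog hat (hmem t ht) (e q - e p))
    simp only [mul_inv_cancel_left] at h2
    refine h2.congr (Eventually.of_forall fun s => ?_)
    simp only [add_smul, add_assoc]

theorem IsCurve.hasDerivAt_comp {F : Type*} [NormedAddCommGroup F] [NormedSpace ℝ F] {c : ℝ → G}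
    {y : E} (hc : IsCurve c y) {h : G → F} (hh : MDifferentiableAt 𝓘(ℝ, E) 𝓘(ℝ, F) h 1) :
    HasDerivAt (fun t => h (c t)) (mfderiv 𝓘(ℝ, E) 𝓘(ℝ, F) h 1 y : F) 0 := by
  have hd := hh.hasMFDerivAt
  have h2 : HasFDerivAt (fun x => h ((chartAt E (1 : G)).symm x))
      (mfderiv 𝓘(ℝ, E) 𝓘(ℝ, F) h 1 : E →L[ℝ] F) (chartAt E (1 : G) 1) := by
    have := hd.2
    simp only [writtenInExtChartAt, mfld_simps] at this
    exact (hasFDerivWithinAt_univ (𝕜 := ℝ)).1 this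
  have h3 := HasFDerivAt.comp_hasDerivAt_of_eq (0 : ℝ) h2 hc.hasDerivAt (by rw [hc.zero])
  refine h3.congr_of_eventuallyEq ?_
  filter_upwards [hc.tendsto (chart_source_mem_nhds E 1)] with t ht
  simp only [Function.comp_apply, (chartAt E (1 : G)).left_inv ht]

/-- A basis of X recovers an operator linearly from finitely many of its values, so pointwise
differentiability suffices for the operator norm. -/
theorem hasDerivAt_clm {X Y : Type*} [NormedAddCommGroup X] [NormedSpace ℂ X]
    [FiniteDimensional ℂ X] [NormedAddCommGroup Y] [NormedSpace ℂ Y] [FiniteDimensional ℂ Y]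
    {F : ℝ → X →L[ℂ] Y} {F' : X →L[ℂ] Y} {t : ℝ}
    (h : ∀ x, HasDerivAt (fun s => F s x) (F' x) t) : HasDerivAt F F' t := by
  let b := Module.finBasis ℂ X
  let L : (Fin (Module.finrank ℂ X) → Y) →ₗ[ℂ] (X →L[ℂ] Y) :=
    LinearMap.toContinuousLinearMap.toLinearMap ∘ₗ (b.constr ℂ).toLinearMap
  have hL : ∀ T : X →L[ℂ] Y, L (fun i => T (b i)) = T := by
    intro T
    ext x
    change (b.constr ℂ fun i => T (b i)) x = T x
    have : (b.constr ℂ fun i => T (b i)) = (T : X →ₗ[ℂ] Y) := b.constr_self ℂ (T : X →ₗ[ℂ] Y)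
    rw [this]
    rfl
  have h1 : HasDerivAt (fun s i => F s (b i)) (fun i => F' (b i)) t :=
    hasDerivAt_pi.2 fun i => h (b i)
  have h2 := ((LinearMap.toContinuousLinearMap L).restrictScalars ℝ).hasFDerivAt.comp_hasDerivAt t h1
  have h3 : HasDerivAt (fun s => L (fun i => F s (b i))) (L (fun i => F' (b i))) t := h2
  simpa only [hL] using h3

/-- A linear action of a connected Lie group preserves a subspace if its differential does. -/
theorem mem_of_connected [FiniteDimensional ℝ E] [ConnectedSpace G] {X : Type*}
    [NormedAddCommGroup X] [NormedSpace ℂ X]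
    [FiniteDimensional ℂ X] {A : G → X →ₗ[ℂ] X} (hA1 : A 1 = LinearMap.id)
    (hA : ∀ g h x, A (g * h) x = A g (A h x))
    (δ : E →ₗ[ℝ] X →ₗ[ℂ] X)
    (hδ : ∀ c y, IsCurve c y → ∀ x, HasDerivAt (fun t : ℝ => A (c t) x) (δ y x) 0)
    {Q : Submodule ℂ X} (hQ : ∀ y, ∀ x ∈ Q, δ y x ∈ Q) (g : G) : ∀ x ∈ Q, A g x ∈ Q := by
  have : IsTopologicalGroup G := topologicalGroup_of_lieGroup 𝓘(ℝ, E) ∞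
  obtain ⟨n, L, hL⟩ : ∃ (n : ℕ) (L : X →ₗ[ℂ] (Fin n → ℂ)), LinearMap.ker L = Q :=
    ⟨_, (Module.finBasis ℂ (X ⧸ Q)).equivFun.toLinearMap ∘ₗ Q.mkQ, by
      rw [LinearEquiv.ker_comp, Submodule.ker_mkQ]⟩
  have hmemL : ∀ x, x ∈ Q ↔ L x = 0 := fun x => by rw [← hL, LinearMap.mem_ker]
  let J := (Module.finBasis ℂ Q).equivFun
  let Z := Fin (Module.finrank ℂ Q) → ℂ
  let R : E →ₗ[ℝ] (Z →L[ℂ] Z) :=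
    { toFun := fun y => LinearMap.toContinuousLinearMap
        (J.toLinearMap ∘ₗ (δ y).restrict (hQ y) ∘ₗ J.symm.toLinearMap)
      map_add' := fun y z => by
        ext1 x
        change J _ = J _ + J _
        rw [← map_add]
        congr 1
        ext
        simp
      map_smul' := fun r y => by
        ext1 x
        change J _ = r • J _
        rw [← Complex.coe_smul, ← map_smul]
        congr 1
        ext
        simp }
  have hR : Continuous R := LinearMap.continuous_of_finiteDimensional R
  -- The obstruction L ∘ A(g)|_Q, with Q = ker L, in coordinates on Q. It vanishes exactly when A(g)
  -- preserves Q.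
  let B : G → (Z →L[ℂ] (Fin n → ℂ)) := fun g =>
    LinearMap.toContinuousLinearMap (L ∘ₗ A g ∘ₗ Q.subtype ∘ₗ J.symm.toLinearMap)
  have hB : ∀ g, B g = 0 ↔ ∀ x ∈ Q, A g x ∈ Q := by
    intro g
    constructor
    · intro h x hx
      rw [hmemL]
      have h1 : L (A g (J.symm (J ⟨x, hx⟩))) = 0 := DFunLike.congr_fun h (J ⟨x, hx⟩)
      rwa [J.symm_apply_apply] at h1
    · intro h
      ext1 x
      exact (hmemL _).1 (h _ (J.symm x).2)
  have key : ∀ e ∈ atlas E G, ∀ x₀ x₁ : E, (∀ t ∈ Set.Icc (0 : ℝ) 1, x₀ + t • (x₁ - x₀) ∈ e.target) →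
      B (e.symm x₀) = 0 → B (e.symm x₁) = 0 := by
    intro e he x₀ x₁ hx h0
    set w := x₁ - x₀ with hw
    set d : ℝ → G := fun t => e.symm (x₀ + t • w) with hd
    set η : ℝ → E := fun t => chartLog e (x₀ + t • w) w with hη
    -- As the differential preserves Q, the obstruction satisfies a homogeneous linear equation
    -- along the segment.
    have hder : ∀ t ∈ Set.Icc (0 : ℝ) 1, HasDerivAt (fun s => B (d s)) (B (d t) ∘L R (η t)) t := by
      intro t ht
      refine hasDerivAt_clm fun z => ?_
      have h1 := hδ _ _ (isCurve_chartLog he (hx t ht) w) (J.symm z)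
      have h2 := ((LinearMap.toContinuousLinearMap (L ∘ₗ A (d t))).restrictScalars
        ℝ).hasFDerivAt.comp_hasDerivAt (0 : ℝ) h1
      have h3 : HasDerivAt (fun s => B (d (t + s)) z) ((B (d t) ∘L R (η t)) z) 0 := by
        have e1 : (B (d t) ∘L R (η t)) z = L (A (d t) (δ (η t) (J.symm z))) := by
          change L (A (d t) (J.symm (J _))) = _
          rw [J.symm_apply_apply]
          rfl
        rw [e1]
        refine HasDerivAt.congr_of_eventuallyEq h2 (Eventually.of_forall fun s => ?_)
        change L (A (d (t + s)) (J.symm z)) = L (A (d t) (A _ (J.symm z)))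
        rw [← hA]
        simp only [hd, mul_inv_cancel_left, add_smul, add_assoc]
      have h4 : HasDerivAt (fun s => B (d (t + s)) z) ((B (d t) ∘L R (η t)) z) (t - t) := by
        rwa [sub_self]
      simpa using HasDerivAt.comp_sub_const t t h4
    have hηc : ContinuousOn η (Set.Icc 0 1) :=
      ((contDiffOn_chartLog he).continuousOn.comp (f := fun t : ℝ => x₀ + t • w) (by fun_prop)
        hx).clm_apply continuousOn_const
    obtain ⟨C, hC⟩ := isCompact_Icc.exists_bound_of_continuousOn (hR.comp_continuousOn hηc)
    -- Grönwall's inequality with initial value 0 and no inhomogeneous term forces B = 0.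
    have hgr := norm_le_gronwallBound_of_norm_deriv_right_le (f := fun s => B (d s))
      (f' := fun t => B (d t) ∘L R (η t)) (δ := 0) (K := C) (ε := 0) (a := 0) (b := 1)
      (fun t ht => (hder t ht).continuousAt.continuousWithinAt)
      (fun t ht => (hder t (Set.Ico_subset_Icc_self ht)).hasDerivWithinAt)
      (by simp [hd, h0])
      (fun t ht => by
        rw [add_zero, mul_comm]
        exact (ContinuousLinearMap.opNorm_comp_le _ _).trans
          (mul_le_mul_of_nonneg_left (hC t (Set.Ico_subset_Icc_self ht)) (norm_nonneg _)))
      1 (by simp)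
    rw [gronwallBound_ε0_δ0] at hgr
    have := norm_le_zero_iff.1 hgr
    simpa [hd, hw] using this
  have hloc : IsLocallyConstant fun g => B g = 0 := by
    rw [IsLocallyConstant.iff_eventually_eq]
    intro p
    set e := chartAt E p with he
    have hat : e ∈ atlas E G := chart_mem_atlas E p
    have hp : p ∈ e.source := mem_chart_source E p
    obtain ⟨r, hr, hball⟩ := Metric.isOpen_iff.1 e.open_target (e p) (e.map_source hp)
    filter_upwards [e.open_source.mem_nhds hp,
      e.continuousAt hp (Metric.ball_mem_nhds _ hr)] with q hq hq'
    have k1 := key e hat (e p) (e q) fun t ht =>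
      hball ((convex_ball (e p) r).add_smul_sub_mem (Metric.mem_ball_self hr) hq' ht)
    -- Traversing the segment backwards gives the converse, so the vanishing of B is both open and
    -- closed.
    have k2 := key e hat (e q) (e p) fun t ht =>
      hball ((convex_ball (e p) r).add_smul_sub_mem hq' (Metric.mem_ball_self hr) ht)
    rw [e.left_inv hp, e.left_inv hq] at k1 k2
    exact propext ⟨k2, k1⟩
  rw [← hB]
  have h1 : B 1 = 0 := (hB 1).2 fun x hx => by simpa [hA1] using hx
  exact (hloc.apply_eq_of_preconnectedSpace 1 g).mp h1

end Velocity

/-! ### The adjoint action along curves and its invariant subspaces -/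

section Adjoint

variable {𝔤 : Type*} [NormedAddCommGroup 𝔤] [NormedSpace ℂ 𝔤] [FiniteDimensional ℂ 𝔤]
  [LieSuperalgebra 𝔤]
  {E : Type*} [NormedAddCommGroup E] [NormedSpace ℝ E] [FiniteDimensional ℝ E]
  {G : Type*} [Group G] [TopologicalSpace G] [ChartedSpace E G] [LieGroup 𝓘(ℝ, E) ∞ G]

theorem CsSupergroupPair.emb_even (P : CsSupergroupPair 𝔤 E G) (y : GroupLieAlgebra 𝓘(ℝ, E) G) :
    P.emb y ∈ part 𝔤 0 :=
  P.isRealForm.le _ (LinearMap.mem_range_self P.emb y)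

theorem CsSupergroupPair.hasDerivAt_Ad (P : CsSupergroupPair 𝔤 E G) {c : ℝ → G}
    {y : GroupLieAlgebra 𝓘(ℝ, E) G} (hc : IsCurve (E := E) c y) (x : 𝔤) :
    HasDerivAt (fun t => P.Ad (c t) x) (br (P.emb y) x) 0 := by
  have h1 : ContMDiff 𝓘(ℝ, E) 𝓘(ℝ, 𝔤) ∞ fun g : G => P.Ad g x :=
    P.Ad_smooth.comp (contMDiff_id.prodMk contMDiff_const)
  rw [← P.deriv_Ad y x]
  exact hc.hasDerivAt_comp (h1.mdifferentiable (by simp) 1)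

theorem CsSupergroupPair.continuous_Ad (P : CsSupergroupPair 𝔤 E G) :
    Continuous fun p : G × 𝔤 => P.Ad p.1 p.2 :=
  P.Ad_smooth.continuous

theorem CsSupergroupPair.exists_isCurve_conj (P : CsSupergroupPair 𝔤 E G) {c : ℝ → G}
    {y : GroupLieAlgebra 𝓘(ℝ, E) G} (hc : IsCurve (E := E) c y) (g : G) :
    ∃ y' : GroupLieAlgebra 𝓘(ℝ, E) G, IsCurve (E := E) (fun t => g * c t * g⁻¹) y' ∧
      P.emb y' = P.Ad g (P.emb y) :=
  ⟨_, hc.conj g, (P.Ad_emb g y).symm⟩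

theorem CsSupergroupPair.Ad_Ad_inv (P : CsSupergroupPair 𝔤 E G) (g : G) (x : 𝔤) :
    P.Ad g (P.Ad g⁻¹ x) = x := by
  rw [← P.Ad_mul, mul_inv_cancel, P.Ad_one]

/-- The adjoint action of a connected Lie group preserves a subspace if its Lie algebra does. -/
theorem CsSupergroupPair.Ad_mem_of_connected (P : CsSupergroupPair 𝔤 E G)
    {F : Type*} [NormedAddCommGroup F] [NormedSpace ℝ F] [FiniteDimensional ℝ F]
    {H : Type*} [Group H] [TopologicalSpace H] [ChartedSpace F H] [LieGroup 𝓘(ℝ, F) ∞ H]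
    [ConnectedSpace H] {φ : H →* G} (hφ : ContMDiff 𝓘(ℝ, F) 𝓘(ℝ, E) ∞ φ) {Q : Submodule ℂ 𝔤}
    (hQ : ∀ y : GroupLieAlgebra 𝓘(ℝ, F) H, ∀ x ∈ Q,
      br (P.emb (mfderiv 𝓘(ℝ, F) 𝓘(ℝ, E) φ 1 y : E)) x ∈ Q) (h : H) :
    ∀ x ∈ Q, P.Ad (φ h) x ∈ Q := by
  let D : F →L[ℝ] E := mfderiv 𝓘(ℝ, F) 𝓘(ℝ, E) φ 1
  let e' : E →ₗ[ℝ] 𝔤 := P.emb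
  let δ : F →ₗ[ℝ] 𝔤 →ₗ[ℂ] 𝔤 := ((br : 𝔤 →ₗ[ℂ] 𝔤 →ₗ[ℂ] 𝔤).restrictScalars ℝ) ∘ₗ e' ∘ₗ D.toLinearMap
  refine mem_of_connected (A := fun h => (P.Ad (φ h)).toLin) ?_ ?_ δ ?_ hQ h
  · ext x
    simp [P.Ad_one]
  · intro g h x
    rw [map_mul, P.Ad_mul]
  · intro c y hc x
    exact P.hasDerivAt_Ad (hc.comp (map_one φ) (hφ.mdifferentiable (by simp) 1)) x

end Adjoint

/-! ### The topology of induced representations -/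

section IndTopology

variable {𝔤 : Type*} [NormedAddCommGroup 𝔤] [NormedSpace ℂ 𝔤] [FiniteDimensional ℂ 𝔤]
  [LieSuperalgebra 𝔤]
  {E : Type*} [NormedAddCommGroup E] [NormedSpace ℝ E] [FiniteDimensional ℝ E]
  {G : Type*} [Group G] [TopologicalSpace G] [ChartedSpace E G] [LieGroup 𝓘(ℝ, E) ∞ G]
  {W : Type*} [AddCommGroup W] [Module ℂ W] [SuperModule W] [UniformSpace W] [LCSuperSpace W]

theorem locallyConvexSpace_uniformOnFun :
    LocallyConvexSpace ℝ (UniformOnFun G W {K : Set G | IsCompact K}) := by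
  refine LocallyConvexSpace.ofBasisZero ℝ _ _ _
    (UniformOnFun.hasBasis_nhds_zero_of_basis {K : Set G | IsCompact K} ⟨∅, isCompact_empty⟩
      (directedOn_of_sup_mem fun _ _ => IsCompact.union)
      (LocallyConvexSpace.convex_basis_zero (𝕜 := ℝ) (E := W))) ?_
  rintro ⟨K, C⟩ ⟨_, _, hC⟩ f hf g hg a b ha hb hab x hx
  exact hC (hf x hx) (hg x hx) ha hb hab

variable (P : CsSupergroupPair 𝔤 E G) (𝔥 : LieSubsuperalgebra 𝔤) (H : Subgroup G)
  (π : SuperRep 𝔥.Carrier H W)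

/-- The embedding which defines the topology of the induced representation. -/
def indToFun : ind P 𝔥 H π →ₗ[ℂ] (SuperEnv 𝔤 → UniformOnFun G W {K : Set G | IsCompact K}) where
  toFun f u := UniformOnFun.ofFun {K : Set G | IsCompact K} (f.1 u)
  map_add' _ _ := rfl
  map_smul' _ _ := rfl

theorem isUniformInducing_indToFun : IsUniformInducing (indToFun P 𝔥 H π) :=
  IsUniformInducing.comp (g := fun (f : SuperEnv 𝔤 →ₗ[ℂ] (G → W)) u =>
    UniformOnFun.ofFun {K : Set G | IsCompact K} (f u)) ⟨rfl⟩ isUniformEmbedding_subtype_val.1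

variable {P 𝔥 H π}

theorem ind_continuous (f : ind P 𝔥 H π) (u : SuperEnv 𝔤) : Continuous (f.1 u) :=
  (f.2.1.1 u).continuous

/-- On a locally compact space, uniform convergence on compact sets is locally uniform convergence,
and for a continuous limit this is convergence jointly with the argument. Seminorms are not needed
afterwards. -/
theorem tendsto_ind_iff {ι : Type*} {l : Filter ι} {F : ι → ind P 𝔥 H π} {f : ind P 𝔥 H π} :
    Tendsto F l (𝓝 f) ↔ ∀ u p₀,
      Tendsto (fun q : ι × G => (F q.1).1 u q.2) (l ×ˢ 𝓝 p₀) (𝓝 (f.1 u p₀)) := by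
  have : LocallyCompactSpace G := ChartedSpace.locallyCompactSpace E G
  rw [(isUniformInducing_indToFun P 𝔥 H π).isInducing.tendsto_nhds_iff, tendsto_pi_nhds]
  refine forall_congr' fun u => ?_
  rw [UniformOnFun.tendsto_iff_tendstoUniformlyOn]
  have h1 := tendstoLocallyUniformly_iff_forall_isCompact (F := fun i => (F i).1 u) (f := f.1 u)
    (p := l)
  refine (show _ ↔ _ from h1.symm).trans ?_
  rw [tendstoLocallyUniformly_iff_forall_tendsto]
  refine forall_congr' fun p₀ => ?_
  have hc : Tendsto (fun q : ι × G => f.1 u q.2) (l ×ˢ 𝓝 p₀) (𝓝 (f.1 u p₀)) :=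
    ((ind_continuous f u).tendsto p₀).comp tendsto_snd
  rw [Uniform.tendsto_nhds_right] at hc ⊢
  constructor
  · intro h
    exact hc.uniformity_trans h
  · intro h
    exact (tendsto_swap_uniformity.comp hc).uniformity_trans h

theorem tendsto_ind_eval (f : ind P 𝔥 H π) (u : SuperEnv 𝔤) (p₀ : G) :
    Tendsto (fun q : ind P 𝔥 H π × G => q.1.1 u q.2) (𝓝 f ×ˢ 𝓝 p₀) (𝓝 (f.1 u p₀)) :=
  tendsto_ind_iff.1 tendsto_id u p₀

theorem continuous_ind_eval (u : SuperEnv 𝔤) :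
    Continuous fun q : ind P 𝔥 H π × G => q.1.1 u q.2 := by
  rw [continuous_iff_continuousAt]
  rintro ⟨f, p⟩
  rw [ContinuousAt, nhds_prod_eq]
  exact tendsto_ind_eval f u p

/-- The exponential law: continuity into the induced space becomes joint continuity on a product
with G₀. -/
theorem continuous_ind_iff {X : Type*} [TopologicalSpace X] {F : X → ind P 𝔥 H π} :
    Continuous F ↔ ∀ u, Continuous fun q : X × G => (F q.1).1 u q.2 := by
  constructor
  · intro h u
    exact (continuous_ind_eval u).comp (h.prodMap continuous_id)
  · intro h
    rw [continuous_iff_continuousAt]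
    intro x
    refine tendsto_ind_iff.2 fun u p₀ => ?_
    rw [← nhds_prod_eq]
    exact (h u).tendsto (x, p₀)

variable (P 𝔥 H π)

instance lcSuperSpace_ind : LCSuperSpace (ind P 𝔥 H π) where
  toIsUniformAddGroup := by
    have := IsUniformAddGroup.comap (indToFun P 𝔥 H π)
    rwa [(isUniformInducing_indToFun P 𝔥 H π).comap_uniformSpace] at this
  continuous_smul := by
    refine continuous_ind_iff.2 fun u => ?_
    exact (continuous_fst.comp continuous_fst).smul
      ((continuous_ind_eval u).comp ((continuous_snd.comp continuous_fst).prodMk continuous_snd))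
  toT2Space := by
    refine T2Space.of_injective_continuous (f := fun (f : ind P 𝔥 H π) u p => f.1 u p) ?_ ?_
    · intro f g h
      ext u p
      exact congr_fun (congr_fun h u) p
    · refine continuous_pi fun u => continuous_pi fun p => ?_
      exact (continuous_ind_eval u).comp (continuous_id.prodMk continuous_const)
  toLocallyConvexSpace := by
    have h0 : LocallyConvexSpace ℝ (UniformOnFun G W {K : Set G | IsCompact K}) :=
      locallyConvexSpace_uniformOnFun
    let L : ind P 𝔥 H π →ₗ[ℝ] (SuperEnv 𝔤 → UniformOnFun G W {K : Set G | IsCompact K}) :=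
      { toFun := indToFun P 𝔥 H π
        map_add' := map_add _
        map_smul' := fun _ _ => rfl }
    have h1 := LocallyConvexSpace.induced L
    rwa [(isUniformInducing_indToFun P 𝔥 H π).isInducing.eq_induced]
  continuous_parity := by
    refine continuous_ind_iff.2 fun u => ?_
    exact LCSuperSpace.continuous_parity.comp (continuous_ind_eval (parity u))

end IndTopology

/-! ### Families of linear maps on a finite-dimensional space -/

section LinearFamilies

variable {X : Type*} [NormedAddCommGroup X] [NormedSpace ℂ X] [FiniteDimensional ℂ X]
  {W : Type*} [AddCommGroup W] [Module ℂ W] [SuperModule W] [UniformSpace W] [LCSuperSpace W]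

/-- Expanding in a basis, pointwise convergence of the maps is enough. It is applied with X = 𝔤 to
arguments Ad(g)x that move with g. -/
theorem tendsto_linear_apply {T : Type*} {l : Filter T} {F : T → X →ₗ[ℂ] W} {F₀ : X →ₗ[ℂ] W}
    (hF : ∀ x, Tendsto (fun t => F t x) l (𝓝 (F₀ x))) {a : T → X} {a₀ : X}
    (ha : Tendsto a l (𝓝 a₀)) : Tendsto (fun t => F t (a t)) l (𝓝 (F₀ a₀)) := by
  let b := Module.finBasis ℂ X
  have e : ∀ (L : X →ₗ[ℂ] W) x, L x = ∑ j, b.repr x j • L (b j) := by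
    intro L x
    conv_lhs => rw [← b.sum_repr x]
    simp only [map_sum, map_smul]
  rw [e F₀]
  refine Tendsto.congr (fun t => (e (F t) (a t)).symm) ?_
  refine tendsto_finsetSum _ fun j _ => Tendsto.smul ?_ (hF _)
  exact ((b.coord j).continuous_of_finiteDimensional.tendsto a₀).comp ha

theorem continuous_linear_apply {T : Type*} [TopologicalSpace T] {F : T → X →ₗ[ℂ] W}
    (hF : ∀ x, Continuous fun t => F t x) {a : T → X} (ha : Continuous a) :
    Continuous fun t => F t (a t) :=
  continuous_iff_continuousAt.2 fun t =>
    tendsto_linear_apply (fun x => (hF x).tendsto t) (ha.tendsto t)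

theorem HasVelocity.linear_apply {F : ℝ → X →ₗ[ℂ] W} (hF : ∀ x, ContinuousAt (fun t => F t x) 0)
    {a : ℝ → X} {a' : X} (ha : HasDerivAt a a' 0) {v : W}
    (hv : HasVelocity (fun t => F t (a 0)) v) :
    HasVelocity (fun t => F t (a t)) (F 0 a' + v) := by
  have h1 := hasDerivAt_iff_tendsto_slope_zero.1 ha
  simp only [zero_add] at h1
  have h2 := tendsto_linear_apply (fun x => (hF x).tendsto.mono_left nhdsWithin_le_nhds) h1
  refine (Tendsto.add h2 hv).congr fun t => ?_
  rw [← Complex.coe_smul, ← Complex.coe_smul, ← Complex.coe_smul, map_smul, map_sub, ← smul_add]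
  congr 1
  abel

end LinearFamilies

section Pairs

variable {𝔤 : Type*} [NormedAddCommGroup 𝔤] [NormedSpace ℂ 𝔤] [FiniteDimensional ℂ 𝔤]
  [LieSuperalgebra 𝔤]
  {E : Type*} [NormedAddCommGroup E] [NormedSpace ℝ E] [FiniteDimensional ℝ E]
  {G : Type*} [Group G] [TopologicalSpace G] [ChartedSpace E G] [LieGroup 𝓘(ℝ, E) ∞ G]
  {W : Type*} [AddCommGroup W] [Module ℂ W] [SuperModule W] [UniformSpace W] [LCSuperSpace W]

/-! ### Smooth representations and curves -/

theorem CsSupergroupPair.IsSmoothRep.hasVelocity {P : CsSupergroupPair 𝔤 E G} {ρ : SuperRep 𝔤 G W}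
    (hρ : P.IsSmoothRep ρ) {c : ℝ → G} {y : GroupLieAlgebra 𝓘(ℝ, E) G} (hc : IsCurve (E := E) c y)
    (v : W) : HasVelocity (fun t => ρ.grp (c t) v) (ρ.alg (P.emb y) v) := by
  obtain ⟨γ, hγ⟩ := exists_isOneParam G y
  have := (hρ.smooth_grp v).hasVelocity_of_isOneParam (p := 1) hγ
    (by simpa using hρ.velocity y γ hγ v) hc
  simpa using this

theorem CsSupergroupPair.sum_repr_smul (P : CsSupergroupPair 𝔤 E G)
    (L : 𝔤 →ₗ[ℂ] W) (y : E) :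
    (∑ j, (Module.finBasis ℝ E).repr y j • L (P.emb (Module.finBasis ℝ E j : E))) =
      L (P.emb y) := by
  let e : E →ₗ[ℝ] 𝔤 := P.emb
  have h : ∀ y : E, L (e y) = ∑ j, (Module.finBasis ℝ E).repr y j •
      L (e (Module.finBasis ℝ E j)) := by
    intro y
    conv_lhs => rw [← (Module.finBasis ℝ E).sum_repr y]
    rw [map_sum, map_sum]
    refine Finset.sum_congr rfl fun j _ => ?_
    rw [map_smul, ← Complex.coe_smul, map_smul, Complex.coe_smul]
  exact (h y).symm

/-- Smoothness of orbit maps comes for free: the derivative of g ↦ ρ(g)v in direction y is the orbit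
map of ρ(y)v, so the class of all orbit maps is stable under differentiation. -/
theorem CsSupergroupPair.isSmoothRep_of_hasVelocity {P : CsSupergroupPair 𝔤 E G}
    {ρ : SuperRep 𝔤 G W} (h1 : Continuous fun p : G × W => ρ.grp p.1 p.2)
    (h2 : Continuous fun p : 𝔤 × W => ρ.alg p.1 p.2)
    (h3 : ∀ (c : ℝ → G) (y : GroupLieAlgebra 𝓘(ℝ, E) G), IsCurve (E := E) c y → ∀ v,
      HasVelocity (fun t => ρ.grp (c t) v) (ρ.alg (P.emb y) v))
    (h4 : ∀ g x v, ρ.alg (P.Ad g x) v = ρ.grp g (ρ.alg x (ρ.grp g⁻¹ v))) : P.IsSmoothRep ρ where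
  continuous_grp := h1
  continuous_alg := h2
  velocity x γ hγ v := h3 γ x hγ.isCurve v
  equivariant := h4
  smooth_grp v := by
    refine lcSmooth_of_velocity (Module.finBasis ℝ E) (Set.range fun v g => ρ.grp g v) ?_ ⟨v, rfl⟩
    rintro _ ⟨v, rfl⟩
    refine ⟨h1.comp (continuous_id.prodMk continuous_const),
      fun j g => ρ.grp g (ρ.alg (P.emb (Module.finBasis ℝ E j : E)) v), fun j => ⟨_, rfl⟩,
      fun p c y hc => ?_⟩
    have h5 := (h3 c y hc v).map (ρ.grp p) (h1.comp (continuous_const.prodMk continuous_id))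
    have h6 : HasVelocity (fun t => ρ.grp (p * c t) v) (ρ.grp p (ρ.alg (P.emb y) v)) := by
      simp only [map_mul]
      exact h5
    exact Eq.subst (motive := HasVelocity _)
      (P.sum_repr_smul (ρ.grp p ∘ₗ ρ.alg.flip v) y).symm h6

theorem CsSupergroupPair.IsSmoothRep.restrict {P : CsSupergroupPair 𝔤 E G} {ρ : SuperRep 𝔤 G W}
    (hρ : P.IsSmoothRep ρ)
    {𝔥 : Type*} [NormedAddCommGroup 𝔥] [NormedSpace ℂ 𝔥] [FiniteDimensional ℂ 𝔥]
    [LieSuperalgebra 𝔥] {F : Type*} [NormedAddCommGroup F] [NormedSpace ℝ F]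
    [FiniteDimensional ℝ F] {H : Type*} [Group H] [TopologicalSpace H] [ChartedSpace F H]
    [LieGroup 𝓘(ℝ, F) ∞ H] {P' : CsSupergroupPair 𝔥 F H} {dφ : LieSuperHom 𝔥 𝔤} {φ : H →* G}
    (h : P'.IsMorphism P dφ φ) : P'.IsSmoothRep (ρ.restrict dφ φ) := by
  refine CsSupergroupPair.isSmoothRep_of_hasVelocity ?_ ?_ ?_ ?_
  · exact hρ.continuous_grp.comp (h.smooth.continuous.prodMap continuous_id)
  · exact hρ.continuous_alg.comp
      ((dφ.toLin.continuous_of_finiteDimensional).prodMap continuous_id)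
  · intro c y hc v
    have h1 := hρ.hasVelocity (hc.comp (map_one φ) (h.smooth.mdifferentiable (by simp) 1)) v
    rw [← h.emb y] at h1
    exact h1
  · intro g x v
    change ρ.alg (dφ (P'.Ad g x)) v = ρ.grp (φ g) (ρ.alg (dφ x) (ρ.grp (φ g⁻¹) v))
    rw [h.Ad, hρ.equivariant, map_inv φ]

/-! ### Superfunctions -/

theorem ι_even_mul_ι {x y : 𝔤} (hx : x ∈ part 𝔤 0) :
    SuperEnv.ι x * SuperEnv.ι y = SuperEnv.ι (br x y) + SuperEnv.ι y * SuperEnv.ι x := by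
  have key : (LinearMap.mulLeft ℂ (SuperEnv.ι x)) ∘ₗ SuperEnv.ι =
      SuperEnv.ι ∘ₗ br x + (LinearMap.mulRight ℂ (SuperEnv.ι x)) ∘ₗ SuperEnv.ι := by
    refine linearMap_ext_part fun i y hy => ?_
    simpa [koszulSign_zero_left] using SuperEnv.ι_mul_ι hx hy
  exact DFunLike.congr_fun key y

/-- The functions f(u) form a class stable under differentiation, the derivative of f(u) along y
being f(yu). Hence continuity replaces smoothness; conversely, arbitrary curves may replace
one-parameter subgroups. -/
theorem mem_superfunctions_iff {P : CsSupergroupPair 𝔤 E G} {f : SuperEnv 𝔤 →ₗ[ℂ] (G → W)} :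
    f ∈ superfunctions P W ↔ (∀ u, Continuous (f u)) ∧
      ∀ (y : GroupLieAlgebra 𝓘(ℝ, E) G) (c : ℝ → G), IsCurve (E := E) c y → ∀ u p,
        HasVelocity (fun t => f u (p * c t)) (f (SuperEnv.ι (P.emb y) * u) p) := by
  constructor
  · rintro ⟨h1, h2⟩
    refine ⟨fun u => (h1 u).continuous, fun y c hc u p => ?_⟩
    obtain ⟨γ, hγ⟩ := exists_isOneParam G y
    exact (h1 u).hasVelocity_of_isOneParam hγ (h2 y γ hγ u p) hc
  · rintro ⟨h1, h2⟩
    refine ⟨fun u => ?_, fun y γ hγ => h2 y γ hγ.isCurve⟩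
    refine lcSmooth_of_velocity (Module.finBasis ℝ E) (Set.range f) ?_ ⟨u, rfl⟩
    rintro _ ⟨u, rfl⟩
    refine ⟨h1 u, fun j => f (SuperEnv.ι (P.emb (Module.finBasis ℝ E j : E)) * u),
      fun j => ⟨_, rfl⟩, fun p c y hc => ?_⟩
    have h3 := P.sum_repr_smul (LinearMap.proj p ∘ₗ f ∘ₗ
      (LinearMap.mulRight ℂ u) ∘ₗ SuperEnv.ι) y
    refine Eq.subst (motive := HasVelocity _) h3.symm (h2 y c hc u p)

/-! ### The action on induced representations -/

section IndRep

variable (P : CsSupergroupPair 𝔤 E G) (𝔥 : LieSubsuperalgebra 𝔤) (H : Subgroup G)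
  (π : SuperRep 𝔥.Carrier H W)

/-- The operator `f ↦ f(g⁻¹ ·)`. -/
def indGrp (g : G) : ind P 𝔥 H π →ₗ[ℂ] ind P 𝔥 H π where
  toFun f := ⟨{ toFun := fun u p => f.1 u (g⁻¹ * p)
                map_add' := fun u v => by ext; simp
                map_smul' := fun c u => by ext; simp }, by
    have : IsTopologicalGroup G := topologicalGroup_of_lieGroup 𝓘(ℝ, E) ∞
    obtain ⟨h1, h2⟩ := mem_superfunctions_iff.1 f.2.1
    refine ⟨mem_superfunctions_iff.2 ⟨fun u => (h1 u).comp (continuous_const_mul g⁻¹),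
      fun y c hc u p => ?_⟩, fun h u p => ?_, fun i y hy u p => f.2.2.2 i y hy u _⟩
    · have := h2 y c hc u (g⁻¹ * p)
      simp only [mul_assoc] at this
      exact this
    · have := f.2.2.1 h u (g⁻¹ * p)
      rw [mul_assoc] at this
      exact this⟩
  map_add' _ _ := rfl
  map_smul' _ _ := rfl

/-- The operator `f ↦ ((u, p) ↦ -f(Ad(p⁻¹)(x)u)(p))`. -/
def indOp : 𝔤 →ₗ[ℂ] ind P 𝔥 H π →ₗ[ℂ] ind P 𝔥 H π :=
  LinearMap.mk₂ ℂ (fun x f => ⟨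
      { toFun := fun u p => -f.1 (SuperEnv.ι (P.Ad p⁻¹ x) * u) p
        map_add' := fun u v => by
          ext
          simp [mul_add]
          abel
        map_smul' := fun c u => by
          ext
          simp }, by
    have : IsTopologicalGroup G := topologicalGroup_of_lieGroup 𝓘(ℝ, E) ∞
    obtain ⟨h1, h2⟩ := mem_superfunctions_iff.1 f.2.1
    refine ⟨mem_superfunctions_iff.2 ⟨fun u => ?_, fun y c hc u p => ?_⟩, fun h u p => ?_,
      fun i y hy u p => ?_⟩
    · refine Continuous.neg (continuous_linear_apply (X := 𝔤) (F := fun p => LinearMap.proj p ∘ₗ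
        f.1 ∘ₗ (LinearMap.mulRight ℂ u) ∘ₗ SuperEnv.ι) (fun z => h1 _) ?_)
      exact P.continuous_Ad.comp (continuous_inv.prodMk continuous_const)
    · have hinv := hc.inv
      have hd := P.hasDerivAt_Ad (y := -y) hinv (P.Ad p⁻¹ x)
      have h3 := HasVelocity.linear_apply (X := 𝔤) (F := fun t => LinearMap.proj (p * c t) ∘ₗ
        f.1 ∘ₗ (LinearMap.mulRight ℂ u) ∘ₗ SuperEnv.ι) (fun z => ?_) hd
        (v := f.1 (SuperEnv.ι (P.emb y) * (SuperEnv.ι (P.Ad p⁻¹ x) * u)) p) ?_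
      · have h4 := h3.neg
        set L : 𝔤 →ₗ[ℂ] W := LinearMap.proj p ∘ₗ f.1 ∘ₗ (LinearMap.mulRight ℂ u) ∘ₗ SuperEnv.ι
        have e0 : L (br (P.emb (-y)) (P.Ad p⁻¹ x)) = -L (br (P.emb y) (P.Ad p⁻¹ x)) := by
          simp only [map_neg, LinearMap.neg_apply]
        -- Moving y to the right past Ad(p⁻¹)x creates a commutator, which cancels the derivative of
        -- Ad(c(t)⁻¹).
        have e1 : f.1 (SuperEnv.ι (P.emb y) * (SuperEnv.ι (P.Ad p⁻¹ x) * u)) p =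
            L (br (P.emb y) (P.Ad p⁻¹ x)) +
              f.1 (SuperEnv.ι (P.Ad p⁻¹ x) * (SuperEnv.ι (P.emb y) * u)) p := by
          rw [← mul_assoc, ← mul_assoc, ι_even_mul_ι (P.emb_even y), add_mul, map_add]
          rfl
        rw [hc.zero, mul_one] at h4
        have h5 : HasVelocity (fun t => -f.1 (SuperEnv.ι (P.Ad (c t)⁻¹ (P.Ad p⁻¹ x)) * u) (p * c t))
            (-(L (br (P.emb (-y)) (P.Ad p⁻¹ x)) +
              f.1 (SuperEnv.ι (P.emb y) * (SuperEnv.ι (P.Ad p⁻¹ x) * u)) p)) := h4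
        rw [e0, e1, neg_add_cancel_left] at h5
        simp only [← P.Ad_mul, ← mul_inv_rev] at h5
        exact h5
      · refine ContinuousAt.comp (g := f.1 _) (h1 _).continuousAt ?_
        exact continuousAt_const.mul hc.continuousAt
      · have := h2 y c hc (SuperEnv.ι (P.Ad p⁻¹ x) * u) p
        simpa [hc.zero, P.Ad_one] using this
    · have := f.2.2.1 h (SuperEnv.ι (P.Ad p⁻¹ x) * u) p
      change -f.1 _ p = π.grp h (-f.1 (SuperEnv.ι (P.Ad (p * h)⁻¹ x) * _) (p * h))
      rw [this, map_mul, SuperEnv.map_ι, map_neg, mul_inv_rev, P.Ad_mul]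
    · have := f.2.2.2 i y hy (SuperEnv.ι (P.Ad p⁻¹ x) * u) p
      change -f.1 (_ * (u * _)) p = -π.alg y (twist i (-f.1 _ p))
      rw [map_neg, map_neg, ← this, mul_assoc]⟩)
    (fun x y f => by
      ext u p
      simp [add_mul]
      abel)
    (fun c x f => by
      ext u p
      simp)
    (fun x f g => by
      ext u p
      simp
      abel)
    (fun c x f => by
      ext u p
      simp)

theorem indOp_apply (x : 𝔤) (f : ind P 𝔥 H π) (u : SuperEnv 𝔤) (p : G) :
    (indOp P 𝔥 H π x f).1 u p = -f.1 (SuperEnv.ι (P.Ad p⁻¹ x) * u) p := rfl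

theorem indGrp_apply (g : G) (f : ind P 𝔥 H π) (u : SuperEnv 𝔤) (p : G) :
    (indGrp P 𝔥 H π g f).1 u p = f.1 u (g⁻¹ * p) := rfl

/-- The parity involution of the induced representation. -/
abbrev indParity : ind P 𝔥 H π →ₗ[ℂ] ind P 𝔥 H π :=
  @parity (ind P 𝔥 H π) (ind P 𝔥 H π).addCommGroup (ind P 𝔥 H π).module _

/-- The twist of the induced representation. -/
abbrev indTwist (i : ZMod 2) : ind P 𝔥 H π →ₗ[ℂ] ind P 𝔥 H π :=
  @twist (ind P 𝔥 H π) (ind P 𝔥 H π).addCommGroup (ind P 𝔥 H π).module _ i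

theorem ind_parity_apply (f : ind P 𝔥 H π) (u : SuperEnv 𝔤) (p : G) :
    (indParity P 𝔥 H π f).1 u p = parity (f.1 (parity u) p) := rfl

theorem parity_indOp (x : 𝔤) (f : ind P 𝔥 H π) :
    indParity P 𝔥 H π (indOp P 𝔥 H π x f) =
      indOp P 𝔥 H π (parity x) (indParity P 𝔥 H π f) := by
  ext u p
  rw [ind_parity_apply, indOp_apply, indOp_apply, ind_parity_apply, (P.Ad p⁻¹).map_parity,
    SuperEnv.parity_eq (_ * _), map_mul SuperEnv.parityHom, SuperEnv.parityHom_ι, parity_parity, map_neg,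
    SuperEnv.parity_eq]

theorem twist_indOp (i : ZMod 2) {j : ZMod 2} {x : 𝔤} (hx : x ∈ part 𝔤 j) (f : ind P 𝔥 H π) :
    indTwist P 𝔥 H π i (indOp P 𝔥 H π x f) =
      koszulSign i j • indOp P 𝔥 H π x (indTwist P 𝔥 H π i f) := by
  rcases parity_cases i with rfl | rfl
  · simp [twist_zero, koszulSign_zero_left]
  · rw [twist_one, twist_one, parity_indOp, mem_part.1 hx, map_smul, LinearMap.smul_apply,
      koszulSign_comm]

theorem indOp_indOp (x y : 𝔤) (f : ind P 𝔥 H π) (u : SuperEnv 𝔤) (p : G) :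
    (indOp P 𝔥 H π x (indOp P 𝔥 H π y f)).1 u p =
      f.1 (SuperEnv.ι (P.Ad p⁻¹ y) * SuperEnv.ι (P.Ad p⁻¹ x) * u) p := by
  rw [indOp_apply, indOp_apply, neg_neg, mul_assoc]

/-- The operator `f ↦ ((u, p) ↦ -(-1)^{|f||x|}f(Ad(p⁻¹)(x)u)(p))`. -/
def indAlg : 𝔤 →ₗ[ℂ] ind P 𝔥 H π →ₗ[ℂ] ind P 𝔥 H π :=
  (indOp P 𝔥 H π) ∘ₗ proj 0 + ((indOp P 𝔥 H π).compl₂ (indParity P 𝔥 H π)) ∘ₗ proj 1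

theorem indAlg_of_mem {i : ZMod 2} {x : 𝔤} (hx : x ∈ part 𝔤 i) (f : ind P 𝔥 H π) :
    indAlg P 𝔥 H π x f = indOp P 𝔥 H π x (indTwist P 𝔥 H π i f) := by
  simp only [indAlg, LinearMap.add_apply, LinearMap.comp_apply, LinearMap.compl₂_apply,
    proj_of_mem hx]
  rcases parity_cases i with rfl | rfl <;> simp [twist]

theorem indAlg_apply (x : 𝔤) (f : ind P 𝔥 H π) :
    indAlg P 𝔥 H π x f = indOp P 𝔥 H π (proj 0 x) f + indOp P 𝔥 H π (proj 1 x)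
      (indParity P 𝔥 H π f) := rfl

/-- The action of `(𝔤, G₀)` on the induced representation. -/
def indRep : SuperRep 𝔤 G (ind P 𝔥 H π) where
  grp :=
    { toFun := indGrp P 𝔥 H π
      map_one' := by
        ext f u p
        simp [indGrp_apply]
      map_mul' := fun g h => by
        ext f u p
        simp [indGrp_apply, mul_assoc] }
  alg := indAlg P 𝔥 H π
  parity_grp _ _ := rfl
  parity_alg x f := by
    rw [indAlg_apply, indAlg_apply, map_add, parity_indOp, parity_indOp, proj_parity, proj_parity]
  alg_br i j x hx y hy f := by
    rw [indAlg_of_mem _ _ _ _ (br_mem_part hx hy), indAlg_of_mem _ _ _ _ hy,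
      indAlg_of_mem _ _ _ _ hx, indAlg_of_mem _ _ _ _ hx, indAlg_of_mem _ _ _ _ hy,
      twist_indOp _ _ _ _ _ hy, twist_indOp _ _ _ _ _ hx, twist_twist, twist_twist, add_comm j i,
      koszulSign_comm j i, map_smul, map_smul, smul_smul, koszulSign_mul_self, one_smul]
    -- `indOp` reverses products (see `indOp_indOp`). The sign from moving the twists past it turns
    -- this reversal into the super commutator in the right order.
    ext u p
    have h1 := SuperEnv.ι_mul_ι ((P.Ad p⁻¹).map_part hx) ((P.Ad p⁻¹).map_part hy)
    rw [← (P.Ad p⁻¹).map_br] at h1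
    have h2 := eq_sub_of_add_eq h1.symm
    change (indOp P 𝔥 H π (br x y) (indTwist P 𝔥 H π (i + j) f)).1 u p = koszulSign i j •
      (indOp P 𝔥 H π x (indOp P 𝔥 H π y (indTwist P 𝔥 H π (i + j) f))).1 u p -
      (indOp P 𝔥 H π y (indOp P 𝔥 H π x (indTwist P 𝔥 H π (i + j) f))).1 u p
    rw [indOp_indOp, indOp_indOp, indOp_apply, h2]
    simp only [sub_mul, map_sub, Pi.sub_apply, smul_mul_assoc, map_smul, Pi.smul_apply]
    abel

theorem isInducedAction_indRep : IsInducedAction P 𝔥 H π (indRep P 𝔥 H π) where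
  grp _ _ _ _ := rfl
  alg i x hx f u p := by
    change (indAlg P 𝔥 H π x f).1 u p = _
    rw [indAlg_of_mem _ _ _ _ hx, indOp_apply]

theorem continuous_indOp :
    Continuous fun q : 𝔤 × ind P 𝔥 H π => indOp P 𝔥 H π q.1 q.2 := by
  have : IsTopologicalGroup G := topologicalGroup_of_lieGroup 𝓘(ℝ, E) ∞
  refine continuous_ind_iff.2 fun u => Continuous.neg ?_
  refine continuous_linear_apply (X := 𝔤)
    (F := fun q : (𝔤 × ind P 𝔥 H π) × G => (LinearMap.proj q.2 : (G → W) →ₗ[ℂ] W) ∘ₗ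
      q.1.2.1 ∘ₗ (LinearMap.mulRight ℂ u) ∘ₗ SuperEnv.ι) (fun z => ?_) ?_
  · exact (continuous_ind_eval _).comp ((continuous_snd.comp continuous_fst).prodMk continuous_snd)
  · exact P.continuous_Ad.comp (continuous_snd.inv.prodMk (continuous_fst.comp continuous_fst))

theorem isSmoothRep_indRep : P.IsSmoothRep (indRep P 𝔥 H π) := by
  have : IsTopologicalGroup G := topologicalGroup_of_lieGroup 𝓘(ℝ, E) ∞
  refine CsSupergroupPair.isSmoothRep_of_hasVelocity ?_ ?_ ?_ ?_
  · refine continuous_ind_iff.2 fun u => ?_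
    exact (continuous_ind_eval u).comp ((continuous_snd.comp continuous_fst).prodMk
      ((continuous_fst.comp continuous_fst).inv.mul continuous_snd))
  · have h0 : ∀ i : ZMod 2, Continuous (proj i : 𝔤 →ₗ[ℂ] 𝔤) := fun i =>
      LinearMap.continuous_of_finiteDimensional _
    have hp : Continuous (indParity P 𝔥 H π) := (lcSuperSpace_ind P 𝔥 H π).continuous_parity
    refine continuous_ind_iff.2 fun u => Continuous.add
      (continuous_ind_iff.1 ((continuous_indOp P 𝔥 H π).comp ((h0 0).prodMap continuous_id)) u)
      (continuous_ind_iff.1 ((continuous_indOp P 𝔥 H π).comp ((h0 1).prodMap hp)) u)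
  · intro c y hc f
    refine tendsto_ind_iff.2 fun u p => ?_
    have e0 : (indRep P 𝔥 H π).alg (P.emb y) f = indOp P 𝔥 H π (P.emb y) f := by
      change indAlg P 𝔥 H π (P.emb y) f = _
      rw [indAlg_of_mem _ _ _ _ (P.emb_even y), twist_zero]
    rw [e0, indOp_apply]
    -- The left difference quotients converge locally uniformly in the base point, hence in the
    -- topology of the induced space. It remains to identify the limit v.
    obtain ⟨v, hv⟩ := (f.2.1.1 u).exists_tendsto p (-y : E)
    have h1 := hv _ hc.inv
    have h2 : HasVelocity (fun t => f.1 u ((c t)⁻¹ * p)) v := by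
      refine (h1.comp (tendsto_id.prodMk (tendsto_const_nhds (x := p)))).congr fun t => ?_
      simp [hc.zero]
    -- Left translation by c(t)⁻¹ at p is right translation by the conjugate p⁻¹c(t)⁻¹p, whose
    -- velocity is -Ad(p⁻¹)y.
    obtain ⟨y', hy', hy''⟩ := P.exists_isCurve_conj (y := -y) hc.inv p⁻¹
    have h3 := (mem_superfunctions_iff.1 f.2.1).2 y' _ hy' u p
    rw [hy''] at h3
    simp only [inv_inv, mul_assoc, mul_inv_cancel_left] at h3
    have h4 := h2.unique h3
    set L : 𝔤 →ₗ[ℂ] W := LinearMap.proj p ∘ₗ f.1 ∘ₗ (LinearMap.mulRight ℂ u) ∘ₗ SuperEnv.ι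
    have h5 : L (P.Ad p⁻¹ (P.emb (-y))) = -L (P.Ad p⁻¹ (P.emb y)) := by
      simp only [map_neg]
    have h6 : v = -f.1 (SuperEnv.ι (P.Ad p⁻¹ (P.emb y)) * u) p := h4.trans h5
    rw [← h6]
    refine h1.congr fun q => ?_
    change _ = q.1⁻¹ • (f.1 u ((c q.1)⁻¹ * q.2) - f.1 u ((c 0)⁻¹ * q.2))
    rw [hc.zero, inv_one, one_mul]
  · intro g x f
    have h1 : ∀ (x : 𝔤) f, indOp P 𝔥 H π (P.Ad g x) f =
        indGrp P 𝔥 H π g (indOp P 𝔥 H π x (indGrp P 𝔥 H π g⁻¹ f)) := by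
      intro x f
      ext u p
      rw [indOp_apply, indGrp_apply, indOp_apply, indGrp_apply, inv_inv, mul_inv_cancel_left,
        mul_inv_rev, inv_inv, P.Ad_mul]
    change indAlg P 𝔥 H π (P.Ad g x) f =
      indGrp P 𝔥 H π g (indAlg P 𝔥 H π x (indGrp P 𝔥 H π g⁻¹ f))
    rw [indAlg_apply, indAlg_apply, ← LieSuperHom.map_proj, ← LieSuperHom.map_proj, h1, h1, map_add]
    rfl

end IndRep

end Pairs

/-! ### Operators which generate bounded groups -/

section Bounded

variable {X : Type*} [NormedAddCommGroup X] [NormedSpace ℂ X] [FiniteDimensional ℂ X]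

/-- Applying exp(-zT) to the right-hand side gives a function of z with zero derivative and value v
at z = 0. -/
theorem exp_smul_apply (T : X →L[ℂ] X) {μ : ℂ} {v w : X} (hv : T v = μ • v + w) (hw : T w = μ • w)
    (z : ℂ) : NormedSpace.exp (z • T) v = Complex.exp (z * μ) • (v + z • w) := by
  have : CompleteSpace X := FiniteDimensional.complete ℂ X
  have hd : ∀ z : ℂ, HasDerivAt (fun z : ℂ => NormedSpace.exp (z • -T)
      (Complex.exp (z * μ) • (v + z • w))) 0 z := by
    intro z
    have h1 := hasDerivAt_exp_smul_const (𝕂 := ℂ) (-T) z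
    have h2 : HasDerivAt (fun z : ℂ => Complex.exp (z * μ)) (Complex.exp (z * μ) * (1 * μ)) z :=
      ((hasDerivAt_id z).mul_const μ).cexp
    have h3 : HasDerivAt (fun z : ℂ => v + z • w) ((1 : ℂ) • w) z :=
      ((hasDerivAt_id z).smul_const w).const_add v
    have h4 := h1.clm_apply (h2.smul h3)
    refine h4.congr_deriv ?_
    change NormedSpace.exp (z • -T) (-(T (Complex.exp (z * μ) • (v + z • w)))) +
      NormedSpace.exp (z • -T) (Complex.exp (z * μ) • ((1 : ℂ) • w) +
        (Complex.exp (z * μ) * (1 * μ)) • (v + z • w)) = 0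
    rw [← map_add]
    convert map_zero (NormedSpace.exp (z • -T)) using 2
    rw [map_smul, map_add, map_smul, hv, hw]
    module
  have hc : ∀ z : ℂ, NormedSpace.exp (z • -T) (Complex.exp (z * μ) • (v + z • w)) = v := by
    intro z
    have := is_const_of_deriv_eq_zero (fun z => (hd z).differentiableAt) (fun z => (hd z).deriv) z 0
    simpa using this
  have h1 : NormedSpace.exp (z • T) * NormedSpace.exp (z • -T) = 1 := by
    let : NormedAlgebra ℚ (X →L[ℂ] X) := NormedAlgebra.restrictScalars ℚ ℂ _
    rw [smul_neg, ← NormedSpace.exp_add_of_commute (Commute.neg_right (Commute.refl _)),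
      add_neg_cancel, NormedSpace.exp_zero]
  have h2 := congr_arg (fun y => NormedSpace.exp (z • T) y) (hc z)
  rw [← h2]
  exact DFunLike.congr_fun h1 (Complex.exp (z * μ) • (v + z • w))

/-- If `exp(itT)` is bounded for real `t`, then `T` has no non-trivial Jordan blocks. -/
theorem eq_smul_of_bounded (T : X →L[ℂ] X) {C : ℝ}
    (hC : ∀ t : ℝ, ‖NormedSpace.exp (((t : ℂ) * Complex.I) • T)‖ ≤ C) {μ : ℂ} {v : X}
    (h : T (T v - μ • v) = μ • (T v - μ • v)) : T v = μ • v := by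
  by_contra hne
  set w := T v - μ • v with hw
  have hw0 : w ≠ 0 := sub_ne_zero.2 hne
  have hwn : 0 < ‖w‖ := norm_pos_iff.2 hw0
  have e1 : ∀ t : ℝ, ‖Complex.exp ((t : ℂ) * Complex.I * μ)‖ ≤ C := by
    intro t
    have h1 := exp_smul_apply T (v := w) (w := 0) (by rw [h, add_zero]) (by simp)
      ((t : ℂ) * Complex.I)
    rw [smul_zero, add_zero] at h1
    have h2 := (ContinuousLinearMap.le_opNorm _ w).trans
      (mul_le_mul_of_nonneg_right (hC t) (norm_nonneg w))
    rw [h1, norm_smul] at h2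
    exact le_of_mul_le_mul_right h2 hwn
  have hC0 : 0 ≤ C := (norm_nonneg _).trans (hC 0)
  -- The scalar exponential in exp(itT)v is removed by multiplying with its inverse, which e1 bounds
  -- at -t.
  have e2 : ∀ t : ℝ, ‖v + ((t : ℂ) * Complex.I) • w‖ ≤ C * (C * ‖v‖) := by
    intro t
    have h1 := exp_smul_apply T (v := v) (w := w) (by rw [hw]; abel) h ((t : ℂ) * Complex.I)
    have h2 := (ContinuousLinearMap.le_opNorm _ v).trans
      (mul_le_mul_of_nonneg_right (hC t) (norm_nonneg v))
    rw [h1] at h2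
    have h3 : v + ((t : ℂ) * Complex.I) • w = Complex.exp (((-t : ℝ) : ℂ) * Complex.I * μ) •
        (Complex.exp ((t : ℂ) * Complex.I * μ) • (v + ((t : ℂ) * Complex.I) • w)) := by
      rw [smul_smul, ← Complex.exp_add]
      have : ((-t : ℝ) : ℂ) * Complex.I * μ + (t : ℂ) * Complex.I * μ = 0 := by
        push_cast
        ring
      rw [this, Complex.exp_zero, one_smul]
    rw [h3, norm_smul]
    exact mul_le_mul (e1 _) h2 (norm_nonneg _) hC0
  -- Chosen so that ‖itw‖ exceeds the bound of e2 plus ‖v‖ by 1.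
  set t : ℝ := (C * (C * ‖v‖) + ‖v‖ + 1) / ‖w‖ with ht
  have ht0 : 0 ≤ t := by positivity
  have h5 : ‖((t : ℂ) * Complex.I) • w‖ = C * (C * ‖v‖) + ‖v‖ + 1 := by
    rw [norm_smul, norm_mul, Complex.norm_I, mul_one, Complex.norm_real, Real.norm_of_nonneg ht0,
      ht, div_mul_cancel₀ _ hwn.ne']
  have h6 := norm_sub_le (v + ((t : ℂ) * Complex.I) • w) v
  rw [add_sub_cancel_left, h5] at h6
  linarith [e2 t]

/-- Jordan chains are shortened one step at a time: by induction (T - μ)²v = 0, and chains of length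
two are excluded by `eq_smul_of_bounded`. -/
theorem maxGenEigenspace_le_eigenspace (T : X →L[ℂ] X) {C : ℝ}
    (hC : ∀ t : ℝ, ‖NormedSpace.exp (((t : ℂ) * Complex.I) • T)‖ ≤ C) {μ : ℂ} {v : X}
    (hv : v ∈ Module.End.maxGenEigenspace (T : X →ₗ[ℂ] X) μ) : T v = μ • v := by
  obtain ⟨k, hk⟩ := (Module.End.mem_maxGenEigenspace _ _ _).1 hv
  clear hv
  set D : Module.End ℂ X := (T : X →ₗ[ℂ] X) - μ • 1 with hD
  have hDa : ∀ x, D x = T x - μ • x := fun x => by simp [hD]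
  have key : ∀ k : ℕ, ∀ v, (D ^ k) v = 0 → D v = 0 := by
    intro k
    induction k with
    | zero =>
      intro v hv
      have : v = 0 := by simpa using hv
      rw [this, map_zero]
    | succ k ih =>
      intro v hv
      rw [pow_succ, Module.End.mul_apply] at hv
      have h1 := ih _ hv
      rw [hDa (D v), hDa v, sub_eq_zero] at h1
      rw [hDa, sub_eq_zero]
      exact eq_smul_of_bounded T hC h1
  have := key k v hk
  rwa [hDa, sub_eq_zero] at this

end Bounded

/-! ### The algebraic Iwasawa decomposition -/

section RootDecomposition

variable {𝔤 : Type*} [NormedAddCommGroup 𝔤] [NormedSpace ℂ 𝔤] [FiniteDimensional ℂ 𝔤]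
  [LieSuperalgebra 𝔤]
  {E : Type*} [NormedAddCommGroup E] [NormedSpace ℝ E] [FiniteDimensional ℝ E]
  {G : Type*} [Group G] [TopologicalSpace G] [ChartedSpace E G] [LieGroup 𝓘(ℝ, E) ∞ G]
  {P : CsSupergroupPair 𝔤 E G} {θ : LieSuperHom 𝔤 𝔤}

theorem mem_antifixed {x : 𝔤} : x ∈ antifixed θ ↔ θ x = -x := by
  rw [antifixed, LinearMap.mem_ker, LinearMap.add_apply, LinearMap.id_apply,
    add_eq_zero_iff_eq_neg]

theorem mem_fixed {x : 𝔤} : x ∈ (LieSubsuperalgebra.fixed θ).toSubmodule ↔ θ x = x := Iff.rfl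

/-- For h ∈ 𝔭_{0,ℝ} the element ith belongs to 𝔲₀, so its exponential lies in the compact group
generated by ad(𝔲₀). -/
theorem exists_bound_exp (hform : P.IsNoncompactForm θ) {h : GroupLieAlgebra 𝓘(ℝ, E) G}
    (hh : P.emb h ∈ antifixed θ) : ∃ C : ℝ, ∀ t : ℝ, ‖NormedSpace.exp (((t : ℂ) * Complex.I) •
      LinearMap.toContinuousLinearMap (br (P.emb h)))‖ ≤ C := by
  obtain ⟨C, hC⟩ := hform.compact.isBounded.exists_norm_le
  refine ⟨C, fun t => hC _ (Submonoid.subset_closure ⟨Complex.I • P.emb (t • h), ?_, ?_⟩)⟩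
  · refine Submodule.mem_sup_right (Submodule.mem_map.2 ⟨P.emb (t • h), ?_, rfl⟩)
    refine Submodule.mem_map.2 ⟨t • h, ?_, rfl⟩
    change P.emb (t • h) ∈ antifixed θ
    rw [map_smul, ← Complex.coe_smul]
    exact Submodule.smul_mem _ _ hh
  · congr 1
    ext x
    simp only [map_smul, ← Complex.coe_smul, smul_apply, LinearMap.coe_toContinuousLinearMap']
    rw [smul_smul, mul_comm]

/-- The operators ad h, h ∈ 𝔞_ℝ, commute, so 𝔤 is the sum of their joint generalised eigenspaces,
and boundedness makes these honest eigenspaces. The semi-simplicity required of an even Cartan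
subspace would only cover 𝔤₀. -/
theorem iSup_rootSpace_eq_top (hform : P.IsNoncompactForm θ)
    {aR : Submodule ℝ (GroupLieAlgebra 𝓘(ℝ, E) G)} (h𝔞 : IsEvenCartan θ (P.complexify aR)) :
    ⨆ l, rootSpace (P.complexify aR) l = ⊤ := by
  set 𝔞 := P.complexify aR with h𝔞'
  have hmem : ∀ h : aR, P.emb h ∈ 𝔞 := fun h => Submodule.subset_span ⟨h, h.2, rfl⟩
  have h1 := Module.End.iSup_iInf_maxGenEigenspace_eq_top_of_iSup_maxGenEigenspace_eq_top_of_commute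
    (K := ℂ) (M := 𝔤) (fun h : aR => br (P.emb h)) (fun h h' _ => by
      refine LinearMap.ext fun x => ?_
      have := br_even_derivation (h𝔞.le_even (hmem h)) (P.emb h') x
      rw [h𝔞.abelian _ (hmem h) _ (hmem h'), map_zero, LinearMap.zero_apply, zero_add] at this
      exact this) (fun h => Module.End.iSup_maxGenEigenspace_eq_top _)
  rw [eq_top_iff, ← h1]
  refine iSup_le fun χ x hx => ?_
  by_cases hx0 : x = 0
  · rw [hx0]
    exact Submodule.zero_mem _
  have h2 : ∀ h : aR, br (P.emb h) x = χ h • x := by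
    intro h
    obtain ⟨C, hC⟩ := exists_bound_exp hform (h𝔞.le_antifixed (hmem h))
    exact maxGenEigenspace_le_eigenspace _ hC ((Submodule.mem_iInf _).1 hx h)
  -- Passage from 𝔞_ℝ to its complex span. As x ≠ 0, the eigenvalue is unique and therefore linear
  -- in h.
  have h3 : ∀ h ∈ 𝔞, ∃ c : ℂ, br h x = c • x := by
    intro h hh
    induction hh using Submodule.span_induction with
    | mem h hh =>
      obtain ⟨h', hh', rfl⟩ := hh
      exact ⟨_, h2 ⟨h', hh'⟩⟩
    | zero => exact ⟨0, by simp⟩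
    | add h h' _ _ e e' =>
      obtain ⟨c, hc⟩ := e
      obtain ⟨c', hc'⟩ := e'
      exact ⟨c + c', by rw [map_add, LinearMap.add_apply, hc, hc', add_smul]⟩
    | smul r h _ e =>
      obtain ⟨c, hc⟩ := e
      exact ⟨r * c, by rw [map_smul, LinearMap.smul_apply, hc, mul_smul]⟩
  choose c hc using h3
  have inj : ∀ a b : ℂ, a • x = b • x → a = b := fun a b h => smul_left_injective ℂ hx0 h
  let l : Module.Dual ℂ 𝔞 :=
    { toFun := fun h => c h h.2
      map_add' := fun h h' => inj _ _ (by
        rw [add_smul, ← hc, ← hc, ← hc, Submodule.coe_add, map_add, LinearMap.add_apply])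
      map_smul' := fun r h => inj _ _ (by
        rw [RingHom.id_apply, smul_eq_mul, mul_smul, ← hc, ← hc, Submodule.coe_smul, map_smul,
          LinearMap.smul_apply]) }
  exact Submodule.mem_iSup_of_mem l (fun h => hc h h.2)

theorem iSupIndep_rootSpace {𝔞 : Submodule ℂ 𝔤} (h𝔞 : IsEvenCartan θ 𝔞) :
    iSupIndep fun l => rootSpace 𝔞 l := by
  have h1 := Module.End.independent_iInf_maxGenEigenspace_of_forall_mapsTo
    (fun h : 𝔞 => (br (h : 𝔤) : Module.End ℂ 𝔤)) (fun i j φ =>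
      Module.End.mapsTo_maxGenEigenspace_of_comm (LinearMap.ext fun x => by
        have := br_even_derivation (h𝔞.le_even j.2) (i : 𝔤) x
        rw [h𝔞.abelian _ j.2 _ i.2, map_zero, LinearMap.zero_apply, zero_add] at this
        exact this) φ)
  have h2 := h1.comp (f := fun l : Module.Dual ℂ 𝔞 => (l : 𝔞 → ℂ)) DFunLike.coe_injective
  have h3 : ∀ l : Module.Dual ℂ 𝔞, rootSpace 𝔞 l ≤ ⨅ h : 𝔞,
      Module.End.maxGenEigenspace (br (h : 𝔤) : Module.End ℂ 𝔤) (l h) := by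
    intro l x hx
    refine (Submodule.mem_iInf _).2 fun h => (Module.End.mem_maxGenEigenspace _ _ _).2 ⟨1, ?_⟩
    rw [pow_one, LinearMap.sub_apply, hx h]
    exact sub_self _
  exact iSupIndep.mono h2 h3

theorem theta_mem_rootSpace {𝔞 : Submodule ℂ 𝔤} (h𝔞 : IsEvenCartan θ 𝔞)
    {l : Module.Dual ℂ 𝔞} {x : 𝔤} (hx : x ∈ rootSpace 𝔞 l) : θ x ∈ rootSpace 𝔞 (-l) := by
  intro h
  have h1 := congr_arg θ.toLin (hx h)
  rw [θ.map_br, mem_antifixed.1 (h𝔞.le_antifixed h.2), map_neg, LinearMap.neg_apply, map_smul] at h1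
  rw [LinearMap.neg_apply, neg_smul, ← h1, neg_neg]

variable {𝔞 : Submodule ℂ 𝔤}

theorem cartan_le_rootSpace_zero (h𝔞 : IsEvenCartan θ 𝔞) : 𝔞 ≤ rootSpace 𝔞 0 := by
  intro a ha h
  rw [h𝔞.abelian _ h.2 _ ha]
  simp

theorem disjoint_rootSpace (h𝔞 : IsEvenCartan θ 𝔞) {s t : Set (Module.Dual ℂ 𝔞)}
    (hst : Disjoint s t) : Disjoint (⨆ l ∈ s, rootSpace 𝔞 l) (⨆ l ∈ t, rootSpace 𝔞 l) :=
  (iSupIndep_rootSpace h𝔞).disjoint_biSup_biSup hst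

/-- The centraliser of `𝔞` in `𝔭` is `𝔞`. -/
theorem mem_cartan_of_antifixed (h𝔞 : IsEvenCartan θ 𝔞) (htop : ⨆ l, rootSpace 𝔞 l = ⊤) {x : 𝔤}
    (hx : x ∈ rootSpace 𝔞 0) (hx' : x ∈ antifixed θ) : x ∈ 𝔞 := by
  rw [h𝔞.antifixed_eq] at hx'
  obtain ⟨a, ha, y, hy, rfl⟩ := Submodule.mem_sup.1 hx'
  -- Bracketing with 𝔞 kills 𝔤⁰ and preserves the other root spaces, so [𝔨, 𝔞] has no component in
  -- 𝔤⁰.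
  have hy' : Submodule.map₂ br (LieSubsuperalgebra.fixed θ).toSubmodule 𝔞 ≤
      ⨆ l ∈ {l : Module.Dual ℂ 𝔞 | l ≠ 0}, rootSpace 𝔞 l := by
    refine Submodule.map₂_le.2 fun k _ h hh => ?_
    have hk : k ∈ ⨆ l, rootSpace 𝔞 l := htop ▸ Submodule.mem_top
    rw [br_even_skew (h𝔞.le_even hh), Submodule.neg_mem_iff]
    refine Submodule.iSup_induction _ (motive := fun k => br h k ∈
      ⨆ l ∈ {l : Module.Dual ℂ 𝔞 | l ≠ 0}, rootSpace 𝔞 l) hk ?_ ?_ ?_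
    · intro l k hk
      rw [hk ⟨h, hh⟩]
      by_cases hl : l = 0
      · simp [hl]
      · exact Submodule.smul_mem _ _ (Submodule.mem_iSup_of_mem l (Submodule.mem_iSup_of_mem hl hk))
    · simp
    · intro k k' hk hk'
      rw [map_add]
      exact Submodule.add_mem _ hk hk'
  have hd := disjoint_rootSpace h𝔞 (s := {0}) (t := {l | l ≠ 0}) (by simp)
  have h0 : y ∈ rootSpace 𝔞 0 := by
    have := Submodule.sub_mem _ hx (cartan_le_rootSpace_zero h𝔞 ha)
    rwa [add_sub_cancel_left] at this
  have : y = 0 := by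
    refine Submodule.disjoint_def.1 hd y ?_ (hy' hy)
    simpa using h0
  rw [this, add_zero]
  exact ha

/-- 𝔤⁰ is θ-stable, and its θ-antifixed part lies in 𝔞 by `mem_cartan_of_antifixed`. -/
theorem exists_mem_fixed_add_cartan (hθ : ∀ x, θ (θ x) = x) (h𝔞 : IsEvenCartan θ 𝔞)
    (htop : ⨆ l, rootSpace 𝔞 l = ⊤) {x : 𝔤} (hx : x ∈ rootSpace 𝔞 0) :
    x ∈ (LieSubsuperalgebra.fixed θ).toSubmodule ⊔ 𝔞 := by
  have h1 : θ x ∈ rootSpace 𝔞 0 := by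
    have := theta_mem_rootSpace h𝔞 hx
    rwa [neg_zero] at this
  have e : x = (2⁻¹ : ℂ) • (x + θ x) + (2⁻¹ : ℂ) • (x - θ x) := by module
  rw [e]
  refine Submodule.add_mem_sup (Submodule.smul_mem _ _ ?_) (Submodule.smul_mem _ _ ?_)
  · rw [mem_fixed, map_add, hθ, add_comm]
  · refine mem_cartan_of_antifixed h𝔞 htop (Submodule.sub_mem _ hx h1) ?_
    rw [mem_antifixed, map_sub, hθ, neg_sub]

variable {S : Set (Module.Dual ℂ 𝔞)}

/-- The subalgebra `𝔞 ⊕ 𝔫`. -/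
def cartanPositive (h𝔞 : IsEvenCartan θ 𝔞) (hS : IsPositiveSystem 𝔞 S) : LieSubsuperalgebra 𝔤 where
  toSubmodule := 𝔞 ⊔ positivePart 𝔞 S
  parity_mem x hx := by
    obtain ⟨a, ha, n, hn, rfl⟩ := Submodule.mem_sup.1 hx
    have h1 : parity a = a := by simpa [mem_part, koszulSign] using h𝔞.le_even ha
    rw [map_add, h1]
    exact Submodule.add_mem_sup ha (parity_mem_positivePart h𝔞 hn)
  br_mem x hx y hy := by
    obtain ⟨a, ha, n, hn, rfl⟩ := Submodule.mem_sup.1 hx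
    obtain ⟨a', ha', n', hn', rfl⟩ := Submodule.mem_sup.1 hy
    have e : br (a + n) (a' + n') = br n a' + (br a n' + br n n') := by
      simp only [map_add, LinearMap.add_apply, h𝔞.abelian a ha a' ha', zero_add]
    rw [e]
    exact Submodule.mem_sup_right (Submodule.add_mem _
      (br_mem_positivePart_right h𝔞 hn (cartan_le_rootSpace_zero h𝔞 ha'))
      (Submodule.add_mem _ (br_mem_positivePart_left h𝔞 (cartan_le_rootSpace_zero h𝔞 ha) hn')
        (br_mem_positivePart h𝔞 hS hn hn')))

theorem cartanPositive_le (h𝔞 : IsEvenCartan θ 𝔞) (hS : IsPositiveSystem 𝔞 S) :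
    (cartanPositive h𝔞 hS).toSubmodule ≤ (minimalParabolic h𝔞 hS).toSubmodule := by
  refine sup_le ?_ le_sup_right
  exact le_sup_of_le_left le_sup_right

/-- The Iwasawa decomposition `𝔤 = 𝔨 ⊕ (𝔞 ⊕ 𝔫)`. -/
theorem isCompl_fixed_cartanPositive (hθ : ∀ x, θ (θ x) = x) (h𝔞 : IsEvenCartan θ 𝔞)
    (hS : IsPositiveSystem 𝔞 S) (htop : ⨆ l, rootSpace 𝔞 l = ⊤) :
    IsCompl (LieSubsuperalgebra.fixed θ).toSubmodule (cartanPositive h𝔞 hS).toSubmodule := by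
  have hpos : ∀ l ∈ S, rootSpace 𝔞 l ≤ positivePart 𝔞 S := fun l hl x hx =>
    Submodule.mem_iSup_of_mem l (Submodule.mem_iSup_of_mem hl hx)
  constructor
  · rw [Submodule.disjoint_def]
    intro x hx hx'
    obtain ⟨a, ha, n, hn, rfl⟩ := Submodule.mem_sup.1 hx'
    rw [mem_fixed, map_add, mem_antifixed.1 (h𝔞.le_antifixed ha)] at hx
    have hθn : positivePart 𝔞 S ≤ (⨆ l ∈ {l | -l ∈ S}, rootSpace 𝔞 l).comap θ.toLin := by
      refine iSup₂_le fun l hl y hy => ?_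
      exact Submodule.mem_iSup_of_mem (-l) (Submodule.mem_iSup_of_mem
        (show - -l ∈ S by rwa [neg_neg]) (theta_mem_rootSpace h𝔞 hy))
    have hn' : θ n ∈ ⨆ l ∈ {l | -l ∈ S}, rootSpace 𝔞 l := hθn hn
    have hne : ∀ l ∈ S, l ≠ 0 := by
      rintro l hl rfl
      exact hS.disjoint 0 hl (by rwa [neg_zero])
    have hle1 : positivePart 𝔞 S ≤ ⨆ l ∈ {l : Module.Dual ℂ 𝔞 | l ≠ 0}, rootSpace 𝔞 l :=
      biSup_mono fun l hl => hne l hl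
    have hle2 : (⨆ l ∈ {l | -l ∈ S}, rootSpace 𝔞 l) ≤
        ⨆ l ∈ {l : Module.Dual ℂ 𝔞 | l ≠ 0}, rootSpace 𝔞 l :=
      biSup_mono fun l hl h0 => hne _ hl (by rw [h0, neg_zero])
    -- If θ fixes a + n, then 2a = θn - n, where the left side has weight 0 and the right side only
    -- non-zero weights. What remains is n = θn, in the intersection of the positive and negative
    -- parts.
    have ha0 : a = 0 := by
      have e : (2 : ℂ) • a = θ n - n := by
        have h2 : θ n = a + n + a := by
          rw [← hx]
          abel
        rw [h2]
        module
      have h3 := disjoint_rootSpace h𝔞 (s := {0}) (t := {l | l ≠ 0}) (by simp)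
      have h4 : (2 : ℂ) • a = 0 := by
        refine Submodule.disjoint_def.1 h3 _ ?_ ?_
        · simpa using Submodule.smul_mem _ (2 : ℂ) (cartan_le_rootSpace_zero h𝔞 ha)
        · rw [e]
          exact Submodule.sub_mem _ (hle2 hn') (hle1 hn)
      simpa using h4
    subst ha0
    rw [neg_zero, zero_add, zero_add] at hx
    rw [zero_add]
    have h5 := disjoint_rootSpace h𝔞 (s := S) (t := {l | -l ∈ S})
      (Set.disjoint_left.2 fun l hl hl' => hS.disjoint l hl hl')
    exact Submodule.disjoint_def.1 h5 n hn (hx ▸ hn')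
  · rw [codisjoint_iff, eq_top_iff, ← htop]
    refine iSup_le fun l x hx => ?_
    by_cases hl : l = 0
    · subst hl
      have := exists_mem_fixed_add_cartan hθ h𝔞 htop hx
      exact sup_le_sup (le_refl (LieSubsuperalgebra.fixed θ).toSubmodule) le_sup_left this
    by_cases hx0 : x = 0
    · rw [hx0]
      exact Submodule.zero_mem _
    have hr : l ∈ restrictedRoots 𝔞 := ⟨hl, fun hb => hx0 (by rwa [hb, Submodule.mem_bot] at hx)⟩
    rw [hS.union] at hr
    rcases hr with hr | hr
    · exact Submodule.mem_sup_right (Submodule.mem_sup_right (hpos l hr hx))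
    -- For a negative root the first term is θ-fixed and θx is a positive root vector.
    · have e : x = (x + θ x) + -θ x := by abel
      rw [e]
      refine Submodule.add_mem_sup ?_ (Submodule.mem_sup_right (Submodule.neg_mem _
        (hpos _ hr (theta_mem_rootSpace h𝔞 hx))))
      rw [mem_fixed, map_add, hθ, add_comm]

end RootDecomposition

/-! ### The right action of a representation -/

namespace SuperRep

variable {𝔤 : Type*} [AddCommGroup 𝔤] [Module ℂ 𝔤] [LieSuperalgebra 𝔤] {G : Type*} [Group G]
  {V : Type*} [AddCommGroup V] [Module ℂ V] [SuperModule V] (π : SuperRep 𝔤 G V)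

/-- The map `v ↦ -(-1)^{|z||v|} π(z) v` for homogeneous `z` and `v`, extended linearly. -/
def rightAct : 𝔤 →ₗ[ℂ] Module.End ℂ V :=
  -(π.alg.comp (proj 0) + (LinearMap.lcomp ℂ V parity).comp (π.alg.comp (proj 1)))

theorem rightAct_apply (z : 𝔤) (v : V) :
    π.rightAct z v = -(π.alg (proj 0 z) v + π.alg (proj 1 z) (parity v)) := rfl

theorem rightAct_of_mem {i : ZMod 2} {z : 𝔤} (hz : z ∈ part 𝔤 i) (v : V) :
    π.rightAct z v = -(π.alg z (twist i v)) := by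
  rw [rightAct_apply, proj_of_mem hz, proj_of_mem hz]
  rcases parity_cases i with rfl | rfl <;> simp [twist_zero, twist_one]

theorem rightAct_even {z : 𝔤} (hz : z ∈ part 𝔤 0) (v : V) : π.rightAct z v = -(π.alg z v) := by
  rw [rightAct_of_mem π hz, twist_zero]

theorem twist_alg (i : ZMod 2) {j : ZMod 2} {z : 𝔤} (hz : z ∈ part 𝔤 j) (v : V) :
    twist i (π.alg z v) = koszulSign i j • π.alg z (twist i v) := by
  rcases parity_cases i with rfl | rfl
  · rw [twist_zero, twist_zero, koszulSign_zero_left, one_smul]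
  · rw [twist_one, twist_one, π.parity_alg, mem_part.1 hz, map_smul, LinearMap.smul_apply,
      koszulSign_comm]

/-- The minus sign reverses the order of products and the twist supplies the Koszul signs. This is
the field `anti` required for the extension to 𝔘(𝔤). -/
theorem rightAct_anti {i j : ZMod 2} {z z' : 𝔤} (hz : z ∈ part 𝔤 i) (hz' : z' ∈ part 𝔤 j) (v : V) :
    π.rightAct z' (π.rightAct z v) =
      π.rightAct (br z z') v + koszulSign i j • π.rightAct z (π.rightAct z' v) := by
  rw [rightAct_of_mem π hz', rightAct_of_mem π hz, rightAct_of_mem π (br_mem_part hz hz'),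
    rightAct_of_mem π hz, rightAct_of_mem π hz', map_neg, map_neg, map_neg, map_neg, twist_alg π j hz,
    twist_alg π i hz', twist_twist, twist_twist, π.alg_br i j z hz z' hz', map_smul, map_smul,
    add_comm j i, koszulSign_comm j i]
  simp only [neg_neg, smul_smul, koszulSign_mul_self]
  module

end SuperRep

section Pair

variable {𝔤 : Type*} [NormedAddCommGroup 𝔤] [NormedSpace ℂ 𝔤] [FiniteDimensional ℂ 𝔤]
  [LieSuperalgebra 𝔤]
  {E : Type*} [NormedAddCommGroup E] [NormedSpace ℝ E] [FiniteDimensional ℝ E]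
  {G : Type*} [Group G] [TopologicalSpace G] [ChartedSpace E G] [LieGroup 𝓘(ℝ, E) ∞ G]
  {V : Type*} [AddCommGroup V] [Module ℂ V] [SuperModule V] [UniformSpace V] [LCSuperSpace V]
  {P : CsSupergroupPair 𝔤 E G} {π : SuperRep 𝔤 G V}

namespace CsSupergroupPair.IsSmoothRep

theorem continuous_rightAct (hπ : P.IsSmoothRep π) (z : 𝔤) : Continuous (π.rightAct z) := by
  have h : ∀ x : 𝔤, Continuous (π.alg x) := fun x =>
    hπ.continuous_alg.comp (continuous_const.prodMk continuous_id)
  exact ((h _).add ((h _).comp LCSuperSpace.continuous_parity)).neg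

theorem continuous_grp_apply (hπ : P.IsSmoothRep π) (g : G) : Continuous (π.grp g) :=
  hπ.continuous_grp.comp (continuous_const.prodMk continuous_id)

theorem rightAct_Ad (hπ : P.IsSmoothRep π) (g : G) (z : 𝔤) (v : V) :
    π.rightAct (P.Ad g z) v = π.grp g (π.rightAct z (π.grp g⁻¹ v)) := by
  rw [SuperRep.rightAct_apply, SuperRep.rightAct_apply, ← LieSuperHom.map_proj,
    ← LieSuperHom.map_proj, hπ.equivariant, hπ.equivariant, ← π.parity_grp, map_neg, map_add]

end CsSupergroupPair.IsSmoothRep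

theorem SuperRep.grp_inv_grp (g : G) (v : V) : π.grp g⁻¹ (π.grp g v) = v := by
  rw [← Module.End.mul_apply, ← map_mul, inv_mul_cancel, map_one, Module.End.one_apply]

theorem SuperRep.grp_grp_inv (g : G) (v : V) : π.grp g (π.grp g⁻¹ v) = v := by
  rw [← Module.End.mul_apply, ← map_mul, mul_inv_cancel, map_one, Module.End.one_apply]

/-! ### The adjoint action on the universal enveloping algebra -/

namespace CsSupergroupPair

variable (P)

theorem map_Ad_one (u : SuperEnv 𝔤) : SuperEnv.map (P.Ad 1) u = u := by
  have : SuperEnv.map (P.Ad 1) = AlgHom.id ℂ (SuperEnv 𝔤) :=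
    SuperEnv.algHom_ext fun x => by simp [P.Ad_one]
  exact DFunLike.congr_fun this u

theorem map_Ad_mul (g h : G) (u : SuperEnv 𝔤) :
    SuperEnv.map (P.Ad (g * h)) u = SuperEnv.map (P.Ad g) (SuperEnv.map (P.Ad h) u) := by
  have : SuperEnv.map (P.Ad (g * h)) = (SuperEnv.map (P.Ad g)).comp (SuperEnv.map (P.Ad h)) :=
    SuperEnv.algHom_ext fun x => by simp [P.Ad_mul]
  exact DFunLike.congr_fun this u

/-- 𝔘(𝔤) carries no topology, so continuity of g ↦ Ad(g)u is expressed through linear maps T out of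
it. The family T is left free in the induction on u: a factor x on the left is absorbed into T. -/
theorem tendsto_map_Ad {α : Type*} {l : Filter α} {g : α → G} {g₀ : G} (hg : Tendsto g l (𝓝 g₀))
    (u : SuperEnv 𝔤) {T : α → SuperEnv 𝔤 →ₗ[ℂ] V} {T₀ : SuperEnv 𝔤 →ₗ[ℂ] V}
    (hT : ∀ w, Tendsto (fun a => T a w) l (𝓝 (T₀ w))) :
    Tendsto (fun a => T a (SuperEnv.map (P.Ad (g a)) u)) l
      (𝓝 (T₀ (SuperEnv.map (P.Ad g₀) u))) := by
  let p : Submodule ℂ (SuperEnv 𝔤) :=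
    { carrier := {u | ∀ (T : α → SuperEnv 𝔤 →ₗ[ℂ] V) (T₀ : SuperEnv 𝔤 →ₗ[ℂ] V),
        (∀ w, Tendsto (fun a => T a w) l (𝓝 (T₀ w))) →
        Tendsto (fun a => T a (SuperEnv.map (P.Ad (g a)) u)) l
          (𝓝 (T₀ (SuperEnv.map (P.Ad g₀) u)))}
      zero_mem' := fun T T₀ _ => by simpa using tendsto_const_nhds
      add_mem' := fun {a b} ha hb T T₀ h => by
        simp only [map_add]
        exact (ha T T₀ h).add (hb T T₀ h)
      smul_mem' := fun c a ha T T₀ h => by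
        simp only [map_smul]
        exact (ha T T₀ h).const_smul c }
  refine SuperEnv.mem_of_left p ?_ ?_ u T T₀ hT
  · intro T T₀ h
    simpa using h 1
  · intro i x _ u hu T T₀ h
    have h1 : Tendsto (fun a => P.Ad (g a) x) l (𝓝 (P.Ad g₀ x)) :=
      (P.continuous_Ad.tendsto (g₀, x)).comp (hg.prodMk_nhds tendsto_const_nhds)
    have := tendsto_linear_apply (F := fun a =>
      (T a).comp ((LinearMap.mulRight ℂ (SuperEnv.map (P.Ad (g a)) u)).comp SuperEnv.ι))
      (F₀ := T₀.comp ((LinearMap.mulRight ℂ (SuperEnv.map (P.Ad g₀) u)).comp SuperEnv.ι))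
      (fun x => hu (fun a => (T a).comp (LinearMap.mulLeft ℂ (SuperEnv.ι x)))
        (T₀.comp (LinearMap.mulLeft ℂ (SuperEnv.ι x))) (fun w => h _)) h1
    simpa using this

/-- Product rule, the derivative of Ad(c(t))u being the commutator yu - uy because y is even. The
induction again keeps T free. -/
theorem hasVelocity_map_Ad {c : ℝ → G} {y : GroupLieAlgebra 𝓘(ℝ, E) G} (hc : IsCurve (E := E) c y)
    (u : SuperEnv 𝔤) {T : ℝ → SuperEnv 𝔤 →ₗ[ℂ] V} {T' : SuperEnv 𝔤 →ₗ[ℂ] V}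
    (hT : ∀ w, HasVelocity (fun t => T t w) (T' w)) :
    HasVelocity (fun t => T t (SuperEnv.map (P.Ad (c t)) u))
      (T' u + T 0 (SuperEnv.ι (P.emb y) * u - u * SuperEnv.ι (P.emb y))) := by
  let p : Submodule ℂ (SuperEnv 𝔤) :=
    { carrier := {u | ∀ (T : ℝ → SuperEnv 𝔤 →ₗ[ℂ] V) (T' : SuperEnv 𝔤 →ₗ[ℂ] V),
        (∀ w, HasVelocity (fun t => T t w) (T' w)) →
        HasVelocity (fun t => T t (SuperEnv.map (P.Ad (c t)) u))
          (T' u + T 0 (SuperEnv.ι (P.emb y) * u - u * SuperEnv.ι (P.emb y)))}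
      zero_mem' := fun T T' _ => by simpa using HasVelocity.zero
      add_mem' := fun {a b} ha hb T T' h => by
        have := (ha T T' h).add (hb T T' h)
        simp only [map_add, mul_add, add_mul, map_sub] at this ⊢
        convert this using 1
        abel
      smul_mem' := fun r a ha T T' h => by
        have := (ha T T' h).map (r • LinearMap.id) (continuous_const_smul r)
        simp only [LinearMap.smul_apply, LinearMap.id_apply] at this
        simp only [map_smul, mul_smul_comm, smul_mul_assoc, ← smul_sub, ← smul_add]
        exact this }
  refine SuperEnv.mem_of_left p ?_ ?_ u T T' hT
  · intro T T' h
    simpa using h 1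
  · intro i x _ u hu T T' h
    have h1 := P.hasDerivAt_Ad hc x
    have h2 : ∀ x, HasVelocity (fun t => T t (SuperEnv.ι x * SuperEnv.map (P.Ad (c t)) u))
        (T' (SuperEnv.ι x * u) + T 0 (SuperEnv.ι x * (SuperEnv.ι (P.emb y) * u -
          u * SuperEnv.ι (P.emb y)))) := fun x =>
      hu (fun a => (T a).comp (LinearMap.mulLeft ℂ (SuperEnv.ι x)))
        (T'.comp (LinearMap.mulLeft ℂ (SuperEnv.ι x))) (fun w => h _)
    have := HasVelocity.linear_apply (F := fun t =>
      (T t).comp ((LinearMap.mulRight ℂ (SuperEnv.map (P.Ad (c t)) u)).comp SuperEnv.ι))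
      (fun x => (h2 x).continuousAt) h1 (h2 _)
    simp only [LinearMap.comp_apply, LinearMap.mulRight_apply] at this
    rw [hc.zero, P.Ad_one, P.map_Ad_one] at this
    simp only [map_mul, SuperEnv.map_ι]
    convert this using 1
    rw [← mul_assoc (SuperEnv.ι (P.emb y)), ι_even_mul_ι (P.emb_even y), add_left_comm, ← map_add]
    congr 2
    simp only [add_mul, mul_sub, mul_assoc]
    abel

end CsSupergroupPair

/-! ### Covariant superfunctions -/

/-- A family of linear maps `F p : 𝔘(𝔤) → V` with `F(yu)(p) = ∂_t|₀ F(u)(p c(t))` for all curves `c`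
with velocity `y`, which is covariant under right multiplication by `𝔮`. -/
structure IsCovariant (P : CsSupergroupPair 𝔤 E G) (π : SuperRep 𝔤 G V) (𝔮 : Submodule ℂ 𝔤)
    (F : G → SuperEnv 𝔤 →ₗ[ℂ] V) : Prop where
  velocity : ∀ (y : GroupLieAlgebra 𝓘(ℝ, E) G) (c : ℝ → G), IsCurve (E := E) c y → ∀ u p,
    HasVelocity (fun t => F (p * c t) u) (F p (SuperEnv.ι (P.emb y) * u))
  right : ∀ z ∈ 𝔮, ∀ u p, F p (u * SuperEnv.ι z) = π.rightAct z (F p u)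

theorem hasVelocity_grp (hπ : P.IsSmoothRep π) {c : ℝ → G} {y : GroupLieAlgebra 𝓘(ℝ, E) G}
    (hc : IsCurve (E := E) c y) {b : ℝ → V} {v : V} (hb : HasVelocity b v) :
    HasVelocity (fun t => π.grp (c t) (b t)) (π.alg (P.emb y) (b 0) + v) := by
  have := HasVelocity.apply hπ.continuous_grp hc.continuousAt (hπ.hasVelocity hc (b 0)) hb
  rwa [hc.zero, map_one] at this

/-- Right covariance under a subalgebra integrates to equivariance under the connected group: the
right-hand side, as a function of h, has velocity zero everywhere. -/
theorem IsCovariant.equivariant (hπ : P.IsSmoothRep π) {𝔮 : Submodule ℂ 𝔤}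
    {F : G → SuperEnv 𝔤 →ₗ[ℂ] V} (hF : IsCovariant P π 𝔮 F)
    {X : Type*} [NormedAddCommGroup X] [NormedSpace ℝ X] [FiniteDimensional ℝ X]
    {H : Type*} [Group H] [TopologicalSpace H] [ChartedSpace X H] [LieGroup 𝓘(ℝ, X) ∞ H]
    [ConnectedSpace H] {φ : H →* G} (hφ : ContMDiff 𝓘(ℝ, X) 𝓘(ℝ, E) ∞ φ)
    (hH : ∀ y : GroupLieAlgebra 𝓘(ℝ, X) H, P.emb (mfderiv 𝓘(ℝ, X) 𝓘(ℝ, E) φ 1 y : E) ∈ 𝔮)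
    (h : H) (u : SuperEnv 𝔤) (p : G) :
    F p u = π.grp (φ h) (F (p * φ h) (SuperEnv.map (P.Ad (φ h)⁻¹) u)) := by
  have key := eq_of_velocity_zero (E := X) (f := fun h : H =>
    π.grp (φ h) (F (p * φ h) (SuperEnv.map (P.Ad (φ h)⁻¹) u))) (fun q c y hc => ?_) 1 h
  · simpa [P.map_Ad_one] using key
  have hc' := hc.comp (g := φ) (map_one φ) (hφ.mdifferentiable (by simp) 1)
  set y' : GroupLieAlgebra 𝓘(ℝ, E) G := mfderiv 𝓘(ℝ, X) 𝓘(ℝ, E) φ 1 y with hy'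
  have hz : P.emb y' ∈ 𝔮 := hH y
  set w := SuperEnv.map (P.Ad (φ q)⁻¹) u with hw
  have h1 := P.hasVelocity_map_Ad (y := -y') hc'.inv w (T := fun t => F (p * φ q * φ (c t)))
    (T' := (F (p * φ q)).comp (LinearMap.mulLeft ℂ (SuperEnv.ι (P.emb y'))))
    (fun w => hF.velocity y' _ hc' w _)
  have h2 := (hasVelocity_grp hπ (y := y') hc' h1).map (π.grp (φ q)) (hπ.continuous_grp_apply _)
  -- The three factors contribute π(y)F(w), F(yw) and -F(yw - wy). The sum π(y)F(w) + F(wy) vanishes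
  -- by right covariance under y ∈ 𝔮.
  have e : π.grp (φ q) (π.alg (P.emb y') (F (p * φ q * φ (c 0))
      (SuperEnv.map (P.Ad (φ (c 0))⁻¹) w)) + ((F (p * φ q)).comp (LinearMap.mulLeft ℂ
      (SuperEnv.ι (P.emb y'))) w + F (p * φ q * φ (c 0)) (SuperEnv.ι (P.emb (-y')) * w -
        w * SuperEnv.ι (P.emb (-y'))))) = 0 := by
    have n1 : SuperEnv.ι (P.emb (-y')) = (-1 : ℂ) • SuperEnv.ι (P.emb y') := by
      rw [map_neg, ← map_smul, neg_one_smul]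
    rw [hc.zero, map_one, inv_one, mul_one, P.map_Ad_one, n1, smul_mul_assoc, mul_smul_comm,
      LinearMap.comp_apply, LinearMap.mulLeft_apply, ← map_add]
    have : SuperEnv.ι (P.emb y') * w + ((-1 : ℂ) • (SuperEnv.ι (P.emb y') * w) -
        (-1 : ℂ) • (w * SuperEnv.ι (P.emb y'))) = w * SuperEnv.ι (P.emb y') := by module
    rw [this, hF.right _ hz, SuperRep.rightAct_even π (P.emb_even y'), add_neg_cancel, map_zero]
  rw [e] at h2
  refine h2.congr (Eventually.of_forall fun t => ?_)
  change π.grp (φ q) (π.grp (φ (c t)) _) = π.grp (φ (q * c t)) _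
  rw [map_mul, map_mul, Module.End.mul_apply, mul_inv_rev, P.map_Ad_mul, mul_assoc]

end Pair

/-! ### The extension of superfunctions along the Iwasawa decomposition -/

section ExtSetup

variable {𝔤 : Type*} [AddCommGroup 𝔤] [Module ℂ 𝔤] [LieSuperalgebra 𝔤] {G : Type*} [Group G]
  {V : Type*} [AddCommGroup V] [Module ℂ V] [SuperModule V] {𝔨 𝔟 : LieSubsuperalgebra 𝔤}

/-- Both summands are graded, so the failure of homogeneity of the component lies in 𝔨 ∩ 𝔟 = 0. -/
theorem LieSubsuperalgebra.projectionOnto_mem_part (h : IsCompl 𝔨.toSubmodule 𝔟.toSubmodule)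
    {i : ZMod 2} {x : 𝔤} (hx : x ∈ part 𝔤 i) :
    ((𝔨.toSubmodule.projectionOnto 𝔟.toSubmodule h x : 𝔨.Carrier) : 𝔤) ∈ part 𝔤 i := by
  set a := 𝔨.toSubmodule.projectionOnto 𝔟.toSubmodule h x
  have hb : x - a ∈ 𝔟.toSubmodule := by
    rw [← Submodule.ker_projectionOnto h, LinearMap.mem_ker, map_sub,
      Submodule.projectionOnto_apply_left, sub_self]
  have h1 : parity (a : 𝔤) - koszulSign i 1 • (a : 𝔤) ∈ 𝔨.toSubmodule :=
    Submodule.sub_mem _ (𝔨.parity_mem _ a.2) (Submodule.smul_mem _ _ a.2)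
  have h2 : parity (a : 𝔤) - koszulSign i 1 • (a : 𝔤) ∈ 𝔟.toSubmodule := by
    have : parity (a : 𝔤) - koszulSign i 1 • (a : 𝔤) =
        koszulSign i 1 • (x - a) - parity (x - (a : 𝔤)) := by
      rw [map_sub, mem_part.1 hx]
      module
    rw [this]
    exact Submodule.sub_mem _ (Submodule.smul_mem _ _ hb) (𝔟.parity_mem _ hb)
  exact sub_eq_zero.1 (Submodule.disjoint_def.1 h.disjoint _ h1 h2)

/-- The extension data of a decomposition `𝔤 = 𝔨 ⊕ 𝔟` and a representation of `𝔤`. -/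
def SuperRep.extSetup (π : SuperRep 𝔤 G V) (h : IsCompl 𝔨.toSubmodule 𝔟.toSubmodule) :
    SuperEnv.ExtSetup 𝔨 𝔟 π.rightAct where
  pK := 𝔨.toSubmodule.projectionOnto 𝔟.toSubmodule h
  pB := LinearMap.id - 𝔨.toSubmodule.subtype.comp (𝔨.toSubmodule.projectionOnto 𝔟.toSubmodule h)
  pB_mem g := by
    refine (Submodule.projectionOnto_apply_eq_zero_iff h).1 ?_
    rw [LinearMap.sub_apply, LinearMap.id_apply, LinearMap.comp_apply, map_sub,
      Submodule.subtype_apply, Submodule.projectionOnto_apply_left, sub_self]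
  add_eq g := by
    rw [LinearMap.sub_apply, LinearMap.id_apply]
    exact add_sub_cancel _ _
  pK_coe x := Submodule.projectionOnto_apply_left h x
  pK_of_mem z hz := by
    rwa [← LinearMap.mem_ker, Submodule.ker_projectionOnto]
  pK_part i g hg := LieSubsuperalgebra.projectionOnto_mem_part h hg
  anti _ _ _ _ hz _ _ hz' v := π.rightAct_anti hz hz' v

end ExtSetup

/-! ### Properties of 𝔟-covariant maps that can be tested on 𝔘(𝔨) -/

section Extension

variable {𝔤 : Type*} [NormedAddCommGroup 𝔤] [NormedSpace ℂ 𝔤] [FiniteDimensional ℂ 𝔤]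
  [LieSuperalgebra 𝔤]
  {E : Type*} [NormedAddCommGroup E] [NormedSpace ℝ E] [FiniteDimensional ℝ E]
  {G : Type*} [Group G] [TopologicalSpace G] [ChartedSpace E G] [LieGroup 𝓘(ℝ, E) ∞ G]
  {EK : Type*} [NormedAddCommGroup EK] [NormedSpace ℝ EK] [FiniteDimensional ℝ EK]
  {K : Type*} [Group K] [TopologicalSpace K] [ChartedSpace EK K] [LieGroup 𝓘(ℝ, EK) ∞ K]
  {V : Type*} [AddCommGroup V] [Module ℂ V] [SuperModule V] [UniformSpace V] [LCSuperSpace V]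
  {P : CsSupergroupPair 𝔤 E G} {π : SuperRep 𝔤 G V} {𝔨 𝔟 : LieSubsuperalgebra 𝔤}

/-- By 𝔘(𝔤) = 𝔘(𝔨)𝔘(𝔟), convergence spreads from 𝔘(𝔨): appending z ∈ 𝔟 only applies the continuous
operator `rightAct z`. -/
theorem tendsto_of_map (hsup : 𝔨.toSubmodule ⊔ 𝔟.toSubmodule = ⊤) (hπ : P.IsSmoothRep π)
    {α : Type*} {l : Filter α} {T : α → SuperEnv 𝔤 →ₗ[ℂ] V} {T₀ : SuperEnv 𝔤 →ₗ[ℂ] V}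
    (hT : ∀ a, ∀ z ∈ 𝔟.toSubmodule, ∀ u, T a (u * SuperEnv.ι z) = π.rightAct z (T a u))
    (hT₀ : ∀ z ∈ 𝔟.toSubmodule, ∀ u, T₀ (u * SuperEnv.ι z) = π.rightAct z (T₀ u))
    (h : ∀ u, Tendsto (fun a => T a (SuperEnv.map 𝔨.incl u)) l
      (𝓝 (T₀ (SuperEnv.map 𝔨.incl u)))) (u : SuperEnv 𝔤) :
    Tendsto (fun a => T a u) l (𝓝 (T₀ u)) := by
  let p : Submodule ℂ (SuperEnv 𝔤) :=
    { carrier := {u | Tendsto (fun a => T a u) l (𝓝 (T₀ u))}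
      zero_mem' := by simpa using tendsto_const_nhds
      add_mem' := fun {a b} ha hb => by
        simp only [Set.mem_ofPred_eq, map_add]
        exact Tendsto.add ha hb
      smul_mem' := fun c a ha => by
        simp only [Set.mem_ofPred_eq, map_smul]
        exact Tendsto.const_smul ha c }
  refine SuperEnv.mem_of_map_of_right hsup p h (fun i z hz _ u hu => ?_) u
  change Tendsto (fun a => T a (u * SuperEnv.ι z)) l (𝓝 (T₀ (u * SuperEnv.ι z)))
  simp only [hT _ z hz, hT₀ z hz]
  exact ((hπ.continuous_rightAct z).tendsto _).comp hu

theorem hasVelocity_of_map (hsup : 𝔨.toSubmodule ⊔ 𝔟.toSubmodule = ⊤) (hπ : P.IsSmoothRep π)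
    {T : ℝ → SuperEnv 𝔤 →ₗ[ℂ] V} {T' : SuperEnv 𝔤 →ₗ[ℂ] V}
    (hT : ∀ t, ∀ z ∈ 𝔟.toSubmodule, ∀ u, T t (u * SuperEnv.ι z) = π.rightAct z (T t u))
    (hT' : ∀ z ∈ 𝔟.toSubmodule, ∀ u, T' (u * SuperEnv.ι z) = π.rightAct z (T' u))
    (h : ∀ u, HasVelocity (fun t => T t (SuperEnv.map 𝔨.incl u)) (T' (SuperEnv.map 𝔨.incl u)))
    (u : SuperEnv 𝔤) : HasVelocity (fun t => T t u) (T' u) := by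
  let p : Submodule ℂ (SuperEnv 𝔤) :=
    { carrier := {u | HasVelocity (fun t => T t u) (T' u)}
      zero_mem' := by simpa using HasVelocity.zero
      add_mem' := fun {a b} ha hb => by
        simp only [Set.mem_ofPred_eq, map_add]
        exact HasVelocity.add ha hb
      smul_mem' := fun c a ha => by
        simp only [Set.mem_ofPred_eq, map_smul]
        exact HasVelocity.map ha (c • LinearMap.id) (continuous_const_smul c) }
  refine SuperEnv.mem_of_map_of_right hsup p h (fun i z hz _ u hu => ?_) u
  change HasVelocity (fun t => T t (u * SuperEnv.ι z)) (T' (u * SuperEnv.ι z))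
  simp only [hT _ z hz, hT' z hz]
  exact HasVelocity.map hu _ (hπ.continuous_rightAct z)

theorem eq_of_map (hsup : 𝔨.toSubmodule ⊔ 𝔟.toSubmodule = ⊤) {T T' : SuperEnv 𝔤 →ₗ[ℂ] V}
    (hT : ∀ z ∈ 𝔟.toSubmodule, ∀ u, T (u * SuperEnv.ι z) = π.rightAct z (T u))
    (hT' : ∀ z ∈ 𝔟.toSubmodule, ∀ u, T' (u * SuperEnv.ι z) = π.rightAct z (T' u))
    (h : ∀ u, T (SuperEnv.map 𝔨.incl u) = T' (SuperEnv.map 𝔨.incl u)) : T = T' := by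
  refine LinearMap.ext fun u => SuperEnv.mem_of_map_of_right hsup (LinearMap.eqLocus T T') h
    (fun i z hz _ u hu => ?_) u
  rw [LinearMap.mem_eqLocus] at hu ⊢
  rw [hT z hz, hT' z hz, hu]

/-- If `T` is covariant under `𝔟`, and its restriction to `𝔘(𝔨)` is covariant under a subspace of
`𝔨` which normalises `𝔟`, then `T` is covariant under this subspace. -/
theorem right_of_map (hsup : 𝔨.toSubmodule ⊔ 𝔟.toSubmodule = ⊤) {T : SuperEnv 𝔤 →ₗ[ℂ] V}
    (hT : ∀ z ∈ 𝔟.toSubmodule, ∀ u, T (u * SuperEnv.ι z) = π.rightAct z (T u))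
    {𝔪 : Submodule ℂ 𝔤} (hpar : ∀ x ∈ 𝔪, ∀ i, proj i x ∈ 𝔪)
    (hm : ∀ x ∈ 𝔪, ∀ b ∈ 𝔟.toSubmodule, br b x ∈ 𝔟.toSubmodule)
    (h : ∀ x ∈ 𝔪, ∀ u, T (SuperEnv.map 𝔨.incl u * SuperEnv.ι x) =
      π.rightAct x (T (SuperEnv.map 𝔨.incl u))) {x : 𝔤} (hx : x ∈ 𝔪) (u : SuperEnv 𝔤) :
    T (u * SuperEnv.ι x) = π.rightAct x (T u) := by
  have key : ∀ i, ∀ x ∈ 𝔪, x ∈ part 𝔤 i → T (u * SuperEnv.ι x) = π.rightAct x (T u) := by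
    intro i x hx hxi
    refine SuperEnv.mem_of_map_of_right hsup (LinearMap.eqLocus
      (T.comp (LinearMap.mulRight ℂ (SuperEnv.ι x))) ((π.rightAct x).comp T)) (h x hx)
      (fun j z hz hzj u hu => ?_) u
    have hu' : T (u * SuperEnv.ι x) = π.rightAct x (T u) := hu
    change T (u * SuperEnv.ι z * SuperEnv.ι x) = π.rightAct x (T (u * SuperEnv.ι z))
    -- Commute x to the left of z: the bracket [z, x] lies in 𝔟, where covariance is known, and the
    -- other term is the induction hypothesis followed by z.
    rw [hT z hz, π.rightAct_anti hzj hxi, mul_assoc, SuperEnv.ι_mul_ι hzj hxi, mul_add,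
      mul_smul_comm, ← mul_assoc, map_add, map_smul, hT _ (hm x hx z hz), hT z hz, hu']
  rw [← proj_add_proj x]
  simp only [map_add, mul_add, LinearMap.add_apply]
  rw [key 0 _ (hpar x hx 0) (proj_mem 0 x), key 1 _ (hpar x hx 1) (proj_mem 1 x)]

end Extension

/-! ### Extension from K₀ to G₀ along the Iwasawa factors -/

section Iwasawa

variable {𝔤 : Type*} [NormedAddCommGroup 𝔤] [NormedSpace ℂ 𝔤] [FiniteDimensional ℂ 𝔤]
  [LieSuperalgebra 𝔤]
  {E : Type*} [NormedAddCommGroup E] [NormedSpace ℝ E] [FiniteDimensional ℝ E]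
  {G : Type*} [Group G] [TopologicalSpace G] [ChartedSpace E G] [LieGroup 𝓘(ℝ, E) ∞ G]
  {EK : Type*} [NormedAddCommGroup EK] [NormedSpace ℝ EK] [FiniteDimensional ℝ EK]
  {K : Type*} [Group K] [TopologicalSpace K] [ChartedSpace EK K] [LieGroup 𝓘(ℝ, EK) ∞ K]
  {EA : Type*} [NormedAddCommGroup EA] [NormedSpace ℝ EA] [FiniteDimensional ℝ EA]
  {A : Type*} [Group A] [TopologicalSpace A] [ChartedSpace EA A] [LieGroup 𝓘(ℝ, EA) ∞ A]
  {EN : Type*} [NormedAddCommGroup EN] [NormedSpace ℝ EN] [FiniteDimensional ℝ EN]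
  {N : Type*} [Group N] [TopologicalSpace N] [ChartedSpace EN N] [LieGroup 𝓘(ℝ, EN) ∞ N]
  {V : Type*} [AddCommGroup V] [Module ℂ V] [SuperModule V] [UniformSpace V] [LCSuperSpace V]
  {P : CsSupergroupPair 𝔤 E G} {π : SuperRep 𝔤 G V}
  {φK : K →* G} {φA : A →* G} {φN : N →* G}

theorem HasGlobalIwasawa.exists_factors (hIw : HasGlobalIwasawa EK EA EN E φK φA φN) :
    ∃ (κ : G → K) (α : G → A) (ν : G → N), ContMDiff 𝓘(ℝ, E) 𝓘(ℝ, EK) ∞ κ ∧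
      ContMDiff 𝓘(ℝ, E) 𝓘(ℝ, EA) ∞ α ∧ ContMDiff 𝓘(ℝ, E) 𝓘(ℝ, EN) ∞ ν ∧
      (∀ g, φK (κ g) * (φA (α g) * φN (ν g)) = g) ∧
      ∀ k, κ (φK k) = k ∧ α (φK k) = 1 ∧ ν (φK k) = 1 := by
  obtain ⟨Φ, hΦ⟩ := hIw
  refine ⟨fun g => (Φ.symm g).1, fun g => (Φ.symm g).2.1, fun g => (Φ.symm g).2.2,
    contMDiff_fst.comp Φ.symm.contMDiff, (contMDiff_fst.comp contMDiff_snd).comp Φ.symm.contMDiff,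
    (contMDiff_snd.comp contMDiff_snd).comp Φ.symm.contMDiff, fun g => ?_, fun k => ?_⟩
  · rw [← mul_assoc, ← hΦ]
    exact Φ.apply_symm_apply g
  · have h1 : Φ.symm (φK k) = (k, 1, 1) := by
      have := hΦ k 1 1
      rw [map_one, map_one, mul_one, mul_one] at this
      rw [← this, Φ.symm_apply_apply]
    simp [h1]

theorem IsCurve.inv_mul_comp {c : ℝ → G} {y : E} (hc : IsCurve c y) {ψ : G → K}
    (hψ : ContMDiff 𝓘(ℝ, E) 𝓘(ℝ, EK) ∞ ψ) (p : G) : ∃ y' : GroupLieAlgebra 𝓘(ℝ, EK) K,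
      IsCurve (E := EK) (fun t => (ψ p)⁻¹ * ψ (p * c t)) y' := by
  have h1 : ContMDiff 𝓘(ℝ, E) 𝓘(ℝ, E) ∞ fun g : G => p * g := contMDiff_mul_left
  have h2 : ContMDiff 𝓘(ℝ, EK) 𝓘(ℝ, EK) ∞ fun k : K => (ψ p)⁻¹ * k := contMDiff_mul_left
  exact ⟨_, hc.comp (g := fun g => (ψ p)⁻¹ * ψ (p * g)) (by simp)
    ((h2.comp (hψ.comp h1)).mdifferentiable (by simp) 1)⟩

variable (P π) in
/-- The extension of a family `T : K → Hom(𝔘(𝔤), V)` to `G`, determined by equivariance: with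
`g = κ(g) η(g)`, it is `F(u)(g) = π(η(g))⁻¹ T(κ(g))(Ad(η(g)) u)`. -/
def extendGroup (κ : G → K) (η : G → G) (T : K → SuperEnv 𝔤 →ₗ[ℂ] V) (g : G) :
    SuperEnv 𝔤 →ₗ[ℂ] V :=
  (π.grp (η g)⁻¹).comp ((T (κ g)).comp (SuperEnv.map (P.Ad (η g))).toLinearMap)

theorem extendGroup_apply (κ : G → K) (η : G → G) (T : K → SuperEnv 𝔤 →ₗ[ℂ] V) (g : G)
    (u : SuperEnv 𝔤) : extendGroup P π κ η T g u =
      π.grp (η g)⁻¹ (T (κ g) (SuperEnv.map (P.Ad (η g)) u)) := rfl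

theorem tendsto_grp_inv_map_Ad (hπ : P.IsSmoothRep π) {α : Type*} {l : Filter α} {g : α → G}
    {g₀ : G} (hg : Tendsto g l (𝓝 g₀)) {T : α → SuperEnv 𝔤 →ₗ[ℂ] V} {T₀ : SuperEnv 𝔤 →ₗ[ℂ] V}
    (hT : ∀ w, Tendsto (fun a => T a w) l (𝓝 (T₀ w))) (u : SuperEnv 𝔤) :
    Tendsto (fun a => π.grp (g a)⁻¹ (T a (SuperEnv.map (P.Ad (g a)) u))) l
      (𝓝 (π.grp g₀⁻¹ (T₀ (SuperEnv.map (P.Ad g₀) u)))) := by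
  have : IsTopologicalGroup G := topologicalGroup_of_lieGroup 𝓘(ℝ, E) ∞
  exact (hπ.continuous_grp.tendsto (g₀⁻¹, _)).comp
    (hg.inv.prodMk_nhds (P.tendsto_map_Ad hg u hT))

/-- Right covariance survives because Ad(A N₀) preserves 𝔮, by connectedness. For the derivative,
the velocity at p is split into a part coming from κ, where the hypothesis on T applies, and a part
in 𝔮 coming from η. -/
theorem isCovariant_extendGroup (hπ : P.IsSmoothRep π) {𝔮 : LieSubsuperalgebra 𝔤}
    [ConnectedSpace A] [ConnectedSpace N] (hφK : ContMDiff 𝓘(ℝ, EK) 𝓘(ℝ, E) ∞ φK)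
    (hφA : ContMDiff 𝓘(ℝ, EA) 𝓘(ℝ, E) ∞ φA) (hφN : ContMDiff 𝓘(ℝ, EN) 𝓘(ℝ, E) ∞ φN)
    (hA : ∀ y : GroupLieAlgebra 𝓘(ℝ, EA) A,
      P.emb (mfderiv 𝓘(ℝ, EA) 𝓘(ℝ, E) φA 1 y : E) ∈ 𝔮.toSubmodule)
    (hN : ∀ y : GroupLieAlgebra 𝓘(ℝ, EN) N,
      P.emb (mfderiv 𝓘(ℝ, EN) 𝓘(ℝ, E) φN 1 y : E) ∈ 𝔮.toSubmodule)
    {κ : G → K} {α : G → A} {ν : G → N} (hκ : ContMDiff 𝓘(ℝ, E) 𝓘(ℝ, EK) ∞ κ)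
    (hα : ContMDiff 𝓘(ℝ, E) 𝓘(ℝ, EA) ∞ α) (hν : ContMDiff 𝓘(ℝ, E) 𝓘(ℝ, EN) ∞ ν)
    (hg : ∀ g, φK (κ g) * (φA (α g) * φN (ν g)) = g) {T : K → SuperEnv 𝔤 →ₗ[ℂ] V}
    (hT : ∀ (y : GroupLieAlgebra 𝓘(ℝ, EK) K) (c : ℝ → K), IsCurve (E := EK) c y → ∀ u k,
      HasVelocity (fun t => T (k * c t) u)
        (T k (SuperEnv.ι (P.emb (mfderiv 𝓘(ℝ, EK) 𝓘(ℝ, E) φK 1 y : E)) * u)))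
    (hT' : ∀ z ∈ 𝔮.toSubmodule, ∀ u k, T k (u * SuperEnv.ι z) = π.rightAct z (T k u)) :
    IsCovariant P π 𝔮.toSubmodule
      (extendGroup P π κ (fun g => φA (α g) * φN (ν g)) T) := by
  set η : G → G := fun g => φA (α g) * φN (ν g) with hη
  have hAdA : ∀ a, ∀ x ∈ 𝔮.toSubmodule, P.Ad (φA a) x ∈ 𝔮.toSubmodule :=
    P.Ad_mem_of_connected hφA fun y x hx => 𝔮.br_mem _ (hA y) _ hx
  have hAdN : ∀ n, ∀ x ∈ 𝔮.toSubmodule, P.Ad (φN n) x ∈ 𝔮.toSubmodule :=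
    P.Ad_mem_of_connected hφN fun y x hx => 𝔮.br_mem _ (hN y) _ hx
  have hright : ∀ z ∈ 𝔮.toSubmodule, ∀ u p, extendGroup P π κ η T p (u * SuperEnv.ι z) =
      π.rightAct z (extendGroup P π κ η T p u) := by
    intro z hz u p
    have h1 : P.Ad (η p) z ∈ 𝔮.toSubmodule := by
      rw [hη, P.Ad_mul]
      exact hAdA _ _ (hAdN _ _ hz)
    rw [extendGroup_apply, map_mul, SuperEnv.map_ι, hT' _ h1, hπ.rightAct_Ad,
      SuperRep.grp_inv_grp, extendGroup_apply]
  refine ⟨fun y c hc u p => ?_, hright⟩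
  set F := extendGroup P π κ η T with hF
  obtain ⟨y₁, h₁⟩ := hc.inv_mul_comp hκ p
  obtain ⟨y₂, h₂⟩ := hc.inv_mul_comp hα p
  obtain ⟨y₃, h₃⟩ := hc.inv_mul_comp hν p
  obtain ⟨y₁', h₁', e₁⟩ := P.exists_isCurve_conj
    (h₁.comp (g := φK) (map_one φK) (hφK.mdifferentiable (by simp) 1)) (η p)⁻¹
  obtain ⟨y₂', h₂', e₂⟩ := P.exists_isCurve_conj
    (h₂.comp (g := φA) (map_one φA) (hφA.mdifferentiable (by simp) 1)) (φN (ν p))⁻¹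
  have h₃' := h₃.comp (g := φN) (map_one φN) (hφN.mdifferentiable (by simp) 1)
  set y₃' : GroupLieAlgebra 𝓘(ℝ, E) G := mfderiv 𝓘(ℝ, EN) 𝓘(ℝ, E) φN 1 y₃
  have hd := h₂'.mul h₃'
  -- The logarithmic increment of η: η(p c(t)) = η(p) d(t), with velocity in 𝔮.
  set d : ℝ → G := fun t => (φN (ν p))⁻¹ * φA ((α p)⁻¹ * α (p * c t)) * (φN (ν p))⁻¹⁻¹ *
    φN ((ν p)⁻¹ * ν (p * c t)) with hd'
  set yd : GroupLieAlgebra 𝓘(ℝ, E) G := y₂' + y₃' with hyd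
  have hyd' : P.emb yd ∈ 𝔮.toSubmodule := by
    rw [hyd, map_add, e₂, ← map_inv]
    exact Submodule.add_mem _ (hAdN _ _ (hA y₂)) (hN y₃)
  have hηd : ∀ t, η (p * c t) = η p * d t := by
    intro t
    simp only [hη, hd', map_mul, map_inv]
    group
  have hcd : c = fun t => (η p)⁻¹ * φK ((κ p)⁻¹ * κ (p * c t)) * (η p)⁻¹⁻¹ * d t := by
    ext t
    have h := hg (p * c t)
    rw [show φA (α (p * c t)) * φN (ν (p * c t)) = η p * d t from hηd t] at h
    rw [map_mul, map_inv, inv_inv]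
    have h' := hg p
    rw [show φA (α p) * φN (ν p) = η p from rfl] at h'
    calc c t = p⁻¹ * (p * c t) := by group
      _ = (φK (κ p) * η p)⁻¹ * (φK (κ (p * c t)) * (η p * d t)) := by rw [h, h']
      _ = _ := by group
  have hy : y = y₁' + yd := by
    have h := h₁'.mul hd
    rw [← hcd] at h
    exact hc.unique h
  have h5 := P.hasVelocity_map_Ad (y := yd) hd u
    (T := fun t => (π.grp (η p)⁻¹).comp ((T (κ p * ((κ p)⁻¹ * κ (p * c t)))).comp
      (SuperEnv.map (P.Ad (η p))).toLinearMap))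
    (T' := (F p).comp (LinearMap.mulLeft ℂ (SuperEnv.ι (P.emb y₁')))) (fun w => by
      have h := (hT y₁ _ h₁ (SuperEnv.map (P.Ad (η p)) w) (κ p)).map (π.grp (η p)⁻¹)
        (hπ.continuous_grp_apply _)
      convert h using 1
      · rfl
      rw [LinearMap.comp_apply, LinearMap.mulLeft_apply, hF, extendGroup_apply, map_mul,
        SuperEnv.map_ι, e₁, P.Ad_Ad_inv])
  have h6 := hasVelocity_grp hπ (y := -yd) hd.inv h5
  have e0 : (π.grp (η p)⁻¹).comp ((T (κ p * ((κ p)⁻¹ * κ (p * c 0)))).comp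
      (SuperEnv.map (P.Ad (η p))).toLinearMap) = F p := by
    rw [hc.zero, mul_one, mul_inv_cancel_left]
    rfl
  rw [e0, hd.zero, P.map_Ad_one, LinearMap.comp_apply, LinearMap.mulLeft_apply, map_sub,
    hright _ hyd', SuperRep.rightAct_even π (P.emb_even yd)] at h6
  -- Differentiating π(d(t))⁻¹ gives -π(y_d)F(u), and differentiating Ad(d(t)) gives F(y_d u) - F(u
  -- y_d). By right covariance the first and last terms cancel, leaving F(y₁'u) + F(y_d u).
  have e1 : F p (SuperEnv.ι (P.emb y) * u) = π.alg (P.emb (-yd)) (F p u) +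
      (F p (SuperEnv.ι (P.emb y₁') * u) + (F p (SuperEnv.ι (P.emb yd) * u) -
        -(π.alg (P.emb yd)) (F p u))) := by
    rw [hy, map_add, map_add, add_mul, map_add, map_neg, map_neg, LinearMap.neg_apply]
    abel
  rw [e1]
  refine h6.congr (Eventually.of_forall fun t => ?_)
  beta_reduce
  rw [mul_inv_cancel_left, hF, extendGroup_apply, hηd, mul_inv_rev (η p), map_mul π.grp (d t)⁻¹,
    P.map_Ad_mul (η p)]
  rfl

end Iwasawa

/-! ### Covariant families and induced representations -/

section Covariant

variable {𝔤 : Type*} [NormedAddCommGroup 𝔤] [NormedSpace ℂ 𝔤] [FiniteDimensional ℂ 𝔤]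
  [LieSuperalgebra 𝔤]
  {E : Type*} [NormedAddCommGroup E] [NormedSpace ℝ E] [FiniteDimensional ℝ E]
  {G : Type*} [Group G] [TopologicalSpace G] [ChartedSpace E G] [LieGroup 𝓘(ℝ, E) ∞ G]
  {V : Type*} [AddCommGroup V] [Module ℂ V] [SuperModule V] [UniformSpace V] [LCSuperSpace V]
  {P : CsSupergroupPair 𝔤 E G} {π : SuperRep 𝔤 G V} {𝔥 : LieSubsuperalgebra 𝔤} {H : Subgroup G}

variable (P π) in
/-- The translate `p ↦ π(m) ∘ F(pm) ∘ Ad(m⁻¹)`. -/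
def translate (m : G) (F : G → SuperEnv 𝔤 →ₗ[ℂ] V) (p : G) : SuperEnv 𝔤 →ₗ[ℂ] V :=
  (π.grp m).comp ((F (p * m)).comp (SuperEnv.map (P.Ad m⁻¹)).toLinearMap)

theorem translate_apply (m : G) (F : G → SuperEnv 𝔤 →ₗ[ℂ] V) (p : G) (u : SuperEnv 𝔤) :
    translate P π m F p u = π.grp m (F (p * m) (SuperEnv.map (P.Ad m⁻¹) u)) := rfl

variable (P π) in
/-- The subgroup of those elements of `G` under which `F` is equivariant. -/
def equivariantSubgroup (F : G → SuperEnv 𝔤 →ₗ[ℂ] V) : Subgroup G where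
  carrier := {h | ∀ u p, F p u = translate P π h F p u}
  one_mem' u p := by simp [translate_apply, P.map_Ad_one]
  mul_mem' {g h} hg hh u p := by
    rw [hg u p, translate_apply, hh, translate_apply, translate_apply, ← P.map_Ad_mul, mul_inv_rev,
      mul_assoc, map_mul, Module.End.mul_apply]
  inv_mem' {h} hh u p := by
    have h1 := hh (SuperEnv.map (P.Ad h) u) (p * h⁻¹)
    rw [translate_apply, ← P.map_Ad_mul, inv_mul_cancel, P.map_Ad_one, inv_mul_cancel_right] at h1
    rw [translate_apply, inv_inv, h1, SuperRep.grp_inv_grp]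

theorem mem_equivariantSubgroup {F : G → SuperEnv 𝔤 →ₗ[ℂ] V} {h : G} :
    h ∈ equivariantSubgroup P π F ↔ ∀ u p, F p u = translate P π h F p u := Iff.rfl

theorem apply_mul_of_mem {F : G → SuperEnv 𝔤 →ₗ[ℂ] V} {h : G}
    (hh : h ∈ equivariantSubgroup P π F) (p : G) (u : SuperEnv 𝔤) :
    F (p * h) u = π.grp h⁻¹ (F p (SuperEnv.map (P.Ad h) u)) := by
  rw [mem_equivariantSubgroup.1 hh (SuperEnv.map (P.Ad h) u) p, translate_apply, ← P.map_Ad_mul, inv_mul_cancel, P.map_Ad_one,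
    SuperRep.grp_inv_grp]

/-- Conjugating curves by m⁻¹ matches the twist by Ad(m⁻¹). Thus, for m ∈ M₀, uniqueness can compare
a function with its translate, although M₀ need not be connected. -/
theorem IsCovariant.translate (hπ : P.IsSmoothRep π) {𝔮 : Submodule ℂ 𝔤}
    {F : G → SuperEnv 𝔤 →ₗ[ℂ] V} (hF : IsCovariant P π 𝔮 F) {m : G}
    (hm : ∀ z ∈ 𝔮, P.Ad m⁻¹ z ∈ 𝔮) : IsCovariant P π 𝔮 (translate P π m F) where
  velocity y c hc u p := by
    obtain ⟨y', hc', e⟩ := P.exists_isCurve_conj hc m⁻¹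
    have h := (hF.velocity y' _ hc' (SuperEnv.map (P.Ad m⁻¹) u) (p * m)).map (π.grp m)
      (hπ.continuous_grp_apply m)
    rw [translate_apply, map_mul, SuperEnv.map_ι, ← e]
    refine h.congr (Eventually.of_forall fun t => ?_)
    beta_reduce
    rw [translate_apply]
    congr 3
    group
  right z hz u p := by
    have h := hF.right _ (hm z hz) (SuperEnv.map (P.Ad m⁻¹) u) (p * m)
    rw [translate_apply, map_mul, SuperEnv.map_ι, h, hπ.rightAct_Ad, inv_inv,
      SuperRep.grp_grp_inv, translate_apply]

theorem isCovariant_of_mem_ind {f : SuperEnv 𝔤 →ₗ[ℂ] (G → V)}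
    (hf : f ∈ ind P 𝔥 H (π.restrict 𝔥.incl H.subtype)) :
    IsCovariant P π 𝔥.toSubmodule (fun p => (LinearMap.proj p).comp f) where
  velocity y c hc u p := (mem_superfunctions_iff.1 hf.1).2 y c hc u p
  right z hz u p := by
    have key : ∀ i, ∀ z ∈ 𝔥.toSubmodule, z ∈ part 𝔤 i →
        f (u * SuperEnv.ι z) p = π.rightAct z (f u p) := fun i z hz hzi => by
      rw [π.rightAct_of_mem hzi]
      exact hf.2.2 i ⟨z, hz⟩ (𝔥.mem_part_carrier hzi) u p
    change f (u * SuperEnv.ι z) p = π.rightAct z (f u p)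
    rw [← proj_add_proj z]
    simp only [map_add, mul_add, LinearMap.add_apply, Pi.add_apply]
    rw [key 0 _ (𝔥.proj_mem hz 0) (SuperModule.proj_mem 0 z),
      key 1 _ (𝔥.proj_mem hz 1) (SuperModule.proj_mem 1 z)]

theorem mem_ind_of_isCovariant {F : G → SuperEnv 𝔤 →ₗ[ℂ] V}
    (hF : IsCovariant P π 𝔥.toSubmodule F) (hc : ∀ u, Continuous fun p => F p u)
    (hH : H ≤ equivariantSubgroup P π F) :
    LinearMap.pi F ∈ ind P 𝔥 H (π.restrict 𝔥.incl H.subtype) := by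
  refine ⟨mem_superfunctions_iff.2 ⟨hc, fun y c hc' u p => hF.velocity y c hc' u p⟩,
    fun h u p => hH h.2 u p, fun i y hy u p => ?_⟩
  have h := hF.right y y.2 u p
  rw [π.rightAct_of_mem (𝔥.coe_mem_part hy)] at h
  exact h

variable {EK : Type*} [NormedAddCommGroup EK] [NormedSpace ℝ EK] [FiniteDimensional ℝ EK]
  {K : Type*} [Group K] [TopologicalSpace K] [ChartedSpace EK K] [LieGroup 𝓘(ℝ, EK) ∞ K]
  {𝔨 : LieSubsuperalgebra 𝔤} {PK : CsSupergroupPair 𝔨.Carrier EK K} {φK : K →* G}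

/-- Restriction along `𝔘(𝔨) → 𝔘(𝔤)` and `K → G`. -/
def restrictSuperfunction (𝔨 : LieSubsuperalgebra 𝔤) (φK : K →* G) :
    (SuperEnv 𝔤 →ₗ[ℂ] (G → V)) →ₗ[ℂ] (SuperEnv 𝔨.Carrier →ₗ[ℂ] (K → V)) where
  toFun f := (LinearMap.funLeft ℂ V φK).comp (f.comp (SuperEnv.map 𝔨.incl).toLinearMap)
  map_add' _ _ := rfl
  map_smul' _ _ := rfl

theorem restrictSuperfunction_apply (f : SuperEnv 𝔤 →ₗ[ℂ] (G → V)) (u : SuperEnv 𝔨.Carrier)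
    (k : K) : restrictSuperfunction 𝔨 φK f u k = f (SuperEnv.map 𝔨.incl u) (φK k) := rfl

theorem CsSupergroupPair.IsMorphism.map_Ad (hPK : PK.IsMorphism P 𝔨.incl φK) (k : K)
    (u : SuperEnv 𝔨.Carrier) : SuperEnv.map (P.Ad (φK k)) (SuperEnv.map 𝔨.incl u) =
      SuperEnv.map 𝔨.incl (SuperEnv.map (PK.Ad k) u) := by
  have : (SuperEnv.map (P.Ad (φK k))).comp (SuperEnv.map 𝔨.incl) =
      (SuperEnv.map 𝔨.incl).comp (SuperEnv.map (PK.Ad k)) :=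
    SuperEnv.algHom_ext fun x => by simp [hPK.Ad]
  exact DFunLike.congr_fun this u

theorem restrictSuperfunction_mem (hPK : PK.IsMorphism P 𝔨.incl φK)
    {𝔪 : LieSubsuperalgebra 𝔨.Carrier} {M : Subgroup K}
    (h𝔪 : ∀ x ∈ 𝔪.toSubmodule, (x : 𝔤) ∈ 𝔥.toSubmodule) (hM : ∀ m ∈ M, φK m ∈ H)
    {f : SuperEnv 𝔤 →ₗ[ℂ] (G → V)} (hf : f ∈ ind P 𝔥 H (π.restrict 𝔥.incl H.subtype)) :
    restrictSuperfunction 𝔨 φK f ∈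
      ind PK 𝔪 M (π.restrict (𝔨.incl.comp 𝔪.incl) (φK.comp M.subtype)) := by
  obtain ⟨h1, h2⟩ := mem_superfunctions_iff.1 hf.1
  refine ⟨mem_superfunctions_iff.2 ⟨fun u => (h1 _).comp hPK.smooth.continuous,
    fun y c hc u p => ?_⟩, fun m u p => ?_, fun i y hy u p => ?_⟩
  · have hc' := hc.comp (g := φK) (map_one φK) (hPK.smooth.mdifferentiable (by simp) 1)
    have h := h2 _ _ hc' (SuperEnv.map 𝔨.incl u) (φK p)
    rw [← hPK.emb] at h
    rw [restrictSuperfunction_apply, map_mul, SuperEnv.map_ι]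
    refine h.congr (Eventually.of_forall fun t => ?_)
    beta_reduce
    rw [restrictSuperfunction_apply, map_mul]
  · have h := hf.2.1 ⟨φK m, hM m m.2⟩ (SuperEnv.map 𝔨.incl u) (φK p)
    rw [restrictSuperfunction_apply, restrictSuperfunction_apply, ← hPK.map_Ad, map_mul, map_inv]
    exact h
  · have h := hf.2.2 i ⟨(y : 𝔨.Carrier), h𝔪 _ y.2⟩
      (𝔥.mem_part_carrier (𝔨.coe_mem_part (𝔪.coe_mem_part hy))) (SuperEnv.map 𝔨.incl u) (φK p)
    rw [restrictSuperfunction_apply, restrictSuperfunction_apply, map_mul, SuperEnv.map_ι]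
    exact h

end Covariant

/-! ### The minimal parabolic subpair -/

section Parabolic

variable {𝔤 : Type*} [NormedAddCommGroup 𝔤] [NormedSpace ℂ 𝔤] [FiniteDimensional ℂ 𝔤]
  [LieSuperalgebra 𝔤]
  {E : Type*} [NormedAddCommGroup E] [NormedSpace ℝ E] [FiniteDimensional ℝ E]
  {G : Type*} [Group G] [TopologicalSpace G] [ChartedSpace E G] [LieGroup 𝓘(ℝ, E) ∞ G]
  {θ : LieSuperHom 𝔤 𝔤} {𝔞 : Submodule ℂ 𝔤} {S : Set (Module.Dual ℂ 𝔞)}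

theorem coe_mem_minimalParabolic (h𝔞 : IsEvenCartan θ 𝔞) (hS : IsPositiveSystem 𝔞 S)
    (x : (LieSubsuperalgebra.fixed θ).Carrier) (hx : x ∈ (centralizerInK h𝔞).toSubmodule) :
    (x : 𝔤) ∈ (minimalParabolic h𝔞 hS).toSubmodule :=
  Submodule.mem_sup_left (Submodule.mem_sup_left ⟨x.2, hx⟩)

/-- If `T` is covariant under `𝔞 ⊕ 𝔫` and its restriction to `𝔘(𝔨)` is covariant under `𝔪`, then `T`
is covariant under `𝔮`. -/
theorem right_minimalParabolic {V : Type*} [AddCommGroup V] [Module ℂ V] [SuperModule V]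
    {π : SuperRep 𝔤 G V} [UniformSpace V] [LCSuperSpace V] (h𝔞 : IsEvenCartan θ 𝔞)
    (hS : IsPositiveSystem 𝔞 S)
    (hsup : (LieSubsuperalgebra.fixed θ).toSubmodule ⊔ (cartanPositive h𝔞 hS).toSubmodule = ⊤)
    {T : SuperEnv 𝔤 →ₗ[ℂ] V} (hT : ∀ z ∈ (cartanPositive h𝔞 hS).toSubmodule, ∀ u,
      T (u * SuperEnv.ι z) = π.rightAct z (T u))
    (h : ∀ x ∈ (centralizerInK h𝔞).toSubmodule, ∀ u,
      T (SuperEnv.map (LieSubsuperalgebra.fixed θ).incl (u * SuperEnv.ι x)) =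
      π.rightAct x (T (SuperEnv.map (LieSubsuperalgebra.fixed θ).incl u)))
    {z : 𝔤} (hz : z ∈ (minimalParabolic h𝔞 hS).toSubmodule) (u : SuperEnv 𝔤) :
    T (u * SuperEnv.ι z) = π.rightAct z (T u) := by
  obtain ⟨w, hw, n, hn, rfl⟩ := Submodule.mem_sup.1 hz
  obtain ⟨m, hm, a, ha, rfl⟩ := Submodule.mem_sup.1 hw
  have h1 := right_of_map hsup hT
    (𝔪 := (LieSubsuperalgebra.fixed θ).toSubmodule ⊓
      (LieSubsuperalgebra.centralizer 𝔞 h𝔞.le_even).toSubmodule)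
    (fun x hx i => ⟨LieSubsuperalgebra.proj_mem _ hx.1 i, LieSubsuperalgebra.proj_mem _ hx.2 i⟩)
    -- Elements of 𝔪 commute with 𝔞 and have weight 0, so they normalise 𝔞 ⊕ 𝔫.
    (fun x hx b hb => by
      obtain ⟨a, ha, n, hn, rfl⟩ := Submodule.mem_sup.1 hb
      have h0 : br a x = 0 := hx.2 a ha
      rw [map_add, LinearMap.add_apply, h0, zero_add]
      refine Submodule.mem_sup_right (br_mem_positivePart_right h𝔞 hn fun h => ?_)
      rw [hx.2 h h.2]
      simp)
    (fun x hx u => by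
      have := h ⟨x, hx.1⟩ hx.2 u
      rwa [map_mul, SuperEnv.map_ι] at this) hm u
  simp only [map_add, mul_add, LinearMap.add_apply]
  rw [h1, hT a (Submodule.mem_sup_left ha), hT n (Submodule.mem_sup_right hn)]

variable {P : CsSupergroupPair 𝔤 E G} {K : Type*} [Group K] {φK : K →* G}

/-- An automorphism that fixes 𝔞 pointwise preserves every root space and the centraliser of 𝔞. -/
theorem Ad_mem_minimalParabolic (h𝔞 : IsEvenCartan θ 𝔞) (hS : IsPositiveSystem 𝔞 S) {k : K}
    (hk : k ∈ centralizerGroup P 𝔞 φK)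
    (hfix : ∀ x ∈ (LieSubsuperalgebra.fixed θ).toSubmodule,
      P.Ad (φK k) x ∈ (LieSubsuperalgebra.fixed θ).toSubmodule) {z : 𝔤}
    (hz : z ∈ (minimalParabolic h𝔞 hS).toSubmodule) :
    P.Ad (φK k) z ∈ (minimalParabolic h𝔞 hS).toSubmodule := by
  have hroot : ∀ l : Module.Dual ℂ 𝔞, ∀ x ∈ rootSpace 𝔞 l, P.Ad (φK k) x ∈ rootSpace 𝔞 l := by
    intro l x hx h
    rw [← map_smul, ← hx h, (P.Ad (φK k)).map_br, hk h h.2]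
  obtain ⟨w, hw, n, hn, rfl⟩ := Submodule.mem_sup.1 hz
  obtain ⟨m, hm, a, ha, rfl⟩ := Submodule.mem_sup.1 hw
  have h1 : P.Ad (φK k) n ∈ positivePart 𝔞 S := by
    have : positivePart 𝔞 S ≤ (positivePart 𝔞 S).comap (P.Ad (φK k)).toLin :=
      iSup₂_le fun l hl x hx =>
        Submodule.mem_iSup_of_mem l (Submodule.mem_iSup_of_mem hl (hroot l x hx))
    exact this hn
  rw [map_add, map_add, hk a ha]
  refine Submodule.add_mem_sup (Submodule.add_mem_sup ⟨hfix _ hm.1, fun h hh => ?_⟩ ha) h1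
  have h2 := (P.Ad (φK k)).map_br h m
  rw [hk h hh, hm.2 h hh, map_zero] at h2
  exact h2.symm

end Parabolic

/-! ### Restriction to the maximal compact subpair -/

theorem SuperRep.rightAct_restrict {𝔤 𝔥 : Type*} [AddCommGroup 𝔤] [Module ℂ 𝔤] [LieSuperalgebra 𝔤]
    [AddCommGroup 𝔥] [Module ℂ 𝔥] [LieSuperalgebra 𝔥] {G H : Type*} [Group G] [Group H]
    {V : Type*} [AddCommGroup V] [Module ℂ V] [SuperModule V] (π : SuperRep 𝔤 G V)
    (dφ : LieSuperHom 𝔥 𝔤) (φ : H →* G) (z : 𝔥) (v : V) :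
    (π.restrict dφ φ).rightAct z v = π.rightAct (dφ z) v := by
  rw [rightAct_apply, rightAct_apply, ← LieSuperHom.map_proj, ← LieSuperHom.map_proj]
  rfl

section Iwasawa

variable {𝔤 : Type*} [NormedAddCommGroup 𝔤] [NormedSpace ℂ 𝔤] [FiniteDimensional ℂ 𝔤]
  [LieSuperalgebra 𝔤]
  {E : Type*} [NormedAddCommGroup E] [NormedSpace ℝ E] [FiniteDimensional ℝ E]
  {G : Type*} [Group G] [TopologicalSpace G] [ChartedSpace E G] [LieGroup 𝓘(ℝ, E) ∞ G]
  {EK : Type*} [NormedAddCommGroup EK] [NormedSpace ℝ EK] [FiniteDimensional ℝ EK]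
  {K : Type*} [Group K] [TopologicalSpace K] [ChartedSpace EK K] [LieGroup 𝓘(ℝ, EK) ∞ K]
  {EA : Type*} [NormedAddCommGroup EA] [NormedSpace ℝ EA] [FiniteDimensional ℝ EA]
  {A : Type*} [Group A] [TopologicalSpace A] [ChartedSpace EA A] [LieGroup 𝓘(ℝ, EA) ∞ A]
  {EN : Type*} [NormedAddCommGroup EN] [NormedSpace ℝ EN] [FiniteDimensional ℝ EN]
  {N : Type*} [Group N] [TopologicalSpace N] [ChartedSpace EN N] [LieGroup 𝓘(ℝ, EN) ∞ N]
  {V : Type*} [AddCommGroup V] [Module ℂ V] [SuperModule V] [UniformSpace V] [LCSuperSpace V]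
  {P : CsSupergroupPair 𝔤 E G} {π : SuperRep 𝔤 G V}
  {φK : K →* G} {φA : A →* G} {φN : N →* G}

/-- Equivariance under η(g) forces the formula for the extension, so it also computes functions
already defined on G₀. -/
theorem extendGroup_restrict {F : G → SuperEnv 𝔤 →ₗ[ℂ] V} {κ : G → K} {η : G → G}
    (hη : ∀ g, η g ∈ equivariantSubgroup P π F) (hg : ∀ g, φK (κ g) * η g = g) (p : G) :
    F p = extendGroup P π κ η (fun k => F (φK k)) p := by
  ext u
  rw [extendGroup_apply, ← apply_mul_of_mem (hη p), hg]

/-- The two halves of uniqueness: `eq_of_map` passes from 𝔘(𝔨) to 𝔘(𝔤) over each k, and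
`extendGroup_restrict` passes from K₀ to G₀. -/
theorem eq_of_eq_on_maximalCompact {𝔨 𝔟 : LieSubsuperalgebra 𝔤} {F F' : G → SuperEnv 𝔤 →ₗ[ℂ] V}
    (hsup : 𝔨.toSubmodule ⊔ 𝔟.toSubmodule = ⊤) (hF : IsCovariant P π 𝔟.toSubmodule F)
    (hF' : IsCovariant P π 𝔟.toSubmodule F') {κ : G → K} {η : G → G}
    (hg : ∀ g, φK (κ g) * η g = g) (hη : ∀ g, η g ∈ equivariantSubgroup P π F)
    (hη' : ∀ g, η g ∈ equivariantSubgroup P π F')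
    (h : ∀ k u, F (φK k) (SuperEnv.map 𝔨.incl u) = F' (φK k) (SuperEnv.map 𝔨.incl u)) :
    F = F' := by
  funext p
  have hk : (fun k => F (φK k)) = fun k => F' (φK k) := funext fun k =>
    eq_of_map (π := π) hsup (fun z hz u => hF.right z hz u _) (fun z hz u => hF'.right z hz u _)
      (h k)
  rw [extendGroup_restrict hη hg, extendGroup_restrict hη' hg, hk]

theorem continuous_extendGroup (hπ : P.IsSmoothRep π) {κ : G → K} {η : G → G}
    (hη : Continuous η) {T : K → SuperEnv 𝔤 →ₗ[ℂ] V} (hT : ∀ w, Continuous fun p => T (κ p) w)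
    (u : SuperEnv 𝔤) : Continuous fun p => extendGroup P π κ η T p u := by
  exact continuous_iff_continuousAt.2 fun p =>
    tendsto_grp_inv_map_Ad hπ (hη.tendsto p) (fun w => (hT w).tendsto p) u

variable {θ : LieSuperHom 𝔤 𝔤} {𝔞 : Submodule ℂ 𝔤} {S : Set (Module.Dual ℂ 𝔞)}

theorem IsCovariant.mono {𝔮 𝔮' : Submodule ℂ 𝔤} {F : G → SuperEnv 𝔤 →ₗ[ℂ] V}
    (hF : IsCovariant P π 𝔮 F) (h : 𝔮' ≤ 𝔮) : IsCovariant P π 𝔮' F :=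
  ⟨hF.velocity, fun z hz => hF.right z (h hz)⟩

set_option maxHeartbeats 1000000 in
/-- Every vector of `Ind_{𝔪,M₀}^{𝔨,K₀}(V)` extends to a vector of `Ind_{𝔮,Q₀}^{𝔤,G₀}(V)`. -/
theorem exists_restrictSuperfunction_eq (hπ : P.IsSmoothRep π) (h𝔞 : IsEvenCartan θ 𝔞)
    (hS : IsPositiveSystem 𝔞 S)
    (hcompl : IsCompl (LieSubsuperalgebra.fixed θ).toSubmodule (cartanPositive h𝔞 hS).toSubmodule)
    {PK : CsSupergroupPair (LieSubsuperalgebra.fixed θ).Carrier EK K}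
    (hPK : PK.IsMorphism P (LieSubsuperalgebra.fixed θ).incl φK)
    [ConnectedSpace A] [ConnectedSpace N]
    (hφA : ContMDiff 𝓘(ℝ, EA) 𝓘(ℝ, E) ∞ φA) (hφN : ContMDiff 𝓘(ℝ, EN) 𝓘(ℝ, E) ∞ φN)
    (hA : ∀ y : GroupLieAlgebra 𝓘(ℝ, EA) A,
      P.emb (mfderiv 𝓘(ℝ, EA) 𝓘(ℝ, E) φA 1 y : E) ∈ 𝔞)
    (hN : ∀ y : GroupLieAlgebra 𝓘(ℝ, EN) N,
      P.emb (mfderiv 𝓘(ℝ, EN) 𝓘(ℝ, E) φN 1 y : E) ∈ positivePart 𝔞 S)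
    (hIw : HasGlobalIwasawa EK EA EN E φK φA φN)
    {f : SuperEnv (LieSubsuperalgebra.fixed θ).Carrier →ₗ[ℂ] (K → V)}
    (hf : f ∈ ind PK (centralizerInK h𝔞) (centralizerGroup P 𝔞 φK)
      (π.restrict ((LieSubsuperalgebra.fixed θ).incl.comp (centralizerInK h𝔞).incl)
        (φK.comp (centralizerGroup P 𝔞 φK).subtype))) :
    ∃ f' ∈ ind P (minimalParabolic h𝔞 hS) (minimalParabolicGroup P 𝔞 φK φA φN)
      (π.restrict (minimalParabolic h𝔞 hS).incl
        (minimalParabolicGroup P 𝔞 φK φA φN).subtype),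
      restrictSuperfunction (LieSubsuperalgebra.fixed θ) φK f' = f := by
  obtain ⟨κ, α, ν, hκ, hα, hν, hg, hgK⟩ := hIw.exists_factors
  have hfM : ∀ m ∈ centralizerGroup P 𝔞 φK, ∀ u k,
      f u k = π.grp (φK m) (f (SuperEnv.map (PK.Ad m⁻¹) u) (k * m)) := fun m hm u k =>
    hf.2.1 ⟨m, hm⟩ u k
  have hsup := codisjoint_iff.1 hcompl.codisjoint
  have hle := cartanPositive_le h𝔞 hS
  have hA' : ∀ y : GroupLieAlgebra 𝓘(ℝ, EA) A, P.emb (mfderiv 𝓘(ℝ, EA) 𝓘(ℝ, E) φA 1 y : E) ∈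
      (minimalParabolic h𝔞 hS).toSubmodule := fun y => hle (Submodule.mem_sup_left (hA y))
  have hN' : ∀ y : GroupLieAlgebra 𝓘(ℝ, EN) N, P.emb (mfderiv 𝓘(ℝ, EN) 𝓘(ℝ, E) φN 1 y : E) ∈
      (minimalParabolic h𝔞 hS).toSubmodule := fun y => hle (Submodule.mem_sup_right (hN y))
  have hcov := isCovariant_of_mem_ind (P := PK)
    (π := π.restrict (LieSubsuperalgebra.fixed θ).incl φK) hf
  -- The algebraic extension is made separately over each point of K₀; continuity and
  -- differentiability in k are recovered from 𝔘(𝔨) afterwards.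
  set T : K → SuperEnv 𝔤 →ₗ[ℂ] V := fun k =>
    (π.extSetup hcompl).extend ((LinearMap.proj k).comp f) with hTdef
  have hTmap : ∀ k u, T k (SuperEnv.map (LieSubsuperalgebra.fixed θ).incl u) = f u k := fun k u =>
    (π.extSetup hcompl).extend_map _ u
  have hTb : ∀ k, ∀ z ∈ (cartanPositive h𝔞 hS).toSubmodule, ∀ u,
      T k (u * SuperEnv.ι z) = π.rightAct z (T k u) := fun k z hz u =>
    (π.extSetup hcompl).extend_mul _ u hz
  have hTq : ∀ z ∈ (minimalParabolic h𝔞 hS).toSubmodule, ∀ u k,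
      T k (u * SuperEnv.ι z) = π.rightAct z (T k u) := fun z hz u k =>
    right_minimalParabolic h𝔞 hS hsup (hTb k) (fun x hx u => by
      have h := hcov.right x hx u k
      rw [SuperRep.rightAct_restrict] at h
      rw [hTmap, hTmap]
      exact h) hz u
  -- Left multiplication by y commutes with right multiplication by 𝔟, so the expected derivative is
  -- again 𝔟-covariant and the claim can be tested on 𝔘(𝔨).
  have hTvel : ∀ (y : GroupLieAlgebra 𝓘(ℝ, EK) K) (c : ℝ → K), IsCurve (E := EK) c y → ∀ u k,
      HasVelocity (fun t => T (k * c t) u)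
        (T k (SuperEnv.ι (P.emb (mfderiv 𝓘(ℝ, EK) 𝓘(ℝ, E) φK 1 y : E)) * u)) := by
    intro y c hc u k
    refine hasVelocity_of_map hsup hπ (T := fun t => T (k * c t)) (T' := (T k).comp
      (LinearMap.mulLeft ℂ (SuperEnv.ι (P.emb (mfderiv 𝓘(ℝ, EK) 𝓘(ℝ, E) φK 1 y : E)))))
      (fun t => hTb _) (fun z hz u => ?_) (fun u => ?_) u
    · rw [LinearMap.comp_apply, LinearMap.mulLeft_apply, ← mul_assoc, hTb k z hz]
      rfl
    · have h := hcov.velocity y c hc u k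
      simp only [hTmap, LinearMap.comp_apply, LinearMap.mulLeft_apply]
      rw [← hPK.emb, ← SuperEnv.map_ι, ← map_mul, hTmap]
      exact h
  set η : G → G := fun g => φA (α g) * φN (ν g) with hη
  set F := extendGroup P π κ η T with hFdef
  have hF : IsCovariant P π (minimalParabolic h𝔞 hS).toSubmodule F :=
    isCovariant_extendGroup hπ hPK.smooth hφA hφN hA' hN' hκ hα hν hg hTvel hTq
  have hFK : ∀ k, F (φK k) = T k := by
    intro k
    obtain ⟨h1, h2, h3⟩ := hgK k
    have h4 : η (φK k) = 1 := by simp only [hη, h2, h3, map_one, mul_one]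
    ext u
    rw [hFdef, extendGroup_apply, h4, h1, inv_one, map_one, P.map_Ad_one, Module.End.one_apply]
  have heqA : ∀ {F : G → SuperEnv 𝔤 →ₗ[ℂ] V},
      IsCovariant P π (minimalParabolic h𝔞 hS).toSubmodule F →
      ∀ a, φA a ∈ equivariantSubgroup P π F := fun hF a u p => hF.equivariant hπ hφA hA' a u p
  have heqN : ∀ {F : G → SuperEnv 𝔤 →ₗ[ℂ] V},
      IsCovariant P π (minimalParabolic h𝔞 hS).toSubmodule F →
      ∀ n, φN n ∈ equivariantSubgroup P π F := fun hF n u p => hF.equivariant hπ hφN hN' n u p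
  have heq : ∀ {F : G → SuperEnv 𝔤 →ₗ[ℂ] V},
      IsCovariant P π (minimalParabolic h𝔞 hS).toSubmodule F →
      ∀ g, η g ∈ equivariantSubgroup P π F := fun hF g => mul_mem (heqA hF _) (heqN hF _)
  refine ⟨LinearMap.pi F, mem_ind_of_isCovariant hF (fun u => ?_) ?_, ?_⟩
  · have hcη : Continuous η := by
      have : IsTopologicalGroup G := topologicalGroup_of_lieGroup 𝓘(ℝ, E) ∞
      exact (hφA.continuous.comp hα.continuous).mul (hφN.continuous.comp hν.continuous)
    refine continuous_extendGroup hπ hcη (fun w => continuous_iff_continuousAt.2 fun p =>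
      tendsto_of_map hsup hπ (fun _ => hTb _) (hTb _) (fun u => ?_) w) u
    simp only [hTmap]
    exact ((ind_continuous ⟨f, hf⟩ u).comp hκ.continuous).tendsto p
  -- The elements under which F is equivariant form a subgroup, so the generators M₀, A and N₀ of Q₀
  -- suffice.
  · refine sup_le (sup_le ?_ ?_) ?_
    · rintro _ ⟨m, hm, rfl⟩
      have hm' : m⁻¹ ∈ centralizerGroup P 𝔞 φK := inv_mem hm
      have htr := hF.translate hπ (m := φK m) (fun z hz => by
        rw [← map_inv]
        refine Ad_mem_minimalParabolic h𝔞 hS hm' (fun x hx => ?_) hz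
        have h := hPK.Ad m⁻¹ ⟨x, hx⟩
        exact h ▸ (PK.Ad m⁻¹ ⟨x, hx⟩).2)
      have h : F = translate P π (φK m) F := by
        refine eq_of_eq_on_maximalCompact hsup (hF.mono hle) (htr.mono hle) hg (heq hF) (heq htr)
          fun k u => ?_
        rw [translate_apply, ← map_inv, hPK.map_Ad, ← map_mul, hFK, hFK, hTmap, hTmap]
        exact hfM m hm u k
      exact fun u p => DFunLike.congr_fun (congr_fun h p) u
    · rintro _ ⟨a, rfl⟩
      exact heqA hF a
    · rintro _ ⟨n, rfl⟩
      exact heqN hF n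
  · ext u k
    rw [restrictSuperfunction_apply, LinearMap.pi_apply, hFK, hTmap]

end Iwasawa

/-! ### Continuity of the inverse of restriction -/

section Homeomorphism

variable {𝔤 : Type*} [NormedAddCommGroup 𝔤] [NormedSpace ℂ 𝔤] [FiniteDimensional ℂ 𝔤]
  [LieSuperalgebra 𝔤]
  {E : Type*} [NormedAddCommGroup E] [NormedSpace ℝ E] [FiniteDimensional ℝ E]
  {G : Type*} [Group G] [TopologicalSpace G] [ChartedSpace E G] [LieGroup 𝓘(ℝ, E) ∞ G]
  {EK : Type*} [NormedAddCommGroup EK] [NormedSpace ℝ EK] [FiniteDimensional ℝ EK]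
  {K : Type*} [Group K] [TopologicalSpace K] [ChartedSpace EK K] [LieGroup 𝓘(ℝ, EK) ∞ K]
  {V : Type*} [AddCommGroup V] [Module ℂ V] [SuperModule V] [UniformSpace V] [LCSuperSpace V]
  {P : CsSupergroupPair 𝔤 E G} {π : SuperRep 𝔤 G V} {𝔥 𝔨 𝔟 : LieSubsuperalgebra 𝔤}
  {H : Subgroup G} {φK : K →* G}

theorem le_equivariantSubgroup {f : SuperEnv 𝔤 →ₗ[ℂ] (G → V)}
    (hf : f ∈ ind P 𝔥 H (π.restrict 𝔥.incl H.subtype)) :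
    H ≤ equivariantSubgroup P π (fun p => (LinearMap.proj p).comp f) := fun h hh u p =>
  hf.2.1 ⟨h, hh⟩ u p

/-- The Iwasawa formula expresses f on G₀ through its values on K₀, and covariance reduces these to
𝔘(𝔨). Every ingredient is jointly continuous, so the topology is already detected by the
restriction. -/
theorem continuous_ind_of_restrict (hπ : P.IsSmoothRep π)
    (hsup : 𝔨.toSubmodule ⊔ 𝔟.toSubmodule = ⊤) (hle : 𝔟.toSubmodule ≤ 𝔥.toSubmodule) {κ : G → K}
    {η : G → G} (hκ : Continuous κ) (hη : Continuous η) (hg : ∀ g, φK (κ g) * η g = g)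
    (hηH : ∀ g, η g ∈ H) {X : Type*} [TopologicalSpace X]
    {Φ : X → ind P 𝔥 H (π.restrict 𝔥.incl H.subtype)}
    (hΦ : ∀ u, Continuous fun q : X × K => (Φ q.1).1 (SuperEnv.map 𝔨.incl u) (φK q.2)) :
    Continuous Φ := by
  refine continuous_ind_iff.2 fun u => ?_
  have e : (fun q : X × G => (Φ q.1).1 u q.2) = fun q : X × G => π.grp (η q.2)⁻¹
      (((LinearMap.proj (φK (κ q.2))).comp (Φ q.1).1 : SuperEnv 𝔤 →ₗ[ℂ] V)
        (SuperEnv.map (P.Ad (η q.2)) u)) := by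
    ext q
    have h := extendGroup_restrict (fun g => le_equivariantSubgroup (Φ q.1).2 (hηH g)) hg q.2
    exact DFunLike.congr_fun h u
  rw [e]
  have hcov := fun x => (isCovariant_of_mem_ind (Φ x).2).mono hle
  refine continuous_iff_continuousAt.2 fun q => tendsto_grp_inv_map_Ad hπ
    ((hη.comp continuous_snd).tendsto q) (fun w => ?_) u
  refine tendsto_of_map hsup hπ (fun q z hz u => (hcov q.1).right z hz u _)
    (fun z hz u => (hcov q.1).right z hz u _) (fun u => ?_) w
  exact ((hΦ u).comp (continuous_fst.prodMk (hκ.comp continuous_snd))).tendsto q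

end Homeomorphism

end

end CsSuper

/-! ### The isomorphism of induced representations -/

theorem mainTheorem10
    {𝔤 : Type*} [NormedAddCommGroup 𝔤] [NormedSpace ℂ 𝔤] [FiniteDimensional ℂ 𝔤]
    [LieSuperalgebra 𝔤]
    {E : Type*} [NormedAddCommGroup E] [NormedSpace ℝ E] [FiniteDimensional ℝ E]
    {G : Type*} [Group G] [TopologicalSpace G] [ChartedSpace E G] [LieGroup 𝓘(ℝ, E) ∞ G]
    {EK : Type*} [NormedAddCommGroup EK] [NormedSpace ℝ EK] [FiniteDimensional ℝ EK]
    {K : Type*} [Group K] [TopologicalSpace K] [ChartedSpace EK K] [LieGroup 𝓘(ℝ, EK) ∞ K]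
    {EA : Type*} [NormedAddCommGroup EA] [NormedSpace ℝ EA] [FiniteDimensional ℝ EA]
    {A : Type*} [Group A] [TopologicalSpace A] [ChartedSpace EA A] [LieGroup 𝓘(ℝ, EA) ∞ A]
    {EN : Type*} [NormedAddCommGroup EN] [NormedSpace ℝ EN] [FiniteDimensional ℝ EN]
    {N : Type*} [Group N] [TopologicalSpace N] [ChartedSpace EN N] [LieGroup 𝓘(ℝ, EN) ∞ N]
    -- the reductive symmetric superpair and its non-compact global form
    (P : CsSupergroupPair 𝔤 E G) (θ : LieSuperHom 𝔤 𝔤) (θ₀ : G →* G)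
    (φK : K →* G) (φA : A →* G) (φN : N →* G)
    (hθ : IsReductiveSymmetricSuperpair θ)
    (hform : P.IsNoncompactGlobalForm θ θ₀ EK φK)
    -- the real even Cartan subspace and the positive system
    (aR : Submodule ℝ (GroupLieAlgebra 𝓘(ℝ, E) G))
    (h𝔞 : IsEvenCartan θ (P.complexify aR))
    (S : Set (Module.Dual ℂ (P.complexify aR)))
    (hS : IsPositiveSystem (P.complexify aR) S)
    -- the global Iwasawa decomposition
    (hA : IsAnalyticSubgroup EA φA aR)
    (hN : IsAnalyticSubgroup EN φN (P.realPart (positivePart (P.complexify aR) S)))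
    (hIw : HasGlobalIwasawa EK EA EN E φK φA φN)
    -- the subpair `(𝔨, K₀)`
    (PK : CsSupergroupPair (LieSubsuperalgebra.fixed θ).Carrier EK K)
    (hPK : PK.IsMorphism P (LieSubsuperalgebra.fixed θ).incl φK)
    -- the smooth representation
    {V : Type*} [AddCommGroup V] [Module ℂ V] [SuperModule V] [UniformSpace V] [LCSuperSpace V]
    (π : SuperRep 𝔤 G V) (hπ : P.IsSmoothRep π) :
    let 𝔨 := LieSubsuperalgebra.fixed θ
    let 𝔮 := minimalParabolic h𝔞 hS
    let Q₀ := minimalParabolicGroup P (P.complexify aR) φK φA φN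
    let 𝔪 := centralizerInK h𝔞
    let M₀ := centralizerGroup P (P.complexify aR) φK
    let πQ := π.restrict 𝔮.incl Q₀.subtype
    let πM := π.restrict (𝔨.incl.comp 𝔪.incl) (φK.comp M₀.subtype)
    LCSuperSpace (ind P 𝔮 Q₀ πQ) ∧ LCSuperSpace (ind PK 𝔪 M₀ πM) ∧
    ∃ (ρG : SuperRep 𝔤 G (ind P 𝔮 Q₀ πQ)) (ρK : SuperRep 𝔨.Carrier K (ind PK 𝔪 M₀ πM)),
      IsInducedAction P 𝔮 Q₀ πQ ρG ∧ IsInducedAction PK 𝔪 M₀ πM ρK ∧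
      PK.IsSmoothRep (ρG.restrict 𝔨.incl φK) ∧ PK.IsSmoothRep ρK ∧
      ∃ Ψ : ind P 𝔮 Q₀ πQ ≃L[ℂ] ind PK 𝔪 M₀ πM,
        (∀ f u k, (Ψ f).1 u k = f.1 (SuperEnv.map 𝔨.incl u) (φK k)) ∧
        (ρG.restrict 𝔨.incl φK).IsIntertwining ρK Ψ := by
  intro 𝔨 𝔮 Q₀ 𝔪 M₀ πQ πM
  have := hA.connected
  have := hN.connected
  have htop := iSup_rootSpace_eq_top hform.toIsNoncompactForm h𝔞
  have hcompl := isCompl_fixed_cartanPositive hθ.involutive h𝔞 hS htop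
  have hsup := codisjoint_iff.1 hcompl.codisjoint
  have hle := cartanPositive_le h𝔞 hS
  have hA' : ∀ y : GroupLieAlgebra 𝓘(ℝ, EA) A,
      P.emb (mfderiv 𝓘(ℝ, EA) 𝓘(ℝ, E) φA 1 y : E) ∈ P.complexify aR := fun y =>
    Submodule.subset_span ⟨_, (hA.range_deriv _).2 ⟨y, rfl⟩, rfl⟩
  have hN' : ∀ y : GroupLieAlgebra 𝓘(ℝ, EN) N,
      P.emb (mfderiv 𝓘(ℝ, EN) 𝓘(ℝ, E) φN 1 y : E) ∈ positivePart (P.complexify aR) S := fun y =>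
    (hN.range_deriv _).2 ⟨y, rfl⟩
  have h𝔪 : ∀ x ∈ 𝔪.toSubmodule, (x : 𝔤) ∈ 𝔮.toSubmodule := coe_mem_minimalParabolic h𝔞 hS
  have hM : ∀ m ∈ M₀, φK m ∈ Q₀ := fun m hm =>
    Subgroup.mem_sup_left (Subgroup.mem_sup_left ⟨m, hm, rfl⟩)
  let R : ind P 𝔮 Q₀ πQ →ₗ[ℂ] ind PK 𝔪 M₀ πM :=
    (restrictSuperfunction 𝔨 φK).restrict fun f hf => restrictSuperfunction_mem hPK h𝔪 hM hf
  have hR : ∀ f u k, (R f).1 u k = f.1 (SuperEnv.map 𝔨.incl u) (φK k) := fun _ _ _ => rfl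
  obtain ⟨κ, α, ν, hκ, hα, hν, hg, -⟩ := hIw.exists_factors
  have hη : ∀ g, φA (α g) * φN (ν g) ∈ Q₀ := fun g =>
    mul_mem (Subgroup.mem_sup_left (Subgroup.mem_sup_right ⟨_, rfl⟩))
      (Subgroup.mem_sup_right ⟨_, rfl⟩)
  have hcη : Continuous fun g => φA (α g) * φN (ν g) := by
    have : IsTopologicalGroup G := topologicalGroup_of_lieGroup 𝓘(ℝ, E) ∞
    exact (hA.smooth.continuous.comp hα.continuous).mul (hN.smooth.continuous.comp hν.continuous)
  have hinj : Function.Injective R := fun f f' hff' => by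
    have h := eq_of_eq_on_maximalCompact hsup ((isCovariant_of_mem_ind f.2).mono hle)
      ((isCovariant_of_mem_ind f'.2).mono hle) hg (fun g => le_equivariantSubgroup f.2 (hη g))
      (fun g => le_equivariantSubgroup f'.2 (hη g))
      (fun k u => congr_fun (DFunLike.congr_fun (congr_arg Subtype.val hff') u) k)
    ext u p
    exact DFunLike.congr_fun (congr_fun h p) u
  have hsurj : Function.Surjective R := fun f => by
    obtain ⟨f', hf', e⟩ := exists_restrictSuperfunction_eq hπ h𝔞 hS hcompl hPK hA.smooth hN.smooth
      hA' hN' hIw f.2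
    exact ⟨⟨f', hf'⟩, Subtype.ext e⟩
  let Ψ := LinearEquiv.ofBijective R ⟨hinj, hsurj⟩
  have hΨ : Continuous Ψ := continuous_ind_iff.2 fun u =>
    (continuous_ind_eval (SuperEnv.map 𝔨.incl u)).comp
      (continuous_fst.prodMk (hPK.smooth.continuous.comp continuous_snd))
  have hΨ' : Continuous Ψ.symm := by
    refine continuous_ind_of_restrict hπ hsup hle hκ.continuous hcη hg hη fun u => ?_
    have e : ∀ (f : ind PK 𝔪 M₀ πM) (k : K),
        (Ψ.symm f).1 (SuperEnv.map 𝔨.incl u) (φK k) = f.1 u k := fun f k => by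
      rw [← hR]
      exact congr_arg (fun f : ind PK 𝔪 M₀ πM => f.1 u k) (Ψ.apply_symm_apply f)
    exact (continuous_ind_eval u).congr fun q => (e q.1 q.2).symm
  have hpar : ∀ f, R (indParity P 𝔮 Q₀ πQ f) = indParity PK 𝔪 M₀ πM (R f) := fun f => by
    ext u k
    rw [hR, ind_parity_apply, ind_parity_apply, hR, SuperEnv.parity_map]
  -- Stated as an equality of maps linear in x, so that it may be checked on homogeneous x, where
  -- the sign is a twist of f commuting with restriction.
  have halg : ∀ f, R.comp (((indRep P 𝔮 Q₀ πQ).alg.comp 𝔨.incl.toLin).flip f) =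
      (indRep PK 𝔪 M₀ πM).alg.flip (R f) := fun f => SuperModule.linearMap_ext_part
      (V := 𝔨.Carrier) (W := ind PK 𝔪 M₀ πM) fun i x hx => by
    ext u k
    have h1 := (isInducedAction_indRep P 𝔮 Q₀ πQ).alg i (𝔨.incl x) (𝔨.incl.map_part hx) f
      (SuperEnv.map 𝔨.incl u) (φK k)
    have h2 := (isInducedAction_indRep PK 𝔪 M₀ πM).alg i x hx (R f) u k
    have h3 : R (indTwist P 𝔮 Q₀ πQ i f) = indTwist PK 𝔪 M₀ πM i (R f) := by
      rcases parity_cases i with rfl | rfl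
      · rfl
      · exact hpar f
    have h4 : (indTwist PK 𝔪 M₀ πM i (R f)).1 (SuperEnv.ι (PK.Ad k⁻¹ x) * u) k =
        (indTwist P 𝔮 Q₀ πQ i f).1 (SuperEnv.ι (P.Ad (φK k)⁻¹ (𝔨.incl x)) * SuperEnv.map 𝔨.incl u)
          (φK k) := by
      rw [← h3, hR, map_mul, SuperEnv.map_ι, hPK.Ad, map_inv]
    exact h1.trans ((congr_arg Neg.neg h4.symm).trans h2.symm)
  refine ⟨inferInstance, inferInstance, indRep P 𝔮 Q₀ πQ, indRep PK 𝔪 M₀ πM,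
    isInducedAction_indRep P 𝔮 Q₀ πQ, isInducedAction_indRep PK 𝔪 M₀ πM,
    (isSmoothRep_indRep P 𝔮 Q₀ πQ).restrict hPK, isSmoothRep_indRep PK 𝔪 M₀ πM,
    { Ψ with continuous_toFun := hΨ, continuous_invFun := hΨ' }, hR, hpar, fun k f => ?_,
    fun x f => DFunLike.congr_fun (halg f) x⟩
  ext u l
  change f.1 (SuperEnv.map 𝔨.incl u) ((φK k)⁻¹ * φK l) =
    f.1 (SuperEnv.map 𝔨.incl u) (φK (k⁻¹ * l))
  rw [map_mul, map_inv]
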